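/- **Notation.** Write $\langle a\rangle=\sqrt{1+a^2}$, and for functions of $(t,x)\in[0,\infty)\times\mathbb R^3$ write $\partial_0=\partial_t$, $\partial_j=\partial/\partial x_j$, $\Omega_{jk}=x_j\partial_k-x_k\partial_j$ $(1\le j<k\le 3)$, and $\square_c=\partial_t^2-c^2\Delta_x$. For $x\neq0$ let $D_{+,c}=\partial_t+c\,\partial_r$ with $\partial_r=\sum_{j=1}^3\frac{x_j}{|x|}\partial_j$. Let $Z=(Z_1,\dots,Z_7)=(\partial_0,\partial_1,\partial_2,\partial_3,\Omega_{12},\Omega_{13},\Omega_{23})$, $Z^\alpha=Z_1^{\alpha_1}\cdots Z_7^{\alpha_7}$ for a multi-index $\alpha$, and $|v(t,x)|_s=\sum_{|\alpha|\le s}|Z^\alpha v(t,x)|$; functions of $x$ alone are regarded as functions of $(t,x)$ not depending on $t$. Fix $c>0$, an integer $N\ge0$ and positive constants $c_1,\dots,c_N$ (arbitrary), put $c_0=0$, and let $$w(t,r)=\min_{0\le j\le N}\langle c_jt-r\rangle .$$ For a real-valued $G$ smooth on $[0,\infty)\times\mathbb R^3$ and real-valued $\phi,\psi$ smooth on $\mathbb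 R^3$ let $$A_{\rho,\mu,s}[G;c](t,x)=\sup\bigl\{|y|\,\langle\tau+|y|\rangle^{\rho}\,w(\tau,|y|)^{1+\mu}\,|G(\tau,y)|_s:\ 0\le\tau\le t,\ y\in\mathbb R^3,\ |y-x|\le c(t-\tau)\bigr\},$$ $$B_{\rho,s}[\phi,\psi;c](t,x)=\sup\bigl\{\langle|y|\rangle^{\rho}\bigl(|\phi(y)|_{s+1}+|\psi(y)|_s\bigr):\ y\in\mathbb R^3,\ |y-x|\le ct\bigr\}.$$ Solutions are classical solutions, of class $C^2$ on $[0,\infty)\times\mathbb R^3$. **Theorem.** Let $1\le\kappa\le2$ and $\mu>0$. In the following, the constants $C>0$ may depend on $\kappa$, $\mu$ and the fixed numbers $c,c_1,\dots,c_N$ (and on $\delta$ where indicated), but not on $G,\phi,\psi,u,u^*,t,x$. (i) There is a constant $C$ such that, whenever $G$ is smooth on $[0,\infty)\times\mathbb R^3$ and $u$ solves $\square_cu=G$ in $(0,\infty)\times\mathbb R^3$ with $u=\partial_tu=0$ at $t=0$, $$\langle|x|\rangle\,\langle t+|x|\rangle\,\langle ct-|x|\rangle^{\kappa-1}\{\log(2+t+|x|)\}^{-1}\,|D_{+,c}u(t,x)|\le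 C\,A_{\kappa,\mu,2}[G;c](t,x)$$ for all $t>0$ and $x\in\mathbb R^3$ with $x\ne0$. Moreover, if $1<\kappa<2$, then for every $\delta>0$ there is a constant $C$, depending also on $\delta$, such that for all such $G$ and $u$ $$\langle t+|x|\rangle^{2}\,\langle ct-|x|\rangle^{\kappa-1}\,|D_{+,c}u(t,x)|\le C\,A_{\kappa,\mu,2}[G;c](t,x)$$ for all $t>0$ and $x\in\mathbb R^3$ with $|x|>\delta t$. (ii) There is a constant $C$ such that, whenever $\phi,\psi$ are smooth on $\mathbb R^3$ and $u^*$ solves $\square_cu^*=0$ in $(0,\infty)\times\mathbb R^3$ with $u^*=\phi$ and $\partial_tu^*=\psi$ at $t=0$, $$\langle|x|\rangle\,\langle t+|x|\rangle\,\langle ct-|x|\rangle^{\kappa-1}\,|D_{+,c}u^*(t,x)|\le C\,B_{\kappa+\mu+1,2}[\phi,\psi;c](t,x)$$ for all $t>0$ and $x\in\mathbb R^3$ with $x\ne0$. -/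

import Mathlib

open scoped ContDiff

namespace WaveDecay

/-- The space `ℝ³` with its Euclidean norm. -/
abbrev E3 : Type := EuclideanSpace ℝ (Fin 3)

/-- The closed half-space `[0, ∞) × ℝ³` of points `(t, x)`. -/
def halfSpace : Set (ℝ × E3) := Set.Ici (0 : ℝ) ×ˢ Set.univ

/-- The bracket `⟨a⟩ = √(1 + a²)`. -/
noncomputable def jb (a : ℝ) : ℝ := Real.sqrt (1 + a ^ 2)

/-- The time derivative `∂_0 = ∂_t` on `[0, ∞) × ℝ³` (one-sided at `t = 0`, the usual one for
`t > 0`). -/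
noncomputable def dt (v : ℝ × E3 → ℝ) (p : ℝ × E3) : ℝ :=
  fderivWithin ℝ v halfSpace p ((1 : ℝ), (0 : E3))

/-- The space derivative `∂_j = ∂/∂x_j` on `[0, ∞) × ℝ³`; the coordinates are numbered
`0, 1, 2`. -/
noncomputable def dx (j : Fin 3) (v : ℝ × E3 → ℝ) (p : ℝ × E3) : ℝ :=
  fderivWithin ℝ v halfSpace p ((0 : ℝ), (EuclideanSpace.single j (1 : ℝ) : E3))

/-- The rotation field `Ω_{jk} = x_j ∂_k - x_k ∂_j`. -/
noncomputable def rot (j k : Fin 3) (v : ℝ × E3 → ℝ) (p : ℝ × E3) : ℝ :=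
  p.2 j * dx k v p - p.2 k * dx j v p

/-- The seven vector fields `∂_t, ∂_1, ∂_2, ∂_3, Ω_{12}, Ω_{13}, Ω_{23}`, in this order. -/
noncomputable def zField : Fin 7 → (ℝ × E3 → ℝ) → (ℝ × E3 → ℝ) :=
  ![dt, dx 0, dx 1, dx 2, rot 0 1, rot 0 2, rot 1 2]

/-- `Z^α = Z_1^{α_1} Z_2^{α_2} ⋯ Z_7^{α_7}` for a multi-index `α`. -/
noncomputable def zPow (α : Fin 7 → ℕ) (v : ℝ × E3 → ℝ) : ℝ × E3 → ℝ :=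
  (zField 0)^[α 0] ((zField 1)^[α 1] ((zField 2)^[α 2] ((zField 3)^[α 3]
    ((zField 4)^[α 4] ((zField 5)^[α 5] ((zField 6)^[α 6] v))))))

/-- `|v(t,x)|_s = ∑_{|α| ≤ s} |Z^α v(t,x)|`. -/
noncomputable def zNorm (s : ℕ) (v : ℝ × E3 → ℝ) (p : ℝ × E3) : ℝ :=
  ∑ k ∈ Finset.range (s + 1), ∑ α ∈ Finset.piAntidiag (Finset.univ : Finset (Fin 7)) k,
    |zPow α v p|

/-- `|φ(y)|_s` for a function `φ` on `ℝ³`, regarded as a function of `(t, x)` that does not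
depend on `t`. -/
noncomputable def zNormData (s : ℕ) (φ : E3 → ℝ) (y : E3) : ℝ :=
  zNorm s (fun p => φ p.2) ((0 : ℝ), y)

/-- The weight `w(t, r) = min_{0 ≤ j ≤ N} ⟨c_j t - r⟩` with `c_0 = 0`; the constants
`c_1, …, c_N` are the entries of `cs`. -/
noncomputable def weight {N : ℕ} (cs : Fin N → ℝ) (t r : ℝ) : ℝ :=
  (Finset.univ : Finset (Fin (N + 1))).inf' Finset.univ_nonempty
    (fun j => jb ((Fin.cons 0 cs : Fin (N + 1) → ℝ) j * t - r))

/-- The backward cone `Λ_c(t,x) = {(τ,y) ∈ [0,t] × ℝ³ : |y - x| ≤ c (t - τ)}`. -/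
def cone (c t : ℝ) (x : E3) : Set (ℝ × E3) :=
  {q | 0 ≤ q.1 ∧ q.1 ≤ t ∧ ‖q.2 - x‖ ≤ c * (t - q.1)}

/-- The ball `Λ'_c(t,x) = {y ∈ ℝ³ : |y - x| ≤ c t}`. -/
def coneBase (c t : ℝ) (x : E3) : Set E3 := {y | ‖y - x‖ ≤ c * t}

/-- `A_{ρ,μ,s}[G;c](t,x)`, the supremum over `(τ,y) ∈ Λ_c(t,x)` of
`|y| ⟨τ+|y|⟩^ρ w(τ,|y|)^{1+μ} |G(τ,y)|_s`. For `t ≥ 0` and `G` smooth on `[0, ∞) × ℝ³` this is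
the supremum of a continuous function over a non-empty compact set. -/
noncomputable def normA {N : ℕ} (cs : Fin N → ℝ) (ρ μ : ℝ) (s : ℕ) (G : ℝ × E3 → ℝ) (c t : ℝ)
    (x : E3) : ℝ :=
  sSup ((fun q : ℝ × E3 =>
    ‖q.2‖ * jb (q.1 + ‖q.2‖) ^ ρ * weight cs q.1 ‖q.2‖ ^ (1 + μ) * zNorm s G q) '' cone c t x)

/-- `B_{ρ,s}[φ,ψ;c](t,x)`, the supremum over `y ∈ Λ'_c(t,x)` of
`⟨|y|⟩^ρ (|φ(y)|_{s+1} + |ψ(y)|_s)`; for smooth data again the supremum of a continuous function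
over a non-empty compact set. -/
noncomputable def normB (ρ : ℝ) (s : ℕ) (φ ψ : E3 → ℝ) (c t : ℝ) (x : E3) : ℝ :=
  sSup ((fun y : E3 =>
    jb ‖y‖ ^ ρ * (zNormData (s + 1) φ y + zNormData s ψ y)) '' coneBase c t x)

/-- The d'Alembertian `□_c = ∂_t² - c² Δ_x`. -/
noncomputable def box (c : ℝ) (u : ℝ × E3 → ℝ) (p : ℝ × E3) : ℝ :=
  dt (dt u) p - c ^ 2 * ∑ j : Fin 3, dx j (dx j u) p

/-- `u` is the classical solution of `□_c u = G` in `(0, ∞) × ℝ³` with `u = φ` and `∂_t u = ψ`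
at `t = 0`. -/
structure IsSolution (c : ℝ) (G : ℝ × E3 → ℝ) (φ ψ : E3 → ℝ) (u : ℝ × E3 → ℝ) : Prop where
  contDiffOn : ContDiffOn ℝ 2 u halfSpace
  eqn : ∀ (t : ℝ) (x : E3), 0 < t → box c u (t, x) = G (t, x)
  init : ∀ x : E3, u (0, x) = φ x
  init_dt : ∀ x : E3, dt u (0, x) = ψ x

/-- `D_{+,c} = ∂_t + c ∂_r` with `∂_r = ∑_j (x_j / |x|) ∂_j`, meant for `x ≠ 0`. -/
noncomputable def dPlus (c : ℝ) (u : ℝ × E3 → ℝ) (p : ℝ × E3) : ℝ :=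
  dt u p + c * ∑ j : Fin 3, p.2 j / ‖p.2‖ * dx j u p

end WaveDecay

open WaveDecay

/-! The estimates rest on one identity (`hasDerivAt_charFun`). Along a backward characteristic,
parametrised by the distance `ρ` from a fixed centre in a fixed direction `ν`, one has `(∂_t -
c∂_ν)(∂_t + c∂_ν)(ρu) = ρ □_c u + c² ρ⁻¹ Δ_S u`, where `Δ_S` is the Laplacian of the unit sphere
about the centre. It is used for two centres.

With the centre at `x`, averaging over `ν` removes the spherical Laplacian
(`integral_sphLap_eq_zero`) and leaves Kirchhoff's formula (`kirchhoff`). With the centre at the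
origin and `ν = x/|x|`, the spherical Laplacian is the sum of the `Ω_{jk}² u` (`sphLap_eq_sum_rot`),
and integration gives `|x| D_+ u = -c u + (data) + ∫ (ρ G + c² ρ⁻¹ ∑ Ω_{jk}² u)` along the
characteristic (`mul_abs_dPlus_le`). The factor `|x|` on the left and the `ρ⁻¹` in the integral give
the extra decay of this derivative.

The right-hand side needs pointwise bounds for `u` and `Ω_{jk}² u`. Kirchhoff's integral is
covariant under rotations, so `Ω_{jk}² u` is the Kirchhoff integral of `Ω_{jk}² G`, although `u` is
only `C²`. For such integrals, Archimedes' hat-box theorem (`integral_sphere_le`) turns a spherical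
mean into an integral over `|y|`. In the variable `p = cτ + |y|` the weights become brackets of
`(c_j + c)τ - p`; their powers `-(1+μ)` are integrable in `τ`, so there remains `r⁻¹
∫_{|ct-r|}^{ct+r} ⟨p⟩^{-κ} dp` with `r = |x|` (`abs_retPot_le_of_weight`). For `κ > 1` this is at
most a multiple of `⟨t+r⟩⁻¹⟨ct-r⟩^{1-κ}`, and for `κ = 1` there is an additional logarithm.

For `r ≥ 1` these bounds are inserted in the characteristic identity; the integral of
`s⁻¹⟨X-2s⟩^{-β}` with `X = ct + r` then produces the logarithm in general and none if `r > δt` and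
`1 < κ < 2`. For `r ≤ 1` division by `r` is too costly, and Kirchhoff's formula is differentiated
instead; there `⟨r⟩` is bounded. For `κ = 1` the bound for `Ω_{jk}² u` is taken with half powers and
no logarithm, as otherwise the logarithm would appear squared.

The homogeneous equation is treated in the same way, with spherical means of the data in place of
retarded potentials. The additional decay `μ` of the data absorbs the logarithm. -/

namespace WaveDecay

open Set Filter Topology MeasureTheory

/-! ### Calculus on the closed half-space -/

theorem mem_halfSpace {p : ℝ × E3} : p ∈ halfSpace ↔ 0 ≤ p.1 := by
  simp [halfSpace]

theorem uniqueDiffOn_halfSpace : UniqueDiffOn ℝ halfSpace :=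
  (uniqueDiffOn_Ici 0).prod uniqueDiffOn_univ

/-- This makes second derivatives within the closed half-space symmetric on the boundary `t = 0`
too. -/
theorem halfSpace_subset_closure_interior : halfSpace ⊆ closure (interior halfSpace) := by
  intro p hp
  rw [halfSpace, interior_prod_eq, closure_prod_eq]
  simpa [mem_halfSpace] using hp

/-- The (one-sided at `t = 0`) total derivative on the half-space. -/
noncomputable abbrev hD {F : Type*} [NormedAddCommGroup F] [NormedSpace ℝ F]
    (f : ℝ × E3 → F) : ℝ × E3 → (ℝ × E3 →L[ℝ] F) := fderivWithin ℝ f halfSpace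

/-- The second total derivative on the half-space. -/
noncomputable abbrev hD2 {F : Type*} [NormedAddCommGroup F] [NormedSpace ℝ F]
    (f : ℝ × E3 → F) : ℝ × E3 → (ℝ × E3 →L[ℝ] ℝ × E3 →L[ℝ] F) := hD (hD f)

section Curves

variable {F : Type*} [NormedAddCommGroup F] [NormedSpace ℝ F] {f : ℝ × E3 → F}
  {γ : ℝ → ℝ × E3} {γ' : ℝ × E3} {s : ℝ}

/-- The curve has to stay in the half-space only near `s`, and it may run inside the boundary `t =
0`. The derivative along it is then two-sided although the total derivative is one-sided there. -/
theorem hasDerivAt_comp_curve (hf : ContDiffOn ℝ 1 f halfSpace) (hγ : HasDerivAt γ γ' s)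
    (hm : ∀ᶠ r in 𝓝 s, γ r ∈ halfSpace) :
    HasDerivAt (fun r => f (γ r)) (hD f (γ s) γ') s :=
  ((hf.differentiableOn one_ne_zero _ hm.self_of_nhds).hasFDerivWithinAt).comp_hasDerivAt s hγ hm

theorem contDiffOn_hD {n : ℕ∞ω} (hf : ContDiffOn ℝ (n + 1) f halfSpace) :
    ContDiffOn ℝ n (hD f) halfSpace :=
  hf.fderivWithin uniqueDiffOn_halfSpace le_rfl

theorem hasDerivAt_hD_comp_curve (hf : ContDiffOn ℝ 2 f halfSpace) (hγ : HasDerivAt γ γ' s)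
    (hm : ∀ᶠ r in 𝓝 s, γ r ∈ halfSpace) {w : ℝ → ℝ × E3} {w' : ℝ × E3}
    (hw : HasDerivAt w w' s) :
    HasDerivAt (fun r => hD f (γ r) (w r)) (hD2 f (γ s) γ' (w s) + hD f (γ s) w') s :=
  (hasDerivAt_comp_curve (contDiffOn_hD (by simpa [one_add_one_eq_two] using hf)) hγ hm).clm_apply hw

end Curves

theorem continuousOn_hD {f : ℝ × E3 → ℝ} (hf : ContDiffOn ℝ 1 f halfSpace) :
    ContinuousOn (hD f) halfSpace :=
  hf.continuousOn_fderivWithin uniqueDiffOn_halfSpace le_rfl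

theorem continuousOn_hD2 {f : ℝ × E3 → ℝ} (hf : ContDiffOn ℝ 2 f halfSpace) :
    ContinuousOn (hD2 f) halfSpace :=
  (contDiffOn_hD (n := 1) (by simpa [one_add_one_eq_two] using hf)).continuousOn_fderivWithin
    uniqueDiffOn_halfSpace le_rfl

theorem hD2_symm {f : ℝ × E3 → ℝ} (hf : ContDiffOn ℝ 2 f halfSpace) {p : ℝ × E3}
    (hp : p ∈ halfSpace) (v w : ℝ × E3) : hD2 f p v w = hD2 f p w v :=
  (hf p hp).isSymmSndFDerivWithinAt (by simp) uniqueDiffOn_halfSpace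
    (halfSpace_subset_closure_interior hp) hp v w

theorem hD_hD_apply {f : ℝ × E3 → ℝ} (hf : ContDiffOn ℝ 2 f halfSpace) {p : ℝ × E3}
    (hp : p ∈ halfSpace) (v w : ℝ × E3) : hD (fun q => hD f q w) p v = hD2 f p v w := by
  have h1 : DifferentiableWithinAt ℝ (hD f) halfSpace p :=
    (contDiffOn_hD (n := 1) (by simpa [one_add_one_eq_two] using hf)).differentiableOn
      one_ne_zero p hp
  have := fderivWithin_clm_apply (uniqueDiffOn_halfSpace p hp) h1
    (differentiableWithinAt_const (c := w))
  simp [hD, this]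

/-! ### The vector fields -/

theorem contDiffOn_hD_apply {f : ℝ × E3 → ℝ} (hf : ContDiffOn ℝ ∞ f halfSpace) (w : ℝ × E3) :
    ContDiffOn ℝ ∞ (fun p => hD f p w) halfSpace :=
  (contDiffOn_hD (n := ∞) (by simpa using hf)).clm_apply contDiffOn_const

theorem contDiffOn_dx {f : ℝ × E3 → ℝ} (hf : ContDiffOn ℝ ∞ f halfSpace) (j : Fin 3) :
    ContDiffOn ℝ ∞ (dx j f) halfSpace := contDiffOn_hD_apply hf _

theorem contDiff_coord (j : Fin 3) : ContDiff ℝ ∞ (fun p : ℝ × E3 => p.2 j) :=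
  (EuclideanSpace.proj (𝕜 := ℝ) j).contDiff.comp contDiff_snd

theorem contDiffOn_rot {f : ℝ × E3 → ℝ} (hf : ContDiffOn ℝ ∞ f halfSpace) (j k : Fin 3) :
    ContDiffOn ℝ ∞ (rot j k f) halfSpace :=
  ((contDiff_coord j).contDiffOn.mul (contDiffOn_dx hf k)).sub
    ((contDiff_coord k).contDiffOn.mul (contDiffOn_dx hf j))

theorem contDiffOn_zField {f : ℝ × E3 → ℝ} (hf : ContDiffOn ℝ ∞ f halfSpace) (i : Fin 7) :
    ContDiffOn ℝ ∞ (zField i f) halfSpace := by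
  fin_cases i
  · exact contDiffOn_hD_apply hf _
  · exact contDiffOn_dx hf _
  · exact contDiffOn_dx hf _
  · exact contDiffOn_dx hf _
  · exact contDiffOn_rot hf _ _
  · exact contDiffOn_rot hf _ _
  · exact contDiffOn_rot hf _ _

theorem contDiffOn_zField_iterate {f : ℝ × E3 → ℝ} (hf : ContDiffOn ℝ ∞ f halfSpace) (i : Fin 7)
    (n : ℕ) : ContDiffOn ℝ ∞ ((zField i)^[n] f) halfSpace := by
  induction n with
  | zero => exact hf
  | succ n ih => rw [Function.iterate_succ_apply']; exact contDiffOn_zField ih i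

theorem contDiffOn_zPow {f : ℝ × E3 → ℝ} (hf : ContDiffOn ℝ ∞ f halfSpace) (α : Fin 7 → ℕ) :
    ContDiffOn ℝ ∞ (zPow α f) halfSpace := by
  unfold zPow
  repeat' first | exact hf | apply contDiffOn_zField_iterate

theorem continuousOn_zNorm {f : ℝ × E3 → ℝ} (hf : ContDiffOn ℝ ∞ f halfSpace) (s : ℕ) :
    ContinuousOn (zNorm s f) halfSpace := by
  unfold zNorm
  exact continuousOn_finsetSum _ fun k _ => continuousOn_finsetSum _ fun α _ =>
    (contDiffOn_zPow hf α).continuousOn.abs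

theorem zNorm_nonneg (s : ℕ) (f : ℝ × E3 → ℝ) (p : ℝ × E3) : 0 ≤ zNorm s f p := by
  unfold zNorm; positivity

theorem abs_zPow_le_zNorm (f : ℝ × E3 → ℝ) (p : ℝ × E3) {α : Fin 7 → ℕ} {s : ℕ}
    (h : ∑ i, α i ≤ s) : |zPow α f p| ≤ zNorm s f p := by
  unfold zNorm
  have h1 : α ∈ Finset.piAntidiag (Finset.univ : Finset (Fin 7)) (∑ i, α i) := by
    simp [Finset.mem_piAntidiag]
  refine le_trans ?_ (Finset.single_le_sum (f := fun k =>
    ∑ α ∈ Finset.piAntidiag (Finset.univ : Finset (Fin 7)) k, |zPow α f p|)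
    (fun k _ => by positivity) (Finset.mem_range.2 (Nat.lt_succ_of_le h)))
  exact Finset.single_le_sum (f := fun α => |zPow α f p|) (fun _ _ => abs_nonneg _) h1

theorem zPow_single (i : Fin 7) (n : ℕ) (f : ℝ × E3 → ℝ) :
    zPow (Pi.single i n) f = (zField i)^[n] f := by
  fin_cases i <;> simp [zPow]

/-- `Z^α` applies its fields in a fixed order, so only compositions with increasing index are
literally of this form. -/
theorem zPow_single_add_single {i j : Fin 7} (hij : i < j) (m n : ℕ) (f : ℝ × E3 → ℝ) :
    zPow (Pi.single i m + Pi.single j n) f = (zField i)^[m] ((zField j)^[n] f) := by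
  fin_cases i <;> fin_cases j <;> first | (exfalso; revert hij; decide) |
    simp [zPow]

theorem abs_zField_iterate_le_zNorm (f : ℝ × E3 → ℝ) (p : ℝ × E3) (i : Fin 7) {n s : ℕ}
    (h : n ≤ s) : |(zField i)^[n] f p| ≤ zNorm s f p := by
  rw [← zPow_single]
  exact abs_zPow_le_zNorm f p (by simpa [Finset.sum_pi_single'] using h)

theorem abs_zField_comp_le_zNorm (f : ℝ × E3 → ℝ) (p : ℝ × E3) {i j : Fin 7} (hij : i < j)
    {m n s : ℕ} (h : m + n ≤ s) : |(zField i)^[m] ((zField j)^[n] f) p| ≤ zNorm s f p := by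
  rw [← zPow_single_add_single hij]
  exact abs_zPow_le_zNorm f p (by simpa [Finset.sum_add_distrib, Finset.sum_pi_single'] using h)

/-! ### Rotations as flows of the rotation fields -/

/-- The generator of the rotations in the `(j, k)` coordinate plane. -/
noncomputable def rotGen (j k : Fin 3) (y : E3) : E3 :=
  y j • EuclideanSpace.single k (1 : ℝ) - y k • EuclideanSpace.single j (1 : ℝ)

/-- The rotation by the angle `a` in the `(j, k)` coordinate plane. -/
noncomputable def rotMap (j k : Fin 3) (a : ℝ) (y : E3) : E3 :=
  y + (Real.cos a - 1) • (y j • EuclideanSpace.single j (1 : ℝ)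
    + y k • EuclideanSpace.single k (1 : ℝ)) + Real.sin a • rotGen j k y

theorem rot_eq_hD (j k : Fin 3) (f : ℝ × E3 → ℝ) (p : ℝ × E3) :
    rot j k f p = hD f p ((0 : ℝ), rotGen j k p.2) := by
  have : ((0 : ℝ), rotGen j k p.2) = p.2 j • ((0 : ℝ), (EuclideanSpace.single k (1 : ℝ) : E3))
      - p.2 k • ((0 : ℝ), (EuclideanSpace.single j (1 : ℝ) : E3)) := by
    simp [rotGen]
  rw [this, map_sub, map_smul, map_smul]
  rfl

theorem rotMap_zero (j k : Fin 3) (y : E3) : rotMap j k 0 y = y := by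
  simp [rotMap]

theorem rotMap_add (j k : Fin 3) (a : ℝ) (y z : E3) :
    rotMap j k a (y + z) = rotMap j k a y + rotMap j k a z := by
  ext i
  simp [rotMap, rotGen]
  split_ifs <;> ring

theorem rotMap_smul (j k : Fin 3) (a m : ℝ) (y : E3) :
    rotMap j k a (m • y) = m • rotMap j k a y := by
  ext i
  simp [rotMap, rotGen]
  split_ifs <;> ring

theorem norm_rotMap {j k : Fin 3} (hjk : j ≠ k) (a : ℝ) (y : E3) :
    ‖rotMap j k a y‖ = ‖y‖ := by
  rw [EuclideanSpace.norm_eq, EuclideanSpace.norm_eq]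
  congr 1
  have h := Real.sin_sq_add_cos_sq a
  fin_cases j <;> fin_cases k <;>
    first | exact absurd rfl hjk | skip
  all_goals
    simp [rotMap, rotGen, Fin.sum_univ_three]
  all_goals
    first
    | linear_combination (y 0 ^ 2 + y 1 ^ 2) * h
    | linear_combination (y 0 ^ 2 + y 2 ^ 2) * h
    | linear_combination (y 1 ^ 2 + y 2 ^ 2) * h

/-- The rotation in the `(j, k)` coordinate plane as a linear isometry. -/
noncomputable def rotIso {j k : Fin 3} (hjk : j ≠ k) (a : ℝ) : E3 →ₗᵢ[ℝ] E3 where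
  toFun := rotMap j k a
  map_add' := rotMap_add j k a
  map_smul' := rotMap_smul j k a
  norm_map' := norm_rotMap hjk a

theorem hasDerivAt_rotMap {j k : Fin 3} (hjk : j ≠ k) (a : ℝ) (y : E3) :
    HasDerivAt (fun s => rotMap j k s y) (rotGen j k (rotMap j k a y)) a := by
  have h1 : HasDerivAt (fun s => rotMap j k s y)
      ((-Real.sin a) • (y j • EuclideanSpace.single j (1 : ℝ)
        + y k • EuclideanSpace.single k (1 : ℝ)) + Real.cos a • rotGen j k y) a := by
    unfold rotMap
    exact (((((Real.hasDerivAt_cos a).sub_const 1).smul_const _).const_add y)).add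
      ((Real.hasDerivAt_sin a).smul_const _)
  convert h1 using 1
  fin_cases j <;> fin_cases k <;>
    first | exact absurd rfl hjk | skip
  all_goals
    ext i
    fin_cases i <;> simp [rotMap, rotGen] <;> ring

theorem continuous_rotGen (j k : Fin 3) : Continuous (rotGen j k) := by
  unfold rotGen; fun_prop

theorem continuous_rotMap (j k : Fin 3) : Continuous (fun q : ℝ × E3 => rotMap j k q.1 q.2) := by
  unfold rotMap
  have := continuous_rotGen j k
  fun_prop

/-- Differentiating a smooth function along a rotation applies the rotation field. -/
theorem hasDerivAt_comp_rotMap {f : ℝ × E3 → ℝ} (hf : ContDiffOn ℝ 1 f halfSpace)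
    {j k : Fin 3} (hjk : j ≠ k) {t : ℝ} (ht : 0 ≤ t) (a : ℝ) (y : E3) :
    HasDerivAt (fun s => f (t, rotMap j k s y)) (rot j k f (t, rotMap j k a y)) a := by
  rw [rot_eq_hD]
  exact hasDerivAt_comp_curve hf ((hasDerivAt_const a t).prodMk (hasDerivAt_rotMap hjk a y))
    (Eventually.of_forall fun r => mem_halfSpace.2 ht)

/-! ### Fubini on compact boxes -/

section Fubini

variable {β : Type*} [TopologicalSpace β] [TopologicalSpace.MetrizableSpace β]
  [SecondCountableTopology β] [MeasureSpace β] [BorelSpace β]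
  [IsLocallyFiniteMeasure (volume : Measure β)] [SFinite (volume : Measure β)]

theorem setIntegral_box_fst {a b : ℝ} (hab : a ≤ b) {K : Set β} (hK : IsCompact K) {f : ℝ × β → ℝ}
    (hf : ContinuousOn f (Icc a b ×ˢ K)) :
    ∫ z in Icc a b ×ˢ K, f z = ∫ s in a..b, ∫ q in K, f (s, q) := by
  have hi : IntegrableOn f (Icc a b ×ˢ K) (volume.prod volume) :=
    hf.integrableOn_compact (isCompact_Icc.prod hK)
  rw [Measure.volume_eq_prod, setIntegral_prod _ hi, intervalIntegral.integral_of_le hab,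
    integral_Icc_eq_integral_Ioc]

theorem setIntegral_box_snd {a b : ℝ} (hab : a ≤ b) {K : Set β} (hK : IsCompact K) {f : ℝ × β → ℝ}
    (hf : ContinuousOn f (Icc a b ×ˢ K)) :
    ∫ z in Icc a b ×ˢ K, f z = ∫ q in K, ∫ s in a..b, f (s, q) := by
  have hi : IntegrableOn f (Icc a b ×ˢ K) (volume.prod volume) :=
    hf.integrableOn_compact (isCompact_Icc.prod hK)
  rw [setIntegral_box_fst hab hK hf]
  rw [IntegrableOn, ← Measure.prod_restrict] at hi
  have := integral_integral_swap (f := fun s q => f (s, q)) hi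
  rw [intervalIntegral.integral_of_le hab, ← integral_Icc_eq_integral_Ioc, this]
  refine integral_congr_ae (Eventually.of_forall fun q => ?_)
  simp only
  rw [intervalIntegral.integral_of_le hab, ← integral_Icc_eq_integral_Ioc]

end Fubini

/-! ### Spherical coordinates with respect to an orthonormal frame -/

/-- The point of the unit sphere with polar angle `q.1` (from `b 2`) and azimuth `q.2`. -/
noncomputable def sph (b : Fin 3 → E3) (q : ℝ × ℝ) : E3 :=
  Real.cos q.1 • b 2 + Real.sin q.1 • (Real.cos q.2 • b 0 + Real.sin q.2 • b 1)

/-- The unit vector in the direction of growing polar angle. -/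
noncomputable def sphPolar (b : Fin 3 → E3) (q : ℝ × ℝ) : E3 :=
  -Real.sin q.1 • b 2 + Real.cos q.1 • (Real.cos q.2 • b 0 + Real.sin q.2 • b 1)

/-- The unit vector in the direction of growing azimuth. -/
noncomputable def sphAzim (b : Fin 3 → E3) (q : ℝ × ℝ) : E3 :=
  -Real.sin q.2 • b 0 + Real.cos q.2 • b 1

/-- The parameter box of spherical coordinates. -/
def angles : Set (ℝ × ℝ) := Icc 0 Real.pi ×ˢ Icc 0 (2 * Real.pi)

theorem isCompact_angles : IsCompact angles := isCompact_Icc.prod isCompact_Icc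

theorem sin_nonneg_of_mem_angles {q : ℝ × ℝ} (hq : q ∈ angles) : 0 ≤ Real.sin q.1 :=
  Real.sin_nonneg_of_mem_Icc hq.1

theorem continuous_sph (b : Fin 3 → E3) : Continuous (sph b) := by unfold sph; fun_prop

theorem continuous_sphPolar (b : Fin 3 → E3) : Continuous (sphPolar b) := by
  unfold sphPolar; fun_prop

theorem continuous_sphAzim (b : Fin 3 → E3) : Continuous (sphAzim b) := by
  unfold sphAzim; fun_prop

theorem hasDerivAt_sph_polar (b : Fin 3 → E3) (q : ℝ × ℝ) :
    HasDerivAt (fun s => sph b (s, q.2)) (sphPolar b q) q.1 :=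
  ((Real.hasDerivAt_cos q.1).smul_const (b 2)).fun_add ((Real.hasDerivAt_sin q.1).smul_const
    (Real.cos q.2 • b 0 + Real.sin q.2 • b 1))

theorem hasDerivAt_sphPolar_polar (b : Fin 3 → E3) (q : ℝ × ℝ) :
    HasDerivAt (fun s => sphPolar b (s, q.2)) (-sph b q) q.1 := by
  have := ((Real.hasDerivAt_sin q.1).fun_neg.smul_const (b 2)).fun_add
    ((Real.hasDerivAt_cos q.1).smul_const (Real.cos q.2 • b 0 + Real.sin q.2 • b 1))
  have e : -sph b q = -Real.cos q.1 • b 2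
      + -Real.sin q.1 • (Real.cos q.2 • b 0 + Real.sin q.2 • b 1) := by
    unfold sph; module
  rw [e]
  exact this

theorem hasDerivAt_sph_azim (b : Fin 3 → E3) (q : ℝ × ℝ) :
    HasDerivAt (fun s => sph b (q.1, s)) (Real.sin q.1 • sphAzim b q) q.2 :=
  ((((Real.hasDerivAt_cos q.2).smul_const (b 0)).fun_add
    ((Real.hasDerivAt_sin q.2).smul_const (b 1))).fun_const_smul (Real.sin q.1)).const_add
    (Real.cos q.1 • b 2)

theorem hasDerivAt_sphAzim_azim (b : Fin 3 → E3) (q : ℝ × ℝ) :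
    HasDerivAt (fun s => sphAzim b (q.1, s))
      (-(Real.sin q.1 • sph b q + Real.cos q.1 • sphPolar b q)) q.2 := by
  have := ((Real.hasDerivAt_sin q.2).fun_neg.smul_const (b 0)).fun_add
    ((Real.hasDerivAt_cos q.2).smul_const (b 1))
  have e : -(Real.sin q.1 • sph b q + Real.cos q.1 • sphPolar b q)
      = -Real.cos q.2 • b 0 + -Real.sin q.2 • b 1 := by
    have h : Real.sin q.1 • sph b q + Real.cos q.1 • sphPolar b q
        = (Real.sin q.1 ^ 2 + Real.cos q.1 ^ 2) • (Real.cos q.2 • b 0 + Real.sin q.2 • b 1) := by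
      unfold sph sphPolar; module
    rw [h, Real.sin_sq_add_cos_sq]; module
  rw [e]
  exact this

theorem norm_sph {b : Fin 3 → E3} (hb : Orthonormal ℝ b) (q : ℝ × ℝ) : ‖sph b q‖ = 1 := by
  have h : ‖sph b q‖ ^ 2 = 1 := by
    rw [← real_inner_self_eq_norm_sq]
    have h0 := orthonormal_iff_ite.1 hb
    simp only [sph, inner_add_left, inner_add_right, real_inner_smul_left, real_inner_smul_right,
      h0]
    simp
    linear_combination (Real.sin q.1 ^ 2) * (Real.sin_sq_add_cos_sq q.2)
      + Real.sin_sq_add_cos_sq q.1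
  nlinarith [norm_nonneg (sph b q)]

/-- The three moving vectors arise from `b` by an orthogonal matrix at every angle, so this is the
invariance of the trace. The frame `b` itself may be arbitrary. -/
theorem orthonormal_moving_trace (b : Fin 3 → E3) (q : ℝ × ℝ) (B : E3 →ₗ[ℝ] E3 →ₗ[ℝ] ℝ) :
    B (sph b q) (sph b q) + B (sphPolar b q) (sphPolar b q) + B (sphAzim b q) (sphAzim b q)
      = ∑ i, B (b i) (b i) := by
  simp only [sph, sphPolar, sphAzim, map_add, map_smul, LinearMap.add_apply, LinearMap.smul_apply,
    smul_eq_mul, Fin.sum_univ_three]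
  linear_combination (B (b 2) (b 2) + Real.cos q.2 ^ 2 * B (b 0) (b 0)
    + Real.sin q.2 ^ 2 * B (b 1) (b 1) + Real.cos q.2 * Real.sin q.2 * B (b 0) (b 1)
    + Real.cos q.2 * Real.sin q.2 * B (b 1) (b 0)) * Real.sin_sq_add_cos_sq q.1
    + (B (b 0) (b 0) + B (b 1) (b 1)) * Real.sin_sq_add_cos_sq q.2

theorem sum_apply_orthonormal {b : Fin 3 → E3} (hb : Orthonormal ℝ b) (B : E3 →ₗ[ℝ] E3 →ₗ[ℝ] ℝ) :
    ∑ i, B (b i) (b i)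
      = ∑ j, B (EuclideanSpace.single j 1) (EuclideanSpace.single j 1) := by
  let M : Matrix (Fin 3) (Fin 3) ℝ := Matrix.of fun i j => b i j
  have h1 : M * M.transpose = 1 := by
    ext i j
    have := orthonormal_iff_ite.1 hb i j
    rw [PiLp.inner_apply] at this
    rw [Matrix.mul_apply, Matrix.one_apply, ← this]
    exact Finset.sum_congr rfl fun k _ => by simp [M, mul_comm]
  -- Orthonormal rows give orthonormal columns, since a one-sided inverse of a square matrix is
  -- two-sided.
  have h2 : M.transpose * M = 1 := mul_eq_one_comm.1 h1
  have h3 (j k : Fin 3) : ∑ i, b i j * b i k = if j = k then 1 else 0 := by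
    have := congrFun (congrFun h2 j) k
    rw [Matrix.mul_apply, Matrix.one_apply] at this
    simpa [M] using this
  have h4 (i : Fin 3) : b i = ∑ j, b i j • (EuclideanSpace.single j 1 : E3) := by
    ext k; simp [Finset.sum_apply, Pi.single_apply]
  have h5 (i : Fin 3) : B (b i) (b i) = ∑ j, ∑ k, (b i j * b i k) *
      B (EuclideanSpace.single j 1) (EuclideanSpace.single k 1) := by
    conv_lhs => rw [h4 i]
    simp only [map_sum, map_smul, LinearMap.sum_apply, LinearMap.smul_apply, smul_eq_mul,
      Finset.mul_sum]
    rw [Finset.sum_comm]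
    exact Finset.sum_congr rfl fun j _ => Finset.sum_congr rfl fun k _ => by ring
  simp only [h5]
  rw [Finset.sum_comm]
  refine Finset.sum_congr rfl fun j _ => ?_
  rw [Finset.sum_comm]
  simp only [← Finset.sum_mul, h3]
  simp

theorem smul_zero_prod (m : ℝ) (v : E3) : ((0 : ℝ), m • v) = m • ((0 : ℝ), v) := by simp

theorem add_zero_prod (v w : E3) : ((0 : ℝ), v + w) = ((0 : ℝ), v) + ((0 : ℝ), w) := by simp

/-- `ρ⁻¹` times the spherical Laplacian (on the unit sphere) of `u` at the point `p`, seen from the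
centre at distance `ρ` in the direction `-ν`. -/
noncomputable def sphLap (u : ℝ × E3 → ℝ) (ρ : ℝ) (ν : E3) (p : ℝ × E3) : ℝ :=
  ρ * (∑ j : Fin 3, hD2 u p ((0 : ℝ), EuclideanSpace.single j 1) ((0 : ℝ), EuclideanSpace.single j 1)
    - hD2 u p ((0 : ℝ), ν) ((0 : ℝ), ν)) - 2 * hD u p ((0 : ℝ), ν)

/-- The spatial part of the second derivative as a bilinear map. -/
noncomputable def spaceHess (u : ℝ × E3 → ℝ) (p : ℝ × E3) : E3 →ₗ[ℝ] E3 →ₗ[ℝ] ℝ :=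
  LinearMap.mk₂ ℝ (fun v w => hD2 u p ((0 : ℝ), v) ((0 : ℝ), w))
    (fun v w z => by rw [add_zero_prod, map_add, add_apply])
    (fun m v w => by rw [smul_zero_prod, map_smul, smul_apply])
    (fun v w z => by rw [add_zero_prod, map_add])
    (fun m v w => by rw [smul_zero_prod, map_smul])

theorem continuousOn_hD_comp {α : Type*} [TopologicalSpace α] {u : ℝ × E3 → ℝ}
    (hu : ContDiffOn ℝ 2 u halfSpace) {p w : α → ℝ × E3} {s : Set α} (hp : ContinuousOn p s)
    (hm : MapsTo p s halfSpace) (hw : ContinuousOn w s) :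
    ContinuousOn (fun q => hD u (p q) (w q)) s :=
  ((continuousOn_hD (hu.of_le one_le_two)).comp hp hm).clm_apply hw

theorem continuousOn_hD2_comp {α : Type*} [TopologicalSpace α] {u : ℝ × E3 → ℝ}
    (hu : ContDiffOn ℝ 2 u halfSpace) {p v w : α → ℝ × E3} {s : Set α} (hp : ContinuousOn p s)
    (hm : MapsTo p s halfSpace) (hv : ContinuousOn v s) (hw : ContinuousOn w s) :
    ContinuousOn (fun q => hD2 u (p q) (v q) (w q)) s :=
  (((continuousOn_hD2 hu).comp hp hm).clm_apply hv).clm_apply hw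

theorem continuousOn_sphLap_comp {α : Type*} [TopologicalSpace α] {u : ℝ × E3 → ℝ}
    (hu : ContDiffOn ℝ 2 u halfSpace) {p : α → ℝ × E3} {ρ : α → ℝ} {ν : α → E3} {s : Set α}
    (hp : ContinuousOn p s) (hm : MapsTo p s halfSpace) (hρ : ContinuousOn ρ s)
    (hν : ContinuousOn ν s) :
    ContinuousOn (fun q => sphLap u (ρ q) (ν q) (p q)) s := by
  unfold sphLap
  have h0 : ContinuousOn (fun q => ((0 : ℝ), ν q)) s := continuousOn_const.prodMk hν
  refine (hρ.mul ((continuousOn_finsetSum _ fun j _ => ?_).sub ?_)).sub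
    (continuousOn_const.mul ?_)
  · exact continuousOn_hD2_comp hu hp hm continuousOn_const continuousOn_const
  · exact continuousOn_hD2_comp hu hp hm h0 h0
  · exact continuousOn_hD_comp hu hp hm h0

/-- The spherical Laplacian has mean zero over spheres. -/
theorem integral_sphLap_eq_zero {u : ℝ × E3 → ℝ} (hu : ContDiffOn ℝ 2 u halfSpace)
    {b : Fin 3 → E3} (hb : Orthonormal ℝ b) {τ : ℝ} (hτ : 0 ≤ τ) (x : E3) (ρ : ℝ) :
    ∫ q in angles, Real.sin q.1 * sphLap u ρ (sph b q) (τ, x + ρ • sph b q) = 0 := by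
  set p : ℝ × ℝ → ℝ × E3 := fun q => (τ, x + ρ • sph b q) with hp
  have hmem : ∀ q, p q ∈ halfSpace := fun q => mem_halfSpace.2 hτ
  have cs := continuous_sph b
  have cp := continuous_sphPolar b
  have ca := continuous_sphAzim b
  have hpc : Continuous p := by rw [hp]; fun_prop
  -- The integrand is a divergence, `∂_ϑ A + ∂_θ B`. The factor `sin ϑ` makes `A` vanish at both
  -- poles, and `B` is `2π`-periodic in the azimuth, so both parts integrate to zero.
  set A : ℝ × ℝ → ℝ := fun q => Real.sin q.1 * hD u (p q) (0, sphPolar b q) with hA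
  set A' : ℝ × ℝ → ℝ := fun q => Real.cos q.1 * hD u (p q) (0, sphPolar b q)
    + Real.sin q.1 * (hD2 u (p q) (0, ρ • sphPolar b q) (0, sphPolar b q)
      + hD u (p q) (0, -sph b q)) with hA'
  set B : ℝ × ℝ → ℝ := fun q => hD u (p q) (0, sphAzim b q) with hB
  set B' : ℝ × ℝ → ℝ := fun q => hD2 u (p q) (0, ρ • (Real.sin q.1 • sphAzim b q)) (0, sphAzim b q)
    + hD u (p q) (0, -(Real.sin q.1 • sph b q + Real.cos q.1 • sphPolar b q)) with hB'
  have hAd : ∀ q : ℝ × ℝ, HasDerivAt (fun s => A (s, q.2)) (A' q) q.1 := by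
    intro q
    have h1 : HasDerivAt (fun s => p (s, q.2)) ((0 : ℝ), ρ • sphPolar b q) q.1 :=
      (hasDerivAt_const q.1 τ).prodMk (((hasDerivAt_sph_polar b q).fun_const_smul ρ).const_add x)
    have h2 : HasDerivAt (fun s => ((0 : ℝ), sphPolar b (s, q.2))) ((0 : ℝ), -sph b q) q.1 :=
      (hasDerivAt_const q.1 (0 : ℝ)).prodMk (hasDerivAt_sphPolar_polar b q)
    exact (Real.hasDerivAt_sin q.1).fun_mul
      (hasDerivAt_hD_comp_curve hu h1 (Eventually.of_forall fun s => hmem _) h2)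
  have hBd : ∀ q : ℝ × ℝ, HasDerivAt (fun s => B (q.1, s)) (B' q) q.2 := by
    intro q
    have h1 : HasDerivAt (fun s => p (q.1, s)) ((0 : ℝ), ρ • (Real.sin q.1 • sphAzim b q)) q.2 :=
      (hasDerivAt_const q.2 τ).prodMk (((hasDerivAt_sph_azim b q).fun_const_smul ρ).const_add x)
    have h2 : HasDerivAt (fun s => ((0 : ℝ), sphAzim b (q.1, s)))
        ((0 : ℝ), -(Real.sin q.1 • sph b q + Real.cos q.1 • sphPolar b q)) q.2 :=
      (hasDerivAt_const q.2 (0 : ℝ)).prodMk (hasDerivAt_sphAzim_azim b q)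
    exact hasDerivAt_hD_comp_curve hu h1 (Eventually.of_forall fun s => hmem _) h2
  have cD : ∀ w : ℝ × ℝ → E3, Continuous w → Continuous fun q => hD u (p q) ((0 : ℝ), w q) :=
    fun w hw => continuousOn_univ.1 (continuousOn_hD_comp hu hpc.continuousOn
      (fun q _ => hmem q) (continuous_const.prodMk hw).continuousOn)
  have cD2 : ∀ v w : ℝ × ℝ → E3, Continuous v → Continuous w →
      Continuous fun q => hD2 u (p q) ((0 : ℝ), v q) ((0 : ℝ), w q) :=
    fun v w hv hw => continuousOn_univ.1 (continuousOn_hD2_comp hu hpc.continuousOn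
      (fun q _ => hmem q) (continuous_const.prodMk hv).continuousOn
      (continuous_const.prodMk hw).continuousOn)
  have cA' : Continuous A' := by
    rw [hA']
    exact ((Real.continuous_cos.comp continuous_fst).mul (cD _ cp)).add
      ((Real.continuous_sin.comp continuous_fst).mul
        ((cD2 _ _ (cp.const_smul ρ) cp).add (cD _ cs.neg)))
  have cB' : Continuous B' := by
    rw [hB']
    refine (cD2 _ _ ?_ ca).add (cD _ ?_) <;> fun_prop
  have hsum : ∀ q, Real.sin q.1 * sphLap u ρ (sph b q) (p q) = A' q + B' q := by
    intro q
    have htr := orthonormal_moving_trace b q (spaceHess u (p q))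
    rw [sum_apply_orthonormal hb] at htr
    simp only [spaceHess, LinearMap.mk₂_apply] at htr
    simp only [hA', hB', sphLap, smul_zero_prod, map_smul, smul_apply,
      smul_eq_mul]
    rw [← htr]
    have e1 : ∀ v : E3, hD u (p q) (0, -v) = -hD u (p q) (0, v) := fun v => by
      rw [← map_neg]; simp
    rw [e1, e1, add_zero_prod, map_add, smul_zero_prod, map_smul, smul_zero_prod, map_smul,
      smul_eq_mul, smul_eq_mul]
    ring
  have hpi := Real.pi_pos.le
  have h2pi : (0 : ℝ) ≤ 2 * Real.pi := by positivity
  have hIA : ∫ q in angles, A' q = 0 := by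
    rw [angles, setIntegral_box_snd hpi isCompact_Icc cA'.continuousOn]
    have : ∀ θ : ℝ, ∫ s in (0 : ℝ)..Real.pi, A' (s, θ) = 0 := by
      intro θ
      rw [intervalIntegral.integral_eq_sub_of_hasDerivAt (f := fun s => A (s, θ))
        (fun s _ => hAd (s, θ)) ((cA'.comp (by fun_prop : Continuous fun s => (s, θ))).intervalIntegrable _ _)]
      simp [hA]
    simp [this]
  have hIB : ∫ q in angles, B' q = 0 := by
    rw [angles, setIntegral_box_fst hpi isCompact_Icc cB'.continuousOn]
    have : ∀ s : ℝ, ∫ θ in Icc (0 : ℝ) (2 * Real.pi), B' (s, θ) = 0 := by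
      intro s
      rw [integral_Icc_eq_integral_Ioc, ← intervalIntegral.integral_of_le h2pi,
        intervalIntegral.integral_eq_sub_of_hasDerivAt (f := fun θ => B (s, θ))
        (fun θ _ => hBd (s, θ)) ((cB'.comp (by fun_prop : Continuous fun θ => (s, θ))).intervalIntegrable _ _)]
      simp [hB, hp, sph, sphAzim]
    simp [this]
  rw [setIntegral_congr_fun (g := fun q => A' q + B' q)
    (isCompact_angles.measurableSet) (fun q _ => hsum q), integral_add, hIA, hIB, add_zero]
  · exact cA'.continuousOn.integrableOn_compact isCompact_angles
  · exact cB'.continuousOn.integrableOn_compact isCompact_angles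

theorem integral_sin_angles : ∫ q in angles, Real.sin q.1 = 4 * Real.pi := by
  have h2pi : (0 : ℝ) ≤ 2 * Real.pi := by positivity
  rw [angles, setIntegral_box_fst Real.pi_pos.le isCompact_Icc
    (by fun_prop : Continuous fun q : ℝ × ℝ => Real.sin q.1).continuousOn]
  simp [h2pi]
  ring

/-! ### Integration along backward characteristics -/

section Characteristic

variable {c t : ℝ} {u G : ℝ × E3 → ℝ}

theorem box_eq (hu : ContDiffOn ℝ 2 u halfSpace) {p : ℝ × E3} (hp : p ∈ halfSpace) :
    box c u p = hD2 u p (1, 0) (1, 0) - c ^ 2 * ∑ j : Fin 3,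
      hD2 u p ((0 : ℝ), EuclideanSpace.single j 1) ((0 : ℝ), EuclideanSpace.single j 1) := by
  unfold box
  congr 1
  · exact hD_hD_apply hu hp _ _
  · congr 1
    exact Finset.sum_congr rfl fun j _ => hD_hD_apply hu hp _ _

/-- The point with parameter `s` on the backward characteristic which starts at time `t` at
distance `r` from `x` in the direction `ν`. -/
noncomputable def backPt (c t r : ℝ) (x ν : E3) (s : ℝ) : ℝ × E3 :=
  (t * (1 - s), x + (r + c * t * s) • ν)

theorem backPt_mem (ht : 0 ≤ t) (r : ℝ) (x ν : E3) {s : ℝ} (hs : s ≤ 1) :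
    backPt c t r x ν s ∈ halfSpace :=
  mem_halfSpace.2 (mul_nonneg ht (by linarith))

/-- `D_+(ρ u)` along the backward characteristic. -/
noncomputable def charFun (c t r : ℝ) (x ν : E3) (u : ℝ × E3 → ℝ) (s : ℝ) : ℝ :=
  (r + c * t * s) * hD u (backPt c t r x ν s) ((1 : ℝ), c • ν) + c * u (backPt c t r x ν s)

theorem hasDerivAt_backPt (c t r : ℝ) (x ν : E3) (s : ℝ) :
    HasDerivAt (backPt c t r x ν) (-t, (c * t) • ν) s := by
  have h1 : HasDerivAt (fun s : ℝ => t * (1 - s)) (-t) s := by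
    simpa using ((hasDerivAt_id s).const_sub 1).const_mul t
  have h2 : HasDerivAt (fun s : ℝ => r + c * t * s) (c * t) s := by
    simpa using ((hasDerivAt_id s).const_mul (c * t)).const_add r
  exact h1.prodMk ((h2.smul_const ν).const_add x)

theorem continuous_backPt (c t r : ℝ) (x ν : E3) : Continuous (backPt c t r x ν) := by
  unfold backPt; fun_prop

/-- The curve has velocity `-t (1, -cν)`, so this is `-t(∂_t - c∂_ν)` applied to `(∂_t + c∂_ν)(ρu)`.
The mixed derivatives cancel by symmetry, and `ρ(∂_t² - c²∂_ν²)u - 2c²∂_ν u` differs from `ρ □_c u`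
exactly by the spherical Laplacian term. -/
theorem hasDerivAt_charFun (ht : 0 < t) (hu : ContDiffOn ℝ 2 u halfSpace)
    (heqn : ∀ (t : ℝ) (x : E3), 0 < t → box c u (t, x) = G (t, x)) (r : ℝ) (x ν : E3)
    {s : ℝ} (hs : s < 1) :
    HasDerivAt (charFun c t r x ν u) (-t * ((r + c * t * s) * G (backPt c t r x ν s)
      + c ^ 2 * sphLap u (r + c * t * s) ν (backPt c t r x ν s))) s := by
  have hm : ∀ᶠ s' in 𝓝 s, backPt c t r x ν s' ∈ halfSpace := by
    filter_upwards [Iio_mem_nhds hs] with s' hs'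
    exact backPt_mem ht.le _ _ _ (le_of_lt hs')
  have hp := hm.self_of_nhds
  have h2 : HasDerivAt (fun s : ℝ => r + c * t * s) (c * t) s := by
    simpa using ((hasDerivAt_id s).const_mul (c * t)).const_add r
  have h := (h2.fun_mul (hasDerivAt_hD_comp_curve hu (hasDerivAt_backPt c t r x ν s) hm
    (hasDerivAt_const s ((1 : ℝ), c • ν)))).fun_add
    ((hasDerivAt_comp_curve (hu.of_le one_le_two) (hasDerivAt_backPt c t r x ν s) hm).const_mul c)
  unfold charFun
  refine h.congr_deriv (Eq.symm ?_)
  have hG : G (backPt c t r x ν s) = box c u (backPt c t r x ν s) :=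
    (heqn _ _ (mul_pos ht (by linarith))).symm
  rw [hG, box_eq hu hp]
  set p := backPt c t r x ν s
  have e1 : ∀ a m : ℝ, (a, m • ν) = a • ((1 : ℝ), (0 : E3)) + m • ((0 : ℝ), ν) := by
    intro a m; simp
  simp only [sphLap, e1, map_add, map_smul, add_apply,
    smul_apply, smul_eq_mul, map_zero, hD2_symm hu hp (0, ν) (1, 0)]
  ring

/-- The starting distance `r` is left free: `r = 0` with centre `x` leads to Kirchhoff's formula, `r
= ‖x‖` with centre `0` to the formula for `‖x‖ D_+ u`. -/
theorem charFun_sub (ht : 0 < t) (hu : ContDiffOn ℝ 2 u halfSpace)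
    (hG : ContinuousOn G halfSpace)
    (heqn : ∀ (t : ℝ) (x : E3), 0 < t → box c u (t, x) = G (t, x)) (r : ℝ) (x ν : E3) :
    charFun c t r x ν u 0 = charFun c t r x ν u 1
      + t * ∫ s in (0 : ℝ)..1, ((r + c * t * s) * G (backPt c t r x ν s)
        + c ^ 2 * sphLap u (r + c * t * s) ν (backPt c t r x ν s)) := by
  have hmt : MapsTo (backPt c t r x ν) (Icc 0 1) halfSpace :=
    fun s hs => backPt_mem ht.le _ _ _ hs.2
  have hbc := (continuous_backPt c t r x ν).continuousOn (s := Icc (0 : ℝ) 1)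
  have hrc : ContinuousOn (fun s : ℝ => r + c * t * s) (Icc (0 : ℝ) 1) := by fun_prop
  have hcont : ContinuousOn (charFun c t r x ν u) (Icc 0 1) := by
    unfold charFun
    exact (hrc.mul (continuousOn_hD_comp hu hbc hmt continuousOn_const)).add
      (continuousOn_const.mul (hu.continuousOn.comp hbc hmt))
  have hint : ContinuousOn (fun s => (r + c * t * s) * G (backPt c t r x ν s)
        + c ^ 2 * sphLap u (r + c * t * s) ν (backPt c t r x ν s)) (Icc 0 1) :=
    (hrc.mul (hG.comp hbc hmt)).add
      (continuousOn_const.mul (continuousOn_sphLap_comp hu hbc hmt hrc continuousOn_const))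
  -- The end `s = 1` lies on `t = 0`, where the wave equation is not assumed; continuity up to the
  -- end is enough.
  have := intervalIntegral.integral_eq_sub_of_hasDerivAt_of_le zero_le_one hcont
    (fun s hs => hasDerivAt_charFun ht hu heqn r x ν hs.2)
    ((continuousOn_const.mul hint).intervalIntegrable_of_Icc zero_le_one)
  rw [intervalIntegral.integral_const_mul] at this
  linarith

/-- **Kirchhoff's formula** in spherical coordinates with respect to an arbitrary frame. -/
theorem kirchhoff (hc : 0 < c) (ht : 0 < t) (hu : ContDiffOn ℝ 2 u halfSpace)
    (hG : ContinuousOn G halfSpace)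
    (heqn : ∀ (t : ℝ) (x : E3), 0 < t → box c u (t, x) = G (t, x)) (x : E3)
    {b : Fin 3 → E3} (hb : Orthonormal ℝ b) :
    4 * Real.pi * u (t, x)
      = (∫ q in angles, Real.sin q.1 * (t * hD u (0, x + (c * t) • sph b q) (1, c • sph b q)
          + u (0, x + (c * t) • sph b q)))
        + ∫ z in Icc (0 : ℝ) 1 ×ˢ angles, Real.sin z.2.1 * (t ^ 2 * z.1
            * G (t * (1 - z.1), x + (c * t * z.1) • sph b z.2)) := by
  have cs := continuous_sph b
  have hK := isCompact_angles
  have hin : ∀ {f : ℝ × ℝ → ℝ}, ContinuousOn f angles → IntegrableOn f angles :=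
    fun hf => hf.integrableOn_compact hK
  have hP : Continuous fun z : ℝ × (ℝ × ℝ) =>
      ((t * (1 - z.1), x + (c * t * z.1) • sph b z.2) : ℝ × E3) := by fun_prop
  have hPm : MapsTo (fun z : ℝ × (ℝ × ℝ) =>
      ((t * (1 - z.1), x + (c * t * z.1) • sph b z.2) : ℝ × E3)) (Icc (0 : ℝ) 1 ×ˢ angles)
      halfSpace := fun z hz => mem_halfSpace.2 (mul_nonneg ht.le (by linarith [hz.1.2]))
  have hgc : ContinuousOn (fun z : ℝ × (ℝ × ℝ) => Real.sin z.2.1 * (t ^ 2 * z.1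
            * G (t * (1 - z.1), x + (c * t * z.1) • sph b z.2))) (Icc (0 : ℝ) 1 ×ˢ angles) :=
    (by fun_prop : Continuous fun z : ℝ × (ℝ × ℝ) => Real.sin z.2.1).continuousOn.mul
      ((by fun_prop : Continuous fun z : ℝ × (ℝ × ℝ) => t ^ 2 * z.1).continuousOn.mul
        (hG.comp hP.continuousOn hPm))
  have hlc : ContinuousOn (fun z : ℝ × (ℝ × ℝ) => Real.sin z.2.1 * sphLap u (c * t * z.1)
      (sph b z.2) (t * (1 - z.1), x + (c * t * z.1) • sph b z.2)) (Icc (0 : ℝ) 1 ×ˢ angles) :=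
    (by fun_prop : Continuous fun z : ℝ × (ℝ × ℝ) => Real.sin z.2.1).continuousOn.mul
      (continuousOn_sphLap_comp hu hP.continuousOn hPm (by fun_prop) (by fun_prop))
  have hL0 : ∫ z in Icc (0 : ℝ) 1 ×ˢ angles, Real.sin z.2.1 * sphLap u (c * t * z.1)
      (sph b z.2) (t * (1 - z.1), x + (c * t * z.1) • sph b z.2) = 0 := by
    rw [setIntegral_box_fst zero_le_one hK hlc]
    refine (intervalIntegral.integral_congr (g := fun _ => (0 : ℝ)) fun s hs => ?_).trans (by simp)
    rw [uIcc_of_le zero_le_one] at hs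
    exact integral_sphLap_eq_zero hu hb (τ := t * (1 - s)) (mul_nonneg ht.le (by linarith [hs.2])) x
      (c * t * s)
  have hq : ∀ q ∈ angles, Real.sin q.1 * u (t, x)
      = Real.sin q.1 * (t * hD u (0, x + (c * t) • sph b q) (1, c • sph b q)
          + u (0, x + (c * t) • sph b q))
        + ((∫ s in (0 : ℝ)..1, Real.sin q.1 * (t ^ 2 * s
            * G (t * (1 - s), x + (c * t * s) • sph b q)))
        + c * t * ∫ s in (0 : ℝ)..1, Real.sin q.1 * sphLap u (c * t * s)
            (sph b q) (t * (1 - s), x + (c * t * s) • sph b q)) := by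
    intro q hq
    -- With `r = 0` the derivative term of `charFun` at `s = 0` has the factor zero, and `c * u (t,
    -- x)` is left.
    have h := charFun_sub ht hu hG heqn 0 x (sph b q)
    have hi1 : IntervalIntegrable (fun s => Real.sin q.1 * (t ^ 2 * s
            * G (t * (1 - s), x + (c * t * s) • sph b q))) volume 0 1 :=
      (hgc.comp (by fun_prop : Continuous fun s : ℝ => (s, q)).continuousOn
        (fun s hs => ⟨hs, hq⟩)).intervalIntegrable_of_Icc zero_le_one
    have hi2 : IntervalIntegrable (fun s => Real.sin q.1 * sphLap u (c * t * s)
            (sph b q) (t * (1 - s), x + (c * t * s) • sph b q)) volume 0 1 :=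
      (hlc.comp (by fun_prop : Continuous fun s : ℝ => (s, q)).continuousOn
        (fun s hs => ⟨hs, hq⟩)).intervalIntegrable_of_Icc zero_le_one
    have e : (Real.sin q.1 * t / c) * ∫ s in (0 : ℝ)..1, ((0 + c * t * s) *
          G (backPt c t 0 x (sph b q) s)
        + c ^ 2 * sphLap u (0 + c * t * s) (sph b q) (backPt c t 0 x (sph b q) s))
        = (∫ s in (0 : ℝ)..1, Real.sin q.1 * (t ^ 2 * s
            * G (t * (1 - s), x + (c * t * s) • sph b q)))
        + c * t * ∫ s in (0 : ℝ)..1, Real.sin q.1 * sphLap u (c * t * s)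
            (sph b q) (t * (1 - s), x + (c * t * s) • sph b q) := by
      rw [← intervalIntegral.integral_const_mul, ← intervalIntegral.integral_const_mul,
        ← intervalIntegral.integral_add hi1 (hi2.const_mul _)]
      refine intervalIntegral.integral_congr fun s _ => ?_
      simp only [backPt, zero_add]
      field_simp
    rw [← e]
    simp only [charFun, backPt, mul_zero, add_zero, zero_smul, mul_one, sub_self, zero_mul,
      zero_add, sub_zero] at h ⊢
    have h' : u (t, x) = (c * t * hD u (0, x + (c * t) • sph b q) (1, c • sph b q)
      + c * u (0, x + (c * t) • sph b q) + t * ∫ s in (0 : ℝ)..1, (c * t * s *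
          G (t * (1 - s), x + (c * t * s) • sph b q)
        + c ^ 2 * sphLap u (c * t * s) (sph b q) (t * (1 - s), x + (c * t * s) • sph b q))) / c := by
      rw [eq_div_iff hc.ne', ← h, mul_comm]
    rw [h']
    field_simp
  have hdc : ContinuousOn (fun q => Real.sin q.1 * (t * hD u (0, x + (c * t) • sph b q)
      (1, c • sph b q) + u (0, x + (c * t) • sph b q))) angles := by
    have h1 : Continuous fun q : ℝ × ℝ => (((0 : ℝ), x + (c * t) • sph b q) : ℝ × E3) := by fun_prop
    have h2 : MapsTo (fun q : ℝ × ℝ => (((0 : ℝ), x + (c * t) • sph b q) : ℝ × E3)) angles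
      halfSpace := fun q _ => mem_halfSpace.2 le_rfl
    exact (by fun_prop : Continuous fun q : ℝ × ℝ => Real.sin q.1).continuousOn.mul
      ((continuousOn_const.mul (continuousOn_hD_comp hu h1.continuousOn h2 (by fun_prop))).add
        (hu.continuousOn.comp h1.continuousOn h2))
  have hI : ∀ {f : ℝ × (ℝ × ℝ) → ℝ}, ContinuousOn f (Icc (0 : ℝ) 1 ×ˢ angles) →
      IntegrableOn (fun q => ∫ s in (0 : ℝ)..1, f (s, q)) angles := by
    intro f hf
    have hi : IntegrableOn f (Icc (0 : ℝ) 1 ×ˢ angles) (volume.prod volume) :=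
      hf.integrableOn_compact (isCompact_Icc.prod hK)
    rw [IntegrableOn, ← Measure.prod_restrict] at hi
    have := hi.integral_prod_right
    simpa only [IntegrableOn, intervalIntegral.integral_of_le zero_le_one,
      integral_Icc_eq_integral_Ioc] using this
  have h0 : ∫ q in angles, Real.sin q.1 * u (t, x) = 4 * Real.pi * u (t, x) := by
    rw [integral_mul_const, integral_sin_angles]
  have i1 := hI hgc
  have i2 := (hI hlc).const_mul (c * t)
  simp only at i1 i2
  have e1 := setIntegral_box_snd zero_le_one hK hgc
  have e2 := setIntegral_box_snd zero_le_one hK hlc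
  simp only at e1 e2
  rw [← h0, setIntegral_congr_fun hK.measurableSet hq, integral_add (hin hdc) (Integrable.fun_add i1 i2),
    integral_add i1 i2, integral_const_mul, ← e1, ← e2, hL0, mul_zero, add_zero]

end Characteristic

/-- Differentiation under an integral over a compact set. -/
theorem hasDerivAt_setIntegral_of_isCompact {α : Type*} [TopologicalSpace α]
    [TopologicalSpace.PseudoMetrizableSpace α] [T2Space α]
    [SecondCountableTopology α] [MeasureSpace α] [OpensMeasurableSpace α]
    [IsFiniteMeasureOnCompacts (volume : Measure α)] {K : Set α} (hK : IsCompact K)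
    {F F' : ℝ → α → ℝ} {x₀ ε : ℝ} (hε : 0 < ε)
    (hF : ContinuousOn (fun z : ℝ × α => F z.1 z.2) (Icc (x₀ - ε) (x₀ + ε) ×ˢ K))
    (hF' : ContinuousOn (fun z : ℝ × α => F' z.1 z.2) (Icc (x₀ - ε) (x₀ + ε) ×ˢ K))
    (hd : ∀ x ∈ Icc (x₀ - ε) (x₀ + ε), ∀ q ∈ K, x ∈ Ioo (x₀ - ε) (x₀ + ε) →
      HasDerivAt (fun y => F y q) (F' x q) x) :
    HasDerivAt (fun x => ∫ q in K, F x q) (∫ q in K, F' x₀ q) x₀ := by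
  obtain ⟨B, hB⟩ := (isCompact_Icc.prod hK).exists_bound_of_continuousOn hF'
  have hs : Ioo (x₀ - ε) (x₀ + ε) ∈ 𝓝 x₀ := Ioo_mem_nhds (by linarith) (by linarith)
  have hsl : ∀ {f : ℝ → α → ℝ}, ContinuousOn (fun z : ℝ × α => f z.1 z.2)
      (Icc (x₀ - ε) (x₀ + ε) ×ˢ K) → ∀ x ∈ Icc (x₀ - ε) (x₀ + ε), ContinuousOn (f x) K :=
    fun hf x hx => hf.comp (by fun_prop : Continuous fun q : α => (x, q)).continuousOn
      fun q hq => ⟨hx, hq⟩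
  have hx₀ : x₀ ∈ Icc (x₀ - ε) (x₀ + ε) := Ioo_subset_Icc_self (mem_of_mem_nhds hs)
  have : Fact (volume K < ⊤) := ⟨hK.measure_lt_top⟩
  refine (hasDerivAt_integral_of_dominated_loc_of_deriv_le (bound := fun _ => B) hs ?_ ?_ ?_ ?_ ?_
    ?_).2
  · filter_upwards [hs] with x hx
    exact (hsl hF x (Ioo_subset_Icc_self hx)).aestronglyMeasurable_of_isCompact hK hK.measurableSet
  · exact (hsl hF x₀ hx₀).integrableOn_compact hK
  · exact (hsl hF' x₀ hx₀).aestronglyMeasurable_of_isCompact hK hK.measurableSet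
  · filter_upwards [ae_restrict_mem hK.measurableSet] with q hq x hx
    exact hB (x, q) ⟨Ioo_subset_Icc_self hx, hq⟩
  · exact integrable_const _
  · filter_upwards [ae_restrict_mem hK.measurableSet] with q hq x hx
    exact hd x (Ioo_subset_Icc_self hx) q hq hx

/-! ### The backward light cone and retarded potentials under rotations -/

/-- The parameter box `[0, 1] × angles` of the backward light cone. -/
def coneBox : Set (ℝ × (ℝ × ℝ)) := Icc (0 : ℝ) 1 ×ˢ angles

theorem isCompact_coneBox : IsCompact coneBox := isCompact_Icc.prod isCompact_angles

/-- The point of the backward light cone of `(t, x)` with parameters `z`. -/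
noncomputable def conePt (c t : ℝ) (x : E3) (b : Fin 3 → E3) (z : ℝ × (ℝ × ℝ)) : ℝ × E3 :=
  (t * (1 - z.1), x + (c * t * z.1) • sph b z.2)

/-- The retarded potential (up to the factor `4π`) in spherical coordinates. -/
noncomputable def retPot (c t : ℝ) (x : E3) (b : Fin 3 → E3) (G : ℝ × E3 → ℝ) : ℝ :=
  ∫ z in coneBox, Real.sin z.2.1 * (t ^ 2 * z.1 * G (conePt c t x b z))

theorem conePt_mem_halfSpace {c t : ℝ} (ht : 0 ≤ t) (x : E3) (b : Fin 3 → E3)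
    {z : ℝ × (ℝ × ℝ)} (hz : z ∈ coneBox) : conePt c t x b z ∈ halfSpace :=
  mem_halfSpace.2 (mul_nonneg ht (by linarith [hz.1.2]))

theorem continuous_conePt (c t : ℝ) (x : E3) (b : Fin 3 → E3) : Continuous (conePt c t x b) := by
  have := continuous_sph b
  unfold conePt; fun_prop

theorem conePt_mem_cone {c t : ℝ} (hc : 0 < c) (ht : 0 ≤ t) (x : E3) {b : Fin 3 → E3}
    (hb : Orthonormal ℝ b) {z : ℝ × (ℝ × ℝ)} (hz : z ∈ coneBox) :
    conePt c t x b z ∈ cone c t x := by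
  have h0 := hz.1.1
  have h1 := hz.1.2
  refine ⟨mul_nonneg ht (by linarith), ?_, ?_⟩
  · simp only [conePt]; nlinarith
  · have : (0 : ℝ) ≤ c * t * z.1 := by positivity
    simp only [conePt, add_sub_cancel_left, norm_smul, norm_sph hb, Real.norm_eq_abs,
      abs_of_nonneg this]
    linarith

/-- By this nesting the suprema taken at `(t, x)` also control the solution at every earlier point
of the cone. -/
theorem cone_subset {c t τ : ℝ} {x y : E3} (h : (τ, y) ∈ cone c t x) :
    cone c τ y ⊆ cone c t x := by
  rintro ⟨σ, z⟩ ⟨h1, h2, h3⟩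
  obtain ⟨h4, h5, h6⟩ := h
  refine ⟨h1, h2.trans h5, ?_⟩
  have : z - x = (z - y) + (y - x) := by abel
  calc ‖z - x‖ ≤ ‖z - y‖ + ‖y - x‖ := by rw [this]; exact norm_add_le _ _
    _ ≤ c * (τ - σ) + c * (t - τ) := add_le_add h3 h6
    _ = c * (t - σ) := by ring

theorem continuousOn_retPot_integrand {c t : ℝ} (ht : 0 ≤ t) (x : E3) (b : Fin 3 → E3)
    {G : ℝ × E3 → ℝ} (hG : ContinuousOn G halfSpace) :
    ContinuousOn (fun z : ℝ × (ℝ × ℝ) => Real.sin z.2.1 * (t ^ 2 * z.1 * G (conePt c t x b z)))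
      coneBox :=
  (by fun_prop : Continuous fun z : ℝ × (ℝ × ℝ) => Real.sin z.2.1).continuousOn.mul
    ((by fun_prop : Continuous fun z : ℝ × (ℝ × ℝ) => t ^ 2 * z.1).continuousOn.mul
      (hG.comp (continuous_conePt c t x b).continuousOn fun _ hz => conePt_mem_halfSpace ht x b hz))

theorem sph_rotMap {j k : Fin 3} (a : ℝ) (b : Fin 3 → E3) (q : ℝ × ℝ) :
    sph (fun i => rotMap j k a (b i)) q = rotMap j k a (sph b q) := by
  simp only [sph, rotMap_add, rotMap_smul]

theorem orthonormal_rotMap {j k : Fin 3} (hjk : j ≠ k) (a : ℝ) {b : Fin 3 → E3}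
    (hb : Orthonormal ℝ b) : Orthonormal ℝ (fun i => rotMap j k a (b i)) :=
  hb.comp_linearIsometry (rotIso hjk a)

theorem conePt_rotMap {j k : Fin 3} (a c t : ℝ) (x : E3) (b : Fin 3 → E3) (z : ℝ × (ℝ × ℝ)) :
    conePt c t (rotMap j k a x) (fun i => rotMap j k a (b i)) z
      = ((conePt c t x b z).1, rotMap j k a (conePt c t x b z).2) := by
  simp only [conePt, sph_rotMap, rotMap_add, rotMap_smul]

/-- Rotating the frame together with `x` moves the whole light cone rigidly. The parameters and the
density stay fixed, so the derivative falls on `G` alone. -/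
theorem hasDerivAt_retPot_rotMap {j k : Fin 3} (hjk : j ≠ k) {c t : ℝ} (ht : 0 ≤ t) (x : E3)
    (b : Fin 3 → E3) {G : ℝ × E3 → ℝ} (hG : ContDiffOn ℝ ∞ G halfSpace) (a : ℝ) :
    HasDerivAt (fun a => retPot c t (rotMap j k a x) (fun i => rotMap j k a (b i)) G)
      (retPot c t (rotMap j k a x) (fun i => rotMap j k a (b i)) (rot j k G)) a := by
  have hcont : ∀ {f : ℝ × E3 → ℝ}, ContinuousOn f halfSpace → ContinuousOn
      (fun w : ℝ × (ℝ × (ℝ × ℝ)) => Real.sin w.2.2.1 * (t ^ 2 * w.2.1 * f (conePt c t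
        (rotMap j k w.1 x) (fun i => rotMap j k w.1 (b i)) w.2))) (Icc (a - 1) (a + 1) ×ˢ coneBox) := by
    intro f hf
    refine (by fun_prop : Continuous fun w : ℝ × (ℝ × (ℝ × ℝ)) => Real.sin w.2.2.1).continuousOn.mul
      ((by fun_prop : Continuous fun w : ℝ × (ℝ × (ℝ × ℝ)) => t ^ 2 * w.2.1).continuousOn.mul
      (hf.comp (Continuous.continuousOn ?_) fun w hw => conePt_mem_halfSpace ht _ _ hw.2))
    simp only [conePt_rotMap]
    have h1 := continuous_conePt c t x b
    have h2 := continuous_rotMap j k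
    exact (h1.comp continuous_snd).fst.prodMk
      (h2.comp (continuous_fst.prodMk (h1.comp continuous_snd).snd))
  refine hasDerivAt_setIntegral_of_isCompact (F := fun a z => Real.sin z.2.1 * (t ^ 2 * z.1 *
      G (conePt c t (rotMap j k a x) (fun i => rotMap j k a (b i)) z)))
    (F' := fun a z => Real.sin z.2.1 * (t ^ 2 * z.1 *
      rot j k G (conePt c t (rotMap j k a x) (fun i => rotMap j k a (b i)) z)))
    isCompact_coneBox one_pos (hcont hG.continuousOn)
    (hcont (contDiffOn_rot hG j k).continuousOn) fun a' _ z hz _ => ?_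
  simp only [conePt_rotMap]
  exact ((hasDerivAt_comp_rotMap (hG.of_le (by norm_cast)) hjk
    (mem_halfSpace.1 (conePt_mem_halfSpace ht x b hz)) a' _).const_mul _).const_mul _

theorem contDiffOn_rot_one {u : ℝ × E3 → ℝ} (hu : ContDiffOn ℝ 2 u halfSpace) (j k : Fin 3) :
    ContDiffOn ℝ 1 (rot j k u) halfSpace := by
  have h : ∀ w : ℝ × E3, ContDiffOn ℝ 1 (fun p => hD u p w) halfSpace := fun w =>
    (contDiffOn_hD (n := 1) (by simpa [one_add_one_eq_two] using hu)).clm_apply contDiffOn_const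
  have h2 : ∀ j, ContDiff ℝ 1 (fun p : ℝ × E3 => p.2 j) := fun j =>
    (contDiff_coord j).of_le (by norm_cast)
  exact ((h2 j).contDiffOn.mul (h _)).sub ((h2 k).contDiffOn.mul (h _))

/-- The second rotational derivative of a solution with a representation that is covariant under
rotations is the second derivative of the representation. -/
theorem rot_rot_eq_of_repr {u : ℝ × E3 → ℝ} (hu : ContDiffOn ℝ 2 u halfSpace) {j k : Fin 3}
    (hjk : j ≠ k) {t : ℝ} (ht : 0 ≤ t) (x : E3) {f f' : ℝ → ℝ} {m f'' : ℝ}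
    (hf : ∀ a, m * u (t, rotMap j k a x) = f a) (hf' : ∀ a, HasDerivAt f (f' a) a)
    (hf'' : HasDerivAt f' f'' 0) : m * rot j k (rot j k u) (t, x) = f'' := by
  have h1 : ∀ a, m * rot j k u (t, rotMap j k a x) = f' a := by
    intro a
    have := (hasDerivAt_comp_rotMap (hu.of_le one_le_two) hjk ht a x).const_mul m
    simp only [hf] at this
    exact this.unique (hf' a)
  have := (hasDerivAt_comp_rotMap (contDiffOn_rot_one hu j k) hjk ht 0 x).const_mul m
  simp only [h1, rotMap_zero] at this
  exact this.unique hf''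

/-! ### Solutions with zero data as retarded potentials -/

section Inhomogeneous

variable {c t : ℝ} {u G : ℝ × E3 → ℝ}

theorem hD_eq_sum (f : ℝ × E3 → ℝ) (p : ℝ × E3) (a : ℝ) (v : E3) :
    hD f p (a, v) = a * dt f p + ∑ j, v j * dx j f p := by
  have h : (a, v) = a • ((1 : ℝ), (0 : E3))
      + ∑ j, v j • ((0 : ℝ), (EuclideanSpace.single j (1 : ℝ) : E3)) := by
    refine Prod.ext ?_ ?_
    · simp [Fin.sum_univ_three]
    · ext i; fin_cases i <;> simp [Fin.sum_univ_three]
  rw [h, map_add, map_smul, map_sum]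
  simp only [map_smul, smul_eq_mul]
  rfl

theorem dPlus_eq_hD {x : E3} (u : ℝ × E3 → ℝ) (c t : ℝ) :
    dPlus c u (t, x) = hD u (t, x) (1, c • (‖x‖⁻¹ • x)) := by
  rw [hD_eq_sum, dPlus, one_mul, Finset.mul_sum]
  congr 1
  refine Finset.sum_congr rfl fun j _ => ?_
  simp
  ring

theorem hD_zero_of_init {φ ψ : E3 → ℝ} (hu : IsSolution c G φ ψ u) (hφ : ContDiff ℝ 1 φ) (x v : E3)
    (a : ℝ) : hD u (0, x) (a, v) = a * ψ x + fderiv ℝ φ x v := by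
  have h1 : (a, v) = a • ((1 : ℝ), (0 : E3)) + ((0 : ℝ), v) := by simp
  rw [h1, map_add, map_smul, smul_eq_mul, ← hu.init_dt x]
  congr 1
  have hl : HasDerivAt (fun s : ℝ => x + s • v) v 0 := by
    simpa using ((hasDerivAt_id (0 : ℝ)).smul_const v).const_add x
  have h2 := hasDerivAt_comp_curve (hu.contDiffOn.of_le one_le_two)
    ((hasDerivAt_const (0 : ℝ) (0 : ℝ)).prodMk hl) (Eventually.of_forall fun s => mem_halfSpace.2 le_rfl)
  simp only [hu.init] at h2
  have h3 := (((hφ.differentiable one_ne_zero) (x + (0 : ℝ) • v)).hasFDerivAt).comp_hasDerivAt (0 : ℝ) hl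
  have := h2.unique h3
  simpa using this

theorem repr_retPot (hc : 0 < c) (ht : 0 < t) (hG : ContDiffOn ℝ ∞ G halfSpace)
    (hu : IsSolution c G (fun _ => 0) (fun _ => 0) u) (x : E3) {b : Fin 3 → E3}
    (hb : Orthonormal ℝ b) : 4 * Real.pi * u (t, x) = retPot c t x b G := by
  rw [kirchhoff hc ht hu.contDiffOn hG.continuousOn hu.eqn x hb]
  have h : ∀ y v : E3, hD u (0, y) (1, v) = 0 := by
    intro y v
    rw [hD_zero_of_init hu contDiff_const]
    simp
  simp only [h, hu.init, mul_zero, add_zero, integral_zero, zero_add]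
  rfl

/-- This replaces the commutation of `Ω_{jk}²` with `□_c`, which would require more derivatives of
`u` than the two available. Only the smooth `G` is differentiated. -/
theorem repr_rot_rot (hc : 0 < c) (ht : 0 < t) (hG : ContDiffOn ℝ ∞ G halfSpace)
    (hu : IsSolution c G (fun _ => 0) (fun _ => 0) u) (x : E3) {b : Fin 3 → E3}
    (hb : Orthonormal ℝ b) {j k : Fin 3} (hjk : j ≠ k) :
    4 * Real.pi * rot j k (rot j k u) (t, x) = retPot c t x b (rot j k (rot j k G)) := by
  have h := hasDerivAt_retPot_rotMap hjk ht.le x b (c := c) (contDiffOn_rot hG j k) 0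
  simp only [rotMap_zero] at h
  exact rot_rot_eq_of_repr hu.contDiffOn hjk ht.le x
    (fun a => repr_retPot hc ht hG hu _ (orthonormal_rotMap hjk a hb))
    (hasDerivAt_retPot_rotMap hjk ht.le x b hG) h

theorem abs_hD_le_zNorm (f : ℝ × E3 → ℝ) (p : ℝ × E3) (a : ℝ) (v : E3) {s : ℕ} (hs : 1 ≤ s) :
    |hD f p (a, v)| ≤ (|a| + 3 * ‖v‖) * zNorm s f p := by
  have h0 : |dt f p| ≤ zNorm s f p := abs_zField_iterate_le_zNorm f p 0 (n := 1) hs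
  have hj : ∀ j, |dx j f p| ≤ zNorm s f p := by
    intro j
    fin_cases j
    · exact abs_zField_iterate_le_zNorm f p 1 (n := 1) hs
    · exact abs_zField_iterate_le_zNorm f p 2 (n := 1) hs
    · exact abs_zField_iterate_le_zNorm f p 3 (n := 1) hs
  have hv : ∀ j, |v j * dx j f p| ≤ ‖v‖ * zNorm s f p := by
    intro j
    rw [abs_mul]
    exact mul_le_mul (PiLp.norm_apply_le v j) (hj j) (abs_nonneg _) (norm_nonneg _)
  rw [hD_eq_sum]
  calc |a * dt f p + ∑ j, v j * dx j f p|
      ≤ |a * dt f p| + ∑ j, |v j * dx j f p| :=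
        (abs_add_le _ _).trans (add_le_add le_rfl (Finset.abs_sum_le_sum_abs _ _))
    _ ≤ |a| * zNorm s f p + ∑ _j : Fin 3, ‖v‖ * zNorm s f p := by
        refine add_le_add ?_ (Finset.sum_le_sum fun j _ => hv j)
        rw [abs_mul]
        exact mul_le_mul_of_nonneg_left h0 (abs_nonneg _)
    _ = (|a| + 3 * ‖v‖) * zNorm s f p := by
        simp; ring

/-- The derivative of a solution in a null direction is controlled by retarded potentials. -/
theorem abs_dPlus_le_retPot (hc : 0 < c) (ht : 0 < t) (hG : ContDiffOn ℝ ∞ G halfSpace)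
    (hu : IsSolution c G (fun _ => 0) (fun _ => 0) u) {x : E3} (hx : x ≠ 0) {b : Fin 3 → E3}
    (hb : Orthonormal ℝ b) :
    4 * Real.pi * |dPlus c u (t, x)|
      ≤ (2 / t + (1 + 6 * c)) * retPot c t x b (zNorm 2 G) := by
  set e : E3 := ‖x‖⁻¹ • x with he
  have hen : ‖e‖ = 1 := by rw [he, norm_smul, norm_inv, norm_norm, inv_mul_cancel₀ (norm_ne_zero_iff.2 hx)]
  have cs := continuous_sph b
  -- The apex moves along `(1, c e)` with the parameters `z` fixed, so only `(t + h) ^ 2` and the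
  -- argument of `G` vary. The derivative of the former is the origin of the summand `2 / t`.
  set P : ℝ → ℝ × (ℝ × ℝ) → ℝ × E3 := fun h z => conePt c (t + h) (x + (c * h) • e) b z with hP
  set V : ℝ × (ℝ × ℝ) → ℝ × E3 := fun z => (1 - z.1, c • e + (c * z.1) • sph b z.2) with hV
  set F : ℝ → ℝ × (ℝ × ℝ) → ℝ := fun h z => Real.sin z.2.1 * ((t + h) ^ 2 * z.1 * G (P h z)) with hF
  set F' : ℝ → ℝ × (ℝ × ℝ) → ℝ := fun h z => Real.sin z.2.1 * (2 * (t + h) * z.1 * G (P h z)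
    + (t + h) ^ 2 * z.1 * hD G (P h z) (V z)) with hF'
  have hPc : Continuous fun w : ℝ × (ℝ × (ℝ × ℝ)) => P w.1 w.2 := by
    simp only [hP, conePt]; fun_prop
  have hVc : Continuous V := by rw [hV]; fun_prop
  have hmem : ∀ h ∈ Icc (0 - t / 2) (0 + t / 2), ∀ z ∈ coneBox, P h z ∈ halfSpace :=
    fun h hh z hz => conePt_mem_halfSpace (by linarith [hh.1]) _ _ hz
  have hm : MapsTo (fun w : ℝ × (ℝ × (ℝ × ℝ)) => P w.1 w.2)
      (Icc (0 - t / 2) (0 + t / 2) ×ˢ coneBox) halfSpace := fun w hw => hmem _ hw.1 _ hw.2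
  have hGP := hG.continuousOn.comp hPc.continuousOn hm
  have hDP := continuousOn_hD_comp (hG.of_le (by norm_cast)) hPc.continuousOn hm
    (hVc.comp continuous_snd).continuousOn
  have hFc : ContinuousOn (fun w : ℝ × (ℝ × (ℝ × ℝ)) => F w.1 w.2)
      (Icc (0 - t / 2) (0 + t / 2) ×ˢ coneBox) :=
    (by fun_prop : Continuous fun w : ℝ × (ℝ × (ℝ × ℝ)) => Real.sin w.2.2.1).continuousOn.mul
      ((by fun_prop : Continuous fun w : ℝ × (ℝ × (ℝ × ℝ)) => (t + w.1) ^ 2 * w.2.1).continuousOn.mul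
        hGP)
  have hFc' : ContinuousOn (fun w : ℝ × (ℝ × (ℝ × ℝ)) => F' w.1 w.2)
      (Icc (0 - t / 2) (0 + t / 2) ×ˢ coneBox) :=
    (by fun_prop : Continuous fun w : ℝ × (ℝ × (ℝ × ℝ)) => Real.sin w.2.2.1).continuousOn.mul
      (((by fun_prop : Continuous fun w : ℝ × (ℝ × (ℝ × ℝ)) =>
        2 * (t + w.1) * w.2.1).continuousOn.mul hGP).add
      ((by fun_prop : Continuous fun w : ℝ × (ℝ × (ℝ × ℝ)) => (t + w.1) ^ 2 * w.2.1).continuousOn.mul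
        hDP))
  have hder : HasDerivAt (fun h => ∫ z in coneBox, F h z) (∫ z in coneBox, F' 0 z) 0 := by
    refine hasDerivAt_setIntegral_of_isCompact isCompact_coneBox (half_pos ht) hFc hFc' ?_
    intro h _ z hz hh
    have h1 : HasDerivAt (fun h : ℝ => t + h) 1 h := (hasDerivAt_id h).const_add t
    have h2 : HasDerivAt (fun h => P h z) (V z) h := by
      have a1 : HasDerivAt (fun h : ℝ => (t + h) * (1 - z.1)) (1 - z.1) h := by
        simpa using h1.mul_const (1 - z.1)
      have a2 : HasDerivAt (fun h : ℝ => c * h) c h := by simpa using (hasDerivAt_id h).const_mul c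
      have a3 : HasDerivAt (fun h : ℝ => c * (t + h) * z.1) (c * z.1) h := by
        simpa using (h1.const_mul c).mul_const z.1
      exact a1.prodMk (((a2.smul_const e).const_add x).fun_add (a3.smul_const (sph b z.2)))
    have h3 := hasDerivAt_comp_curve (f := G) (hG.of_le (by norm_cast)) h2 (by
      filter_upwards [Ioo_mem_nhds hh.1 hh.2] with r hr
      exact hmem r (Ioo_subset_Icc_self hr) z hz)
    have h4 : HasDerivAt (fun h : ℝ => (t + h) ^ 2 * z.1) (2 * (t + h) * z.1) h := by
      simpa using (h1.pow 2).mul_const z.1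
    exact (h4.fun_mul h3).const_mul _
  have hcurve : HasDerivAt (fun h : ℝ => (t + h, x + (c * h) • e)) (1, c • e) 0 := by
    have h1 : HasDerivAt (fun h : ℝ => t + h) 1 0 := (hasDerivAt_id (0 : ℝ)).const_add t
    have a2 : HasDerivAt (fun h : ℝ => c * h) c 0 := by
      simpa using (hasDerivAt_id (0 : ℝ)).const_mul c
    exact h1.prodMk ((a2.smul_const e).const_add x)
  have hev : ∀ᶠ h : ℝ in 𝓝 0, 0 < t + h := by
    filter_upwards [Ioi_mem_nhds (neg_lt_zero.2 ht)] with h hh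
    have : -t < h := hh
    linarith
  have h5 := (hasDerivAt_comp_curve (hu.contDiffOn.of_le one_le_two) hcurve
    (hev.mono fun h hh => mem_halfSpace.2 hh.le)).const_mul (4 * Real.pi)
  have h6 : (fun h : ℝ => 4 * Real.pi * u (t + h, x + (c * h) • e))
      =ᶠ[𝓝 0] fun h => ∫ z in coneBox, F h z :=
    hev.mono fun h hh => repr_retPot hc hh hG hu _ hb
  have h7 := h5.unique (hder.congr_of_eventuallyEq h6)
  simp only [add_zero, mul_zero, zero_smul] at h7
  rw [← dPlus_eq_hD] at h7
  have hpi : (0 : ℝ) ≤ 4 * Real.pi := by positivity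
  have h8 : 4 * Real.pi * |dPlus c u (t, x)| = |4 * Real.pi * dPlus c u (t, x)| := by
    rw [abs_mul, abs_of_nonneg hpi]
  rw [h8, h7, retPot, ← integral_const_mul]
  refine abs_integral_le_integral_abs.trans ?_
  have h0 : (0 : ℝ) ∈ Icc (0 - t / 2) (0 + t / 2) := ⟨by linarith, by linarith⟩
  have hi : IntegrableOn (fun z => F' 0 z) coneBox :=
    (hFc'.comp (by fun_prop : Continuous fun z : ℝ × (ℝ × ℝ) => ((0 : ℝ), z)).continuousOn
      fun z hz => ⟨h0, hz⟩).integrableOn_compact isCompact_coneBox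
  refine setIntegral_mono_on hi.abs ((continuousOn_retPot_integrand ht.le x b
    (continuousOn_zNorm hG 2)).integrableOn_compact isCompact_coneBox |>.const_mul _)
    isCompact_coneBox.measurableSet fun z hz => ?_
  have hs := sin_nonneg_of_mem_angles hz.2
  have hz0 := hz.1.1
  have hz1 := hz.1.2
  have hP0 : P 0 z = conePt c t x b z := by simp [hP]
  simp only [hF', hP0, add_zero]
  set p := conePt c t x b z
  have b1 : |G p| ≤ zNorm 2 G p := abs_zField_iterate_le_zNorm G p 0 (n := 0) (by norm_num)
  -- The time component of `V` is at most `1` and its space component at most `2c` in norm; three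
  -- coordinate derivatives then give `1 + 6c`.
  have b2 : |hD G p (V z)| ≤ (1 + 6 * c) * zNorm 2 G p := by
    refine (abs_hD_le_zNorm G p _ _ one_le_two).trans ?_
    refine mul_le_mul_of_nonneg_right ?_ (zNorm_nonneg _ _ _)
    have n1 : ‖c • e + (c * z.1) • sph b z.2‖ ≤ c + c * z.1 := by
      refine (norm_add_le _ _).trans ?_
      rw [norm_smul c e, norm_smul _ (sph b z.2), hen, norm_sph hb, Real.norm_eq_abs, Real.norm_eq_abs, abs_of_pos hc,
        abs_of_nonneg (by positivity), mul_one, mul_one]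
    rw [abs_of_nonneg (by linarith)]
    nlinarith
  rw [abs_mul, abs_of_nonneg hs]
  calc Real.sin z.2.1 * |2 * t * z.1 * G p + t ^ 2 * z.1 * hD G p (V z)|
      ≤ Real.sin z.2.1 * (2 * t * z.1 * zNorm 2 G p
          + t ^ 2 * z.1 * ((1 + 6 * c) * zNorm 2 G p)) := by
        refine mul_le_mul_of_nonneg_left ((abs_add_le _ _).trans (add_le_add ?_ ?_)) hs
        · rw [abs_mul, abs_of_nonneg (by positivity : 0 ≤ 2 * t * z.1)]
          gcongr
        · rw [abs_mul, abs_of_nonneg (by positivity : 0 ≤ t ^ 2 * z.1)]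
          gcongr
    _ = (2 / t + (1 + 6 * c)) * (Real.sin z.2.1 * (t ^ 2 * z.1 * zNorm 2 G p)) := by
        field_simp

end Inhomogeneous

/-! ### The spherical Laplacian with respect to the origin -/

/-- `rotGen` as a linear map. -/
noncomputable def rotGenLin (j k : Fin 3) : E3 →ₗ[ℝ] E3 where
  toFun := rotGen j k
  map_add' y z := by simp only [rotGen, PiLp.add_apply]; module
  map_smul' m y := by simp only [rotGen, PiLp.smul_apply, smul_eq_mul, RingHom.id_apply]; module

/-- This is the second derivative along a circular orbit; the first-order term is the acceleration
of the orbit. -/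
theorem rot_rot_eq {u : ℝ × E3 → ℝ} (hu : ContDiffOn ℝ 2 u halfSpace) {j k : Fin 3} (hjk : j ≠ k)
    {t : ℝ} (ht : 0 ≤ t) (y : E3) :
    rot j k (rot j k u) (t, y)
      = hD2 u (t, y) ((0 : ℝ), rotGen j k y) ((0 : ℝ), rotGen j k y)
        + hD u (t, y) ((0 : ℝ), rotGen j k (rotGen j k y)) := by
  have hR : HasDerivAt (fun a => rotMap j k a y) (rotGen j k y) 0 := by
    simpa [rotMap_zero] using hasDerivAt_rotMap hjk 0 y
  have hA : HasDerivAt (fun a => rotGen j k (rotMap j k a y)) (rotGen j k (rotGen j k y)) 0 :=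
    ((rotGenLin j k).toContinuousLinearMap.hasFDerivAt.comp_hasDerivAt (0 : ℝ) hR)
  have h1 := hasDerivAt_hD_comp_curve hu ((hasDerivAt_const (0 : ℝ) t).prodMk hR)
    (Eventually.of_forall fun _ => mem_halfSpace.2 ht) ((hasDerivAt_const (0 : ℝ) (0 : ℝ)).prodMk hA)
  have h2 := hasDerivAt_comp_rotMap (contDiffOn_rot_one hu j k) hjk ht 0 y
  simp only [rot_eq_hD j k u, rotMap_zero] at h1 h2
  exact h2.unique h1

/-- The accelerations `rotGen j k (rotGen j k y)` add up to `-2y` and supply the radial term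
`-2∂_ν`. The quadratic terms give `|y|²` times the trace minus the radial second derivative, by `‖e‖
= 1`. -/
theorem sphLap_eq_sum_rot {u : ℝ × E3 → ℝ} (hu : ContDiffOn ℝ 2 u halfSpace) {t : ℝ} (ht : 0 ≤ t)
    {ρ : ℝ} (hρ : 0 < ρ) {e : E3} (he : ‖e‖ = 1) :
    sphLap u ρ e (t, ρ • e) = ρ⁻¹ * (rot 0 1 (rot 0 1 u) (t, ρ • e)
      + rot 0 2 (rot 0 2 u) (t, ρ • e) + rot 1 2 (rot 1 2 u) (t, ρ • e)) := by
  have hp : (t, ρ • e) ∈ halfSpace := mem_halfSpace.2 ht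
  have hn : e 0 ^ 2 + e 1 ^ 2 + e 2 ^ 2 = 1 := by
    have h1 := EuclideanSpace.norm_sq_eq e
    rw [he, Fin.sum_univ_three] at h1
    simpa using h1.symm
  rw [rot_rot_eq hu (by decide) ht, rot_rot_eq hu (by decide) ht, rot_rot_eq hu (by decide) ht]
  have hdec : ((0 : ℝ), e) = e 0 • ((0 : ℝ), (EuclideanSpace.single 0 (1 : ℝ) : E3))
      + e 1 • ((0 : ℝ), (EuclideanSpace.single 1 (1 : ℝ) : E3))
      + e 2 • ((0 : ℝ), (EuclideanSpace.single 2 (1 : ℝ) : E3)) := by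
    refine Prod.ext (by simp) ?_
    ext i; fin_cases i <;> simp
  have hgen : ∀ j k : Fin 3, ∀ y : E3, ((0 : ℝ), rotGen j k y)
      = y j • ((0 : ℝ), (EuclideanSpace.single k (1 : ℝ) : E3))
        - y k • ((0 : ℝ), (EuclideanSpace.single j (1 : ℝ) : E3)) := by
    intro j k y; simp [rotGen]
  have s01 := hD2_symm hu hp ((0 : ℝ), (EuclideanSpace.single 0 (1 : ℝ) : E3))
    ((0 : ℝ), (EuclideanSpace.single 1 (1 : ℝ) : E3))
  have s02 := hD2_symm hu hp ((0 : ℝ), (EuclideanSpace.single 0 (1 : ℝ) : E3))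
    ((0 : ℝ), (EuclideanSpace.single 2 (1 : ℝ) : E3))
  have s12 := hD2_symm hu hp ((0 : ℝ), (EuclideanSpace.single 1 (1 : ℝ) : E3))
    ((0 : ℝ), (EuclideanSpace.single 2 (1 : ℝ) : E3))
  simp only [sphLap, hdec, hgen, Fin.sum_univ_three, map_add, map_sub, map_smul, add_apply,
    sub_apply, smul_apply, smul_eq_mul, s01, s02, s12, PiLp.smul_apply]
  have g0 : ∀ j k : Fin 3, j ≠ k → rotGen j k (ρ • e) j = -(ρ * e k) := by
    intro j k h; simp [rotGen, h]
  have g1 : ∀ j k : Fin 3, j ≠ k → rotGen j k (ρ • e) k = ρ * e j := by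
    intro j k h; simp [rotGen, h.symm]
  rw [g0 0 1 (by decide), g0 0 2 (by decide), g0 1 2 (by decide), g1 0 1 (by decide),
    g1 0 2 (by decide), g1 1 2 (by decide)]
  generalize hD2 u (t, ρ • e) = B at *
  field_simp
  linear_combination (-ρ * (B (0, EuclideanSpace.single 0 1) (0, EuclideanSpace.single 0 1)
    + B (0, EuclideanSpace.single 1 1) (0, EuclideanSpace.single 1 1)
    + B (0, EuclideanSpace.single 2 1) (0, EuclideanSpace.single 2 1))) * hn

/-! ### The bracket and the weight -/

theorem one_le_jb (a : ℝ) : 1 ≤ jb a := Real.one_le_sqrt.2 (by nlinarith [sq_nonneg a])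

theorem jb_pos (a : ℝ) : 0 < jb a := zero_lt_one.trans_le (one_le_jb a)

theorem abs_le_jb (a : ℝ) : |a| ≤ jb a := Real.abs_le_sqrt (by linarith)

theorem jb_le_one_add_abs (a : ℝ) : jb a ≤ 1 + |a| :=
  Real.sqrt_le_iff.2 ⟨by positivity, by nlinarith [abs_nonneg a, sq_abs a]⟩

theorem jb_le_jb {a b : ℝ} (h : |a| ≤ |b|) : jb a ≤ jb b :=
  Real.sqrt_le_sqrt (by linarith [sq_le_sq.2 h])

theorem jb_le_mul_jb {a b m : ℝ} (hm : 1 ≤ m) (h : |a| ≤ m * |b|) : jb a ≤ m * jb b := by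
  refine Real.sqrt_le_iff.2 ⟨mul_nonneg (by linarith) (jb_pos b).le, ?_⟩
  have h1 : jb b ^ 2 = 1 + b ^ 2 := Real.sq_sqrt (by positivity)
  have h2 : |a| ^ 2 ≤ (m * |b|) ^ 2 := by gcongr
  rw [mul_pow, sq_abs, sq_abs] at h2
  rw [mul_pow, h1]
  nlinarith

theorem continuous_jb : Continuous jb := by unfold jb; fun_prop

theorem continuous_jb_rpow (m : ℝ) : Continuous fun a => jb a ^ m :=
  continuous_jb.rpow_const fun a => Or.inl (jb_pos a).ne'

theorem jb_rpow_nonneg (a m : ℝ) : 0 ≤ jb a ^ m := Real.rpow_nonneg (jb_pos a).le m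

theorem jb_rpow_le_one (a : ℝ) {m : ℝ} (hm : m ≤ 0) : jb a ^ m ≤ 1 :=
  Real.rpow_le_one_of_one_le_of_nonpos (one_le_jb a) hm

theorem jb_neg_rpow_le {a b m k : ℝ} (hm : 0 < m) (hk : 0 ≤ k) (h : jb b ≤ m * jb a) :
    jb a ^ (-k) ≤ m ^ k * jb b ^ (-k) := by
  rw [Real.rpow_neg (jb_pos a).le, Real.rpow_neg (jb_pos b).le, ← div_eq_mul_inv,
    le_div_iff₀ (Real.rpow_pos_of_pos (jb_pos b) k), inv_mul_le_iff₀
    (Real.rpow_pos_of_pos (jb_pos a) k), mul_comm, ← Real.mul_rpow hm.le (jb_pos a).le]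
  exact Real.rpow_le_rpow (jb_pos b).le h hk

theorem integrable_jb_rpow {μ : ℝ} (hμ : 0 < μ) : Integrable fun a : ℝ => jb a ^ (-(1 + μ)) := by
  have h := integrable_rpow_neg_one_add_norm_sq (E := ℝ) (μ := volume) (r := 1 + μ) (by simpa using hμ)
  refine h.congr (Eventually.of_forall fun a => ?_)
  simp only [jb, Real.sqrt_eq_rpow, Real.norm_eq_abs, sq_abs]
  rw [← Real.rpow_mul (by positivity)]
  congr 1; ring

theorem one_le_weight {N : ℕ} (cs : Fin N → ℝ) (t r : ℝ) : 1 ≤ weight cs t r :=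
  Finset.le_inf' _ _ fun _ _ => one_le_jb _

/-- The minimum is attained, so its power is one of the summands; each summand can then be
integrated separately. -/
theorem weight_rpow_le_sum {N : ℕ} (cs : Fin N → ℝ) (t r m : ℝ) :
    weight cs t r ^ m ≤ ∑ j, jb ((Fin.cons 0 cs : Fin (N + 1) → ℝ) j * t - r) ^ m := by
  obtain ⟨j, -, hj⟩ := Finset.exists_mem_eq_inf' (s := (Finset.univ : Finset (Fin (N + 1))))
    Finset.univ_nonempty (fun j => jb ((Fin.cons 0 cs : Fin (N + 1) → ℝ) j * t - r))
  rw [weight, hj]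
  exact Finset.single_le_sum (f := fun j => jb ((Fin.cons 0 cs : Fin (N + 1) → ℝ) j * t - r) ^ m)
    (fun _ _ => jb_rpow_nonneg _ _) (Finset.mem_univ j)

/-! ### Spherical means of functions with a radial majorant -/

/-- Archimedes' hat-box theorem as an inequality. -/
theorem integral_sphere_le {b : Fin 3 → E3} (hb : Orthonormal ℝ b) {r ρ : ℝ} (hr : 0 < r)
    (hρ : 0 < ρ) {f : E3 → ℝ} {Hh : ℝ → ℝ} (hH : Continuous Hh)
    (hf : ContinuousOn (fun q => f (r • b 2 + ρ • sph b q)) angles)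
    (h : ∀ q ∈ angles, ‖r • b 2 + ρ • sph b q‖ * |f (r • b 2 + ρ • sph b q)|
      ≤ Hh ‖r • b 2 + ρ • sph b q‖) :
    ∫ q in angles, Real.sin q.1 * |f (r • b 2 + ρ • sph b q)|
      ≤ 2 * Real.pi / (r * ρ) * ∫ l in |r - ρ|..(r + ρ), Hh l := by
  -- By the law of cosines `l = √(S ϑ)` is the distance to the origin, and `l dl = -r ρ sin ϑ dϑ`.
  -- The factor `‖·‖` in the hypothesis is exactly the one in this Jacobian.
  set S : ℝ → ℝ := fun ϑ => r ^ 2 + ρ ^ 2 + 2 * r * ρ * Real.cos ϑ with hS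
  have hnorm : ∀ q, ‖r • b 2 + ρ • sph b q‖ = √(S q.1) := by
    intro q
    rw [← Real.sqrt_sq (norm_nonneg _)]
    congr 1
    have h0 := orthonormal_iff_ite.1 hb
    have hi : inner ℝ (b 2) (sph b q) = Real.cos q.1 := by
      simp only [sph, inner_add_right, real_inner_smul_right, h0]
      simp
    rw [norm_add_sq_real, norm_smul, norm_smul, norm_sph hb, hb.1, real_inner_smul_left,
      real_inner_smul_right, hi, Real.norm_eq_abs, Real.norm_eq_abs, abs_of_pos hr, abs_of_pos hρ]
    simp only [hS]; ring
  have hSpos : ∀ ϑ ∈ Ioo 0 Real.pi, 0 < S ϑ := by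
    intro ϑ hϑ
    have h1 : -1 < Real.cos ϑ := by
      rw [← Real.cos_pi]
      exact Real.cos_lt_cos_of_nonneg_of_le_pi hϑ.1.le le_rfl hϑ.2
    have h2 : 0 < r * ρ := mul_pos hr hρ
    simp only [hS]
    nlinarith [sq_nonneg (r - ρ)]
  have hcont : ContinuousOn (fun q => Real.sin q.1 * |f (r • b 2 + ρ • sph b q)|)
      (Icc 0 Real.pi ×ˢ Icc 0 (2 * Real.pi)) :=
    (by fun_prop : Continuous fun q : ℝ × ℝ => Real.sin q.1).continuousOn.mul hf.abs
  have key : ∀ θ ∈ Icc (0 : ℝ) (2 * Real.pi),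
      ∫ ϑ in (0 : ℝ)..Real.pi, Real.sin ϑ * |f (r • b 2 + ρ • sph b (ϑ, θ))|
        ≤ (r * ρ)⁻¹ * ∫ l in |r - ρ|..(r + ρ), Hh l := by
    intro θ hθ
    have hprim : ∀ y : ℝ, HasDerivAt (fun y => ∫ l in (0 : ℝ)..y, Hh l) (Hh y) y := fun y =>
      intervalIntegral.integral_hasDerivAt_right (hH.intervalIntegrable _ _)
        (hH.stronglyMeasurableAtFilter _ _) hH.continuousAt
    have hprimc : Continuous (fun y => ∫ l in (0 : ℝ)..y, Hh l) :=
      continuous_iff_continuousAt.2 fun y => (hprim y).continuousAt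
    have hSc : Continuous S := by rw [hS]; fun_prop
    -- The comparison with a primitive needs derivatives in the open interval only: if `r = ρ`, then
    -- `S` vanishes at `ϑ = π` and its root need not be differentiable there.
    have hle := intervalIntegral.integral_le_sub_of_hasDeriv_right_of_le Real.pi_pos.le
      (g := fun ϑ => -((r * ρ)⁻¹ * ∫ l in (0 : ℝ)..√(S ϑ), Hh l))
      (g' := fun ϑ => Hh √(S ϑ) * Real.sin ϑ / √(S ϑ))
      (φ := fun ϑ => Real.sin ϑ * |f (r • b 2 + ρ • sph b (ϑ, θ))|) ?_ ?_ ?_ ?_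
    · refine hle.trans (le_of_eq ?_)
      have e1 : √(S 0) = r + ρ := by
        simp only [hS, Real.cos_zero]
        rw [← Real.sqrt_sq (by positivity : 0 ≤ r + ρ)]; congr 1; ring
      have e2 : √(S Real.pi) = |r - ρ| := by
        simp only [hS, Real.cos_pi]
        rw [← Real.sqrt_sq_eq_abs]; congr 1; ring
      simp only [e1, e2]
      rw [← intervalIntegral.integral_interval_sub_left (hH.intervalIntegrable 0 (r + ρ))
        (hH.intervalIntegrable 0 |r - ρ|)]
      ring
    · exact ((hprimc.comp (Real.continuous_sqrt.comp hSc)).const_mul _).neg.continuousOn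
    · intro ϑ hϑ
      have hSd : HasDerivAt S (-(2 * r * ρ * Real.sin ϑ)) ϑ := by
        exact (((Real.hasDerivAt_cos ϑ).const_mul (2 * r * ρ)).const_add
          (r ^ 2 + ρ ^ 2)).congr_deriv (by ring)
      have h1 := hSd.sqrt (hSpos ϑ hϑ).ne'
      have h2 := (((hprim √(S ϑ)).comp ϑ h1).const_mul (r * ρ)⁻¹).neg
      refine (h2.congr_deriv ?_).hasDerivWithinAt
      have := Real.sqrt_pos.2 (hSpos ϑ hϑ)
      field_simp
    · exact (hcont.comp (by fun_prop : Continuous fun ϑ : ℝ => (ϑ, θ)).continuousOn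
        fun ϑ hϑ => ⟨hϑ, hθ⟩).integrableOn_compact isCompact_Icc
    · intro ϑ hϑ
      have h1 := h (ϑ, θ) ⟨Ioo_subset_Icc_self hϑ, hθ⟩
      rw [hnorm] at h1
      have h2 := Real.sqrt_pos.2 (hSpos ϑ hϑ)
      have h3 := Real.sin_nonneg_of_mem_Icc (Ioo_subset_Icc_self hϑ)
      rw [le_div_iff₀ h2]
      calc Real.sin ϑ * |f (r • b 2 + ρ • sph b (ϑ, θ))| * √(S ϑ)
          = (√(S ϑ) * |f (r • b 2 + ρ • sph b (ϑ, θ))|) * Real.sin ϑ := by ring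
        _ ≤ _ := mul_le_mul_of_nonneg_right h1 h3
  have h2pi : (0 : ℝ) ≤ 2 * Real.pi := by positivity
  rw [angles, setIntegral_box_snd Real.pi_pos.le isCompact_Icc hcont]
  have hi : IntegrableOn (fun θ => ∫ ϑ in (0 : ℝ)..Real.pi,
      Real.sin ϑ * |f (r • b 2 + ρ • sph b (ϑ, θ))|) (Icc 0 (2 * Real.pi)) := by
    have hi : IntegrableOn _ (Icc 0 Real.pi ×ˢ Icc 0 (2 * Real.pi)) (volume.prod volume) :=
      hcont.integrableOn_compact (isCompact_Icc.prod isCompact_Icc)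
    rw [IntegrableOn, ← Measure.prod_restrict] at hi
    have := hi.integral_prod_right
    simpa only [IntegrableOn, intervalIntegral.integral_of_le Real.pi_pos.le,
      integral_Icc_eq_integral_Ioc] using this
  refine (setIntegral_mono_on hi (integrable_const _) measurableSet_Icc key).trans (le_of_eq ?_)
  rw [setIntegral_const]
  simp [h2pi]
  field_simp

theorem intervalIntegrable_box {β : Type*} [TopologicalSpace β] [TopologicalSpace.MetrizableSpace β]
    [SecondCountableTopology β] [MeasureSpace β] [BorelSpace β]
    [IsLocallyFiniteMeasure (volume : Measure β)] [SFinite (volume : Measure β)]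
    {a b : ℝ} (hab : a ≤ b) {K : Set β} (hK : IsCompact K) {f : ℝ × β → ℝ}
    (hf : ContinuousOn f (Icc a b ×ˢ K)) :
    IntervalIntegrable (fun s => ∫ q in K, f (s, q)) volume a b := by
  have hi : IntegrableOn f (Icc a b ×ˢ K) (volume.prod volume) :=
    hf.integrableOn_compact (isCompact_Icc.prod hK)
  rw [IntegrableOn, ← Measure.prod_restrict] at hi
  rw [intervalIntegrable_iff_integrableOn_Icc_of_le hab]
  exact hi.integral_prod_left

theorem integrableOn_box {β : Type*} [TopologicalSpace β] [TopologicalSpace.MetrizableSpace β]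
    [SecondCountableTopology β] [MeasureSpace β] [BorelSpace β]
    [IsLocallyFiniteMeasure (volume : Measure β)] [SFinite (volume : Measure β)]
    {a b : ℝ} (hab : a ≤ b) {K : Set β} (hK : IsCompact K) {f : ℝ × β → ℝ}
    (hf : ContinuousOn f (Icc a b ×ˢ K)) :
    IntegrableOn (fun q => ∫ s in a..b, f (s, q)) K := by
  have hi : IntegrableOn f (Icc a b ×ˢ K) (volume.prod volume) :=
    hf.integrableOn_compact (isCompact_Icc.prod hK)
  rw [IntegrableOn, ← Measure.prod_restrict] at hi
  have := hi.integral_prod_right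
  simpa only [IntegrableOn, intervalIntegral.integral_of_le hab, integral_Icc_eq_integral_Ioc]
    using this

/-- Integrals of a decaying bracket along an affine path of speed `a`. -/
theorem mul_integral_jb_le {μ : ℝ} (hμ : 0 < μ) {a t : ℝ} (ha : 0 < a) (ht : 0 < t) (d : ℝ) :
    t * ∫ s in (0 : ℝ)..1, jb (a * (t * (1 - s)) - d) ^ (-(1 + μ))
      ≤ (1 + a⁻¹ * ∫ y, jb y ^ (-(1 + μ))) * min 1 t := by
  set I := ∫ y, jb y ^ (-(1 + μ)) with hI
  have hI0 : 0 ≤ I := integral_nonneg fun y => jb_rpow_nonneg _ _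
  have hc : Continuous fun s : ℝ => jb (a * (t * (1 - s)) - d) ^ (-(1 + μ)) :=
    (continuous_jb_rpow _).comp (by fun_prop)
  -- Brackets are at least `1`, which gives the bound `t`; the substitution below gives a bound
  -- uniform in `t`. The resulting factor `min 1 t` later compensates the summand `2 / t` of the
  -- differentiated Kirchhoff formula.
  have h1 : ∫ s in (0 : ℝ)..1, jb (a * (t * (1 - s)) - d) ^ (-(1 + μ)) ≤ 1 := by
    have := intervalIntegral.integral_mono_on (μ := volume) zero_le_one (hc.intervalIntegrable 0 1)
      (continuous_const (y := (1 : ℝ)).intervalIntegrable 0 1)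
      (fun s _ => jb_rpow_le_one _ (by linarith))
    simpa using this
  have h2 : t * ∫ s in (0 : ℝ)..1, jb (a * (t * (1 - s)) - d) ^ (-(1 + μ)) ≤ a⁻¹ * I := by
    have hat : a * t ≠ 0 := (mul_pos ha ht).ne'
    have e : ∀ s : ℝ, a * (t * (1 - s)) - d = (a * t - d) - (a * t) * s := fun s => by ring
    simp only [e]
    rw [intervalIntegral.integral_comp_sub_mul (fun y => jb y ^ (-(1 + μ))) hat, smul_eq_mul]
    have hle : ∫ y in (a * t - d - a * t * 1)..(a * t - d - a * t * 0), jb y ^ (-(1 + μ)) ≤ I := by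
      rw [intervalIntegral.integral_of_le (by nlinarith [mul_pos ha ht])]
      exact setIntegral_le_integral (integrable_jb_rpow hμ)
        (Eventually.of_forall fun y => jb_rpow_nonneg _ _)
    calc t * ((a * t)⁻¹ * ∫ y in (a * t - d - a * t * 1)..(a * t - d - a * t * 0), jb y ^ (-(1 + μ)))
        = a⁻¹ * ∫ y in (a * t - d - a * t * 1)..(a * t - d - a * t * 0), jb y ^ (-(1 + μ)) := by
          field_simp
      _ ≤ a⁻¹ * I := by gcongr
  have hainv : 0 ≤ a⁻¹ * I := by positivity
  rcases le_total 1 t with h | h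
  · rw [min_eq_left h]; linarith
  · rw [min_eq_right h]
    nlinarith

/-- The basic weighted `L^∞` estimate for retarded potentials. -/
theorem abs_retPot_le_of_weight {c : ℝ} (hc : 0 < c) {N : ℕ} {cs : Fin N → ℝ} (hcs : ∀ j, 0 < cs j)
    {κ μ : ℝ} (hκ : 0 ≤ κ) (hμ : 0 < μ) :
    ∃ C : ℝ, 0 < C ∧ ∀ (t : ℝ) (x : E3) (b : Fin 3 → E3) (g : ℝ × E3 → ℝ) (M : ℝ), 0 < t → x ≠ 0 →
      Orthonormal ℝ b → b 2 = ‖x‖⁻¹ • x → ContinuousOn g halfSpace → 0 ≤ M →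
      (∀ p ∈ cone c t x, ‖p.2‖ * |g p|
        ≤ M * (jb (p.1 + ‖p.2‖) ^ (-κ) * weight cs p.1 ‖p.2‖ ^ (-(1 + μ)))) →
      |retPot c t x b g| ≤ C * M * min 1 t * (‖x‖⁻¹ *
        ∫ p in |c * t - ‖x‖|..(c * t + ‖x‖), jb p ^ (-κ)) := by
  set I := ∫ y, jb y ^ (-(1 + μ)) with hI
  have hI0 : 0 ≤ I := integral_nonneg fun y => jb_rpow_nonneg _ _
  set cj : Fin (N + 1) → ℝ := Fin.cons 0 cs with hcj
  have hcj0 : ∀ j, 0 ≤ cj j := by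
    intro j
    refine Fin.cases ?_ (fun i => ?_) j
    · simp [hcj]
    · simpa [hcj] using (hcs i).le
  -- This is the price for replacing `⟨τ + |y|⟩` by `⟨cτ + |y|⟩`, the bracket adapted to the cone.
  set C1 := (1 + c) ^ κ with hC1
  have hC1p : 0 < C1 := Real.rpow_pos_of_pos (by linarith) _
  set C2 : ℝ := (N + 1) * (1 + c⁻¹ * I) with hC2
  have hC2p : 0 < C2 := by positivity
  refine ⟨2 * Real.pi / c * C1 * C2, by positivity, ?_⟩
  intro t x b g M ht hx hb hb2 hg hM hgM
  set r := ‖x‖ with hr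
  have hr0 : 0 < r := norm_pos_iff.2 hx
  have hxb : x = r • b 2 := by
    rw [hb2, smul_smul, mul_inv_cancel₀ hr0.ne', one_smul]
  set A := |c * t - r| with hA
  set X := c * t + r with hX
  have hct : 0 < c * t := mul_pos hc ht
  have hAX : A ≤ X := abs_le.2 ⟨by linarith, by linarith⟩
  -- The second variable is `p = cτ + |y|` with `τ = t(1 - s)`. For fixed `p` one has `c_j τ - |y| =
  -- (c_j + c)τ - p`, whose speed in `τ` is at least `c` for every `j`, including `c_0 = 0` and `c_j
  -- = c`.
  set Kf : ℝ × ℝ → ℝ := fun z => jb z.2 ^ (-κ) *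
    ∑ j, jb ((cj j + c) * (t * (1 - z.1)) - z.2) ^ (-(1 + μ)) with hKf
  have hKc : Continuous Kf := by
    refine ((continuous_jb_rpow _).comp continuous_snd).mul (continuous_finsetSum _ fun j _ =>
      (continuous_jb_rpow _).comp ?_)
    fun_prop
  have hK0 : ∀ z, 0 ≤ Kf z := fun z => mul_nonneg (jb_rpow_nonneg _ _)
    (Finset.sum_nonneg fun j _ => jb_rpow_nonneg _ _)
  have hgc := (continuousOn_retPot_integrand ht.le x b hg (c := c)).abs
  have hpt : ∀ z ∈ coneBox, |Real.sin z.2.1 * (t ^ 2 * z.1 * g (conePt c t x b z))|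
      = t ^ 2 * z.1 * (Real.sin z.2.1 * |g (conePt c t x b z)|) := by
    intro z hz
    rw [abs_mul, abs_mul, abs_of_nonneg (sin_nonneg_of_mem_angles hz.2),
      abs_of_nonneg (mul_nonneg (sq_nonneg t) hz.1.1)]
    ring
  have hslice : ∀ s ∈ Ioc (0 : ℝ) 1, ∫ q in angles,
      |Real.sin q.1 * (t ^ 2 * s * g (conePt c t x b (s, q)))|
        ≤ 2 * Real.pi * t / (r * c) * (M * C1) * ∫ p in Icc A X, Kf (s, p) := by
    intro s hs
    have hs0 : 0 < s := hs.1
    have hρ : 0 < c * t * s := by positivity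
    set τ := t * (1 - s) with hτ
    have hτ0 : 0 ≤ τ := mul_nonneg ht.le (by linarith [hs.2])
    have e1 : ∫ q in angles, |Real.sin q.1 * (t ^ 2 * s * g (conePt c t x b (s, q)))|
        = t ^ 2 * s * ∫ q in angles, Real.sin q.1 * |g (τ, r • b 2 + (c * t * s) • sph b q)| := by
      rw [← integral_const_mul]
      refine setIntegral_congr_fun isCompact_angles.measurableSet fun q hq => ?_
      have := hpt (s, q) ⟨⟨hs.1.le, hs.2⟩, hq⟩
      rw [← hxb]
      exact this
    set Hh : ℝ → ℝ := fun l => M * C1 * Kf (s, c * τ + l) with hHh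
    have hHc : Continuous Hh := by
      exact (hKc.comp (by fun_prop : Continuous fun l : ℝ => (s, c * τ + l))).const_mul _
    have hsp := integral_sphere_le hb hr0 hρ (f := fun y => g (τ, y)) hHc
      (hg.comp (Continuous.continuousOn (by have := continuous_sph b; fun_prop))
        fun q _ => mem_halfSpace.2 hτ0) (fun q hq => ?_)
    · have e2 : ∫ l in |r - c * t * s|..(r + c * t * s), Hh l
          ≤ M * C1 * ∫ p in Icc A X, Kf (s, p) := by
        rw [hHh, intervalIntegral.integral_const_mul]
        refine mul_le_mul_of_nonneg_left ?_ (by positivity)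
        rw [intervalIntegral.integral_comp_add_left (fun p => Kf (s, p)),
          intervalIntegral.integral_of_le, ← integral_Icc_eq_integral_Ioc]
        · refine setIntegral_mono_set ?_ (Eventually.of_forall fun p => hK0 _)
            (LE.le.eventuallyLE ?_)
          · exact (hKc.comp (by fun_prop : Continuous fun p : ℝ => (s, p))).continuousOn.integrableOn_compact
              isCompact_Icc
          · refine Icc_subset_Icc ?_ (le_of_eq ?_)
            -- The lower limit comes from the triangle inequality: `|ct - r| ≤ cτ + |r - c(t - τ)|`.
            -- Hence the range of `p` can be enlarged to one independent of `s`.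
            · have hct1 : 0 ≤ c * τ := by positivity
              have e3 : c * t - r = c * τ - (r - c * t * s) := by rw [hτ]; ring
              rw [hA, e3]
              calc |c * τ - (r - c * t * s)| ≤ |c * τ| + |r - c * t * s| := abs_sub _ _
                _ = _ := by rw [abs_of_nonneg hct1]
            · rw [hτ, hX]; ring
        · have : |r - c * t * s| ≤ r + c * t * s := abs_le.2 ⟨by linarith, by linarith⟩
          linarith
      rw [e1]
      calc t ^ 2 * s * ∫ q in angles, Real.sin q.1 * |g (τ, r • b 2 + (c * t * s) • sph b q)|
          ≤ t ^ 2 * s * (2 * Real.pi / (r * (c * t * s)) *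
              (M * C1 * ∫ p in Icc A X, Kf (s, p))) := by
            refine mul_le_mul_of_nonneg_left (hsp.trans ?_) (by positivity)
            exact mul_le_mul_of_nonneg_left e2 (by positivity)
        _ = _ := by field_simp
    · have hz : (s, q) ∈ coneBox := ⟨⟨hs.1.le, hs.2⟩, hq⟩
      have h1 := hgM _ (conePt_mem_cone hc ht.le x hb hz)
      simp only [conePt] at h1
      rw [← hτ, hxb] at h1
      refine h1.trans ?_
      set y := r • b 2 + (c * t * s) • sph b q
      have hy := norm_nonneg y
      simp only [hHh, hKf]
      rw [mul_assoc M]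
      refine mul_le_mul_of_nonneg_left ?_ hM
      rw [← mul_assoc]
      refine mul_le_mul ?_ ?_ (Real.rpow_nonneg (zero_le_one.trans (one_le_weight _ _ _)) _)
        (mul_nonneg hC1p.le (jb_rpow_nonneg _ _))
      · refine jb_neg_rpow_le (by linarith) hκ (jb_le_mul_jb (by linarith) ?_)
        rw [abs_of_nonneg (by positivity), abs_of_nonneg (by positivity)]
        nlinarith [mul_nonneg hc.le hy]
      · refine (weight_rpow_le_sum cs τ ‖y‖ _).trans (le_of_eq ?_)
        refine Finset.sum_congr rfl fun j _ => ?_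
        congr 2
        simp only [hcj]; ring
  have hKon : ContinuousOn Kf (Icc (0 : ℝ) 1 ×ˢ Icc A X) := hKc.continuousOn
  calc |retPot c t x b g|
      ≤ ∫ z in coneBox, |Real.sin z.2.1 * (t ^ 2 * z.1 * g (conePt c t x b z))| :=
        abs_integral_le_integral_abs
    _ = ∫ s in (0 : ℝ)..1, ∫ q in angles,
          |Real.sin q.1 * (t ^ 2 * s * g (conePt c t x b (s, q)))| :=
        setIntegral_box_fst zero_le_one isCompact_angles hgc
    _ ≤ ∫ s in (0 : ℝ)..1, 2 * Real.pi * t / (r * c) * (M * C1) * ∫ p in Icc A X, Kf (s, p) := by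
        refine intervalIntegral.integral_mono_on_of_le_Ioo zero_le_one
          (intervalIntegrable_box zero_le_one isCompact_angles hgc)
          ((intervalIntegrable_box zero_le_one isCompact_Icc hKon).const_mul _)
          fun s hs => hslice s (Ioo_subset_Ioc_self hs)
    -- Integrating in time first, at fixed `p`, uses up the weight and leaves only `⟨p⟩^{-κ}`.
    _ = 2 * Real.pi * t / (r * c) * (M * C1) * ∫ p in Icc A X, ∫ s in (0 : ℝ)..1, Kf (s, p) := by
        rw [intervalIntegral.integral_const_mul, ← setIntegral_box_fst zero_le_one isCompact_Icc hKon,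
          setIntegral_box_snd zero_le_one isCompact_Icc hKon]
    _ = 2 * Real.pi / (r * c) * (M * C1) * ∫ p in Icc A X, t * ∫ s in (0 : ℝ)..1, Kf (s, p) := by
        rw [integral_const_mul]; ring
    _ ≤ 2 * Real.pi / (r * c) * (M * C1) * ∫ p in Icc A X, (C2 * min 1 t) * jb p ^ (-κ) := by
        refine mul_le_mul_of_nonneg_left ?_ (by positivity)
        refine setIntegral_mono_on ((integrableOn_box zero_le_one isCompact_Icc hKon).const_mul t)
          (((continuous_jb_rpow _).continuousOn.integrableOn_compact isCompact_Icc).const_mul _)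
          measurableSet_Icc fun p _ => ?_
        simp only [hKf]
        rw [intervalIntegral.integral_const_mul, intervalIntegral.integral_finsetSum]
        · have hj : ∀ j, t * ∫ s in (0 : ℝ)..1, jb ((cj j + c) * (t * (1 - s)) - p) ^ (-(1 + μ))
              ≤ (1 + c⁻¹ * I) * min 1 t := by
            intro j
            have hcjc : 0 < cj j + c := add_pos_of_nonneg_of_pos (hcj0 j) hc
            refine (mul_integral_jb_le hμ hcjc ht p).trans ?_
            have h1 : (cj j + c)⁻¹ ≤ c⁻¹ := inv_anti₀ hc (by linarith [hcj0 j])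
            have h2 : 0 ≤ min 1 t := le_min zero_le_one ht.le
            rw [← hI]
            gcongr
          have hsum := Finset.sum_le_sum fun j (_ : j ∈ (Finset.univ : Finset (Fin (N + 1)))) => hj j
          rw [← Finset.mul_sum] at hsum
          simp only [Finset.sum_const, Finset.card_univ, Fintype.card_fin, nsmul_eq_mul] at hsum
          push_cast at hsum
          rw [← mul_assoc, mul_comm t, mul_assoc, mul_comm (C2 * min 1 t)]
          refine mul_le_mul_of_nonneg_left (hsum.trans (le_of_eq ?_)) (jb_rpow_nonneg _ _)
          rw [hC2]; ring
        · intro j _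
          exact ((continuous_jb_rpow _).comp (by fun_prop)).intervalIntegrable _ _
    _ = 2 * Real.pi / c * C1 * C2 * M * min 1 t * (r⁻¹ * ∫ p in A..X, jb p ^ (-κ)) := by
        rw [integral_const_mul, intervalIntegral.integral_of_le hAX, integral_Icc_eq_integral_Ioc]
        field_simp

/-! ### One-dimensional integrals of brackets -/

theorem one_add_le_two_mul_jb {p : ℝ} (hp : 0 ≤ p) : 1 + p ≤ 2 * jb p := by
  have h1 := one_le_jb p
  have h2 := abs_le_jb p
  rw [abs_of_nonneg hp] at h2
  linarith

theorem jb_le_one_add {p : ℝ} (hp : 0 ≤ p) : jb p ≤ 1 + p := by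
  have := jb_le_one_add_abs p
  rwa [abs_of_nonneg hp] at this

theorem intervalIntegrable_jb_rpow (m a b : ℝ) :
    IntervalIntegrable (fun p => jb p ^ m) volume a b :=
  (continuous_jb_rpow m).intervalIntegrable a b

theorem integral_jb_rpow_le_one_add {b a X : ℝ} (hb : 0 ≤ b) (ha : 0 ≤ a) (haX : a ≤ X) :
    ∫ p in a..X, jb p ^ (-b) ≤ 2 ^ b * ∫ p in (1 + a)..(1 + X), p ^ (-b) := by
  rw [← intervalIntegral.integral_comp_add_left (fun p => p ^ (-b)),
    ← intervalIntegral.integral_const_mul]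
  refine intervalIntegral.integral_mono_on haX (intervalIntegrable_jb_rpow _ _ _) ?_ fun p hp => ?_
  · refine ContinuousOn.intervalIntegrable ?_
    rw [uIcc_of_le haX]
    refine continuousOn_const.mul (ContinuousOn.rpow_const (by fun_prop) fun p hp => Or.inl ?_)
    have := ha.trans hp.1
    positivity
  · have hp0 : 0 ≤ p := ha.trans hp.1
    have h := one_add_le_two_mul_jb hp0
    have h1 : 0 < 1 + p := by linarith
    calc jb p ^ (-b) = 2 ^ b * (2 * jb p) ^ (-b) := by
          rw [Real.mul_rpow two_pos.le (jb_pos p).le, ← mul_assoc, ← Real.rpow_add two_pos]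
          simp
      _ ≤ 2 ^ b * (1 + p) ^ (-b) := by
          refine mul_le_mul_of_nonneg_left ?_ (by positivity)
          exact Real.rpow_le_rpow_of_nonpos h1 h (by linarith)

theorem integral_jb_rpow_tail {k a X : ℝ} (hk : 1 < k) (ha : 0 ≤ a) (haX : a ≤ X) :
    ∫ p in a..X, jb p ^ (-k) ≤ 2 ^ k / (k - 1) * jb a ^ (1 - k) := by
  refine (integral_jb_rpow_le_one_add (by linarith) ha haX).trans ?_
  have h0 : (0 : ℝ) ∉ uIcc (1 + a) (1 + X) := by
    rw [uIcc_of_le (by linarith)]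
    exact fun h => by linarith [h.1]
  rw [integral_rpow (Or.inr ⟨by linarith, h0⟩), div_mul_eq_mul_div, mul_div_assoc]
  refine mul_le_mul_of_nonneg_left ?_ (by positivity)
  have e : -k + 1 = -(k - 1) := by ring
  rw [e, div_neg, ← neg_div, neg_sub]
  refine div_le_div_of_nonneg_right ?_ (by linarith)
  have h1 : 0 ≤ (1 + X) ^ (-(k - 1)) := Real.rpow_nonneg (by linarith) _
  have h2 : (1 + a) ^ (-(k - 1)) ≤ jb a ^ (-(k - 1)) :=
    Real.rpow_le_rpow_of_nonpos (jb_pos a) (jb_le_one_add ha) (by linarith)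
  rw [show 1 - k = -(k - 1) by ring]
  linarith

theorem integral_jb_rpow_growth {b a X : ℝ} (hb : 0 ≤ b) (hb1 : b < 1) (ha : 0 ≤ a) (haX : a ≤ X) :
    ∫ p in a..X, jb p ^ (-b) ≤ 2 / (1 - b) * jb X ^ (1 - b) := by
  refine (integral_jb_rpow_le_one_add hb ha haX).trans ?_
  have hX : 0 ≤ X := ha.trans haX
  rw [integral_rpow (Or.inl (by linarith)), neg_add_eq_sub]
  have h1 : 0 ≤ (1 + a) ^ (1 - b) := Real.rpow_nonneg (by linarith) _
  have h2 : (1 + X) ^ (1 - b) ≤ (2 * jb X) ^ (1 - b) :=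
    Real.rpow_le_rpow (by linarith) (one_add_le_two_mul_jb hX) (by linarith)
  have h3 : 0 < 1 - b := by linarith
  calc 2 ^ b * (((1 + X) ^ (1 - b) - (1 + a) ^ (1 - b)) / (1 - b))
      ≤ 2 ^ b * ((2 * jb X) ^ (1 - b) / (1 - b)) := by
        refine mul_le_mul_of_nonneg_left ?_ (by positivity)
        exact div_le_div_of_nonneg_right (by linarith) h3.le
    _ = (2 ^ b * 2 ^ (1 - b)) / (1 - b) * jb X ^ (1 - b) := by
        rw [Real.mul_rpow two_pos.le (jb_pos X).le]; ring
    _ = 2 / (1 - b) * jb X ^ (1 - b) := by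
        rw [← Real.rpow_add two_pos]; simp

theorem integral_jb_inv_le {a X : ℝ} (ha : 0 ≤ a) (haX : a ≤ X) :
    ∫ p in a..X, jb p ^ (-1 : ℝ) ≤ 2 * Real.log (2 + X) := by
  refine (integral_jb_rpow_le_one_add zero_le_one ha haX).trans ?_
  simp only [Real.rpow_neg_one, Real.rpow_one]
  rw [integral_inv_of_pos (by linarith) (by linarith)]
  refine mul_le_mul_of_nonneg_left (Real.log_le_log (div_pos (by linarith) (by linarith)) ?_)
    two_pos.le
  rw [div_le_iff₀ (by linarith)]
  nlinarith

/-- Radial potential bound in terms of the integral over the characteristic interval. -/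
theorem inv_mul_integral_jb_le {c : ℝ} (hc : 0 < c) {k : ℝ} (hk : 0 ≤ k) :
    ∃ C : ℝ, 0 < C ∧ ∀ t r : ℝ, 0 < t → 0 < r →
      r⁻¹ * ∫ p in |c * t - r|..(c * t + r), jb p ^ (-k)
        ≤ C * (jb (t + r))⁻¹ * (jb (c * t - r) ^ (1 - k)
          + ∫ p in |c * t - r|..(c * t + r), jb p ^ (-k)) := by
  set D : ℝ := 2 + 2 / c with hD
  have hDp : 0 < D := by positivity
  refine ⟨2 * D, by positivity, ?_⟩
  intro t r ht hr
  have hct : 0 < c * t := mul_pos hc ht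
  have haX : |c * t - r| ≤ c * t + r := abs_le.2 ⟨by linarith, by linarith⟩
  set I := ∫ p in |c * t - r|..(c * t + r), jb p ^ (-k) with hI
  have hI0 : 0 ≤ I := intervalIntegral.integral_nonneg haX fun p _ => jb_rpow_nonneg _ _
  have hJ0 : 0 ≤ jb (c * t - r) ^ (1 - k) := jb_rpow_nonneg _ _
  have hjp := jb_pos (t + r)
  -- In the first case `r` is comparable to `⟨t + r⟩`. In the other case `⟨t + r⟩` is at most a
  -- multiple of `⟨ct - r⟩`, the interval has length at most `2r`, and the integrand is largest at
  -- its left end.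
  by_cases hcase : 1 ≤ r ∧ c * t ≤ 2 * r
  · have h1 : jb (t + r) ≤ D * r := by
      have := jb_le_one_add (p := t + r) (by positivity)
      have h2 : t ≤ 2 / c * r := by
        rw [div_mul_eq_mul_div, le_div_iff₀ hc]; linarith
      rw [hD]; nlinarith [hcase.1]
    have h2 : r⁻¹ ≤ D * (jb (t + r))⁻¹ := by
      rw [← div_eq_mul_inv, le_div_iff₀ hjp, inv_mul_le_iff₀ hr, mul_comm]
      exact h1
    calc r⁻¹ * I ≤ D * (jb (t + r))⁻¹ * I := by gcongr
      _ ≤ 2 * D * (jb (t + r))⁻¹ * (jb (c * t - r) ^ (1 - k) + I) := by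
        gcongr
        · linarith
        · linarith
  · have hIle : r⁻¹ * I ≤ 2 * jb (c * t - r) ^ (-k) := by
      have h1 : I ≤ ∫ _p in |c * t - r|..(c * t + r), jb (c * t - r) ^ (-k) := by
        refine intervalIntegral.integral_mono_on haX (intervalIntegrable_jb_rpow _ _ _)
          intervalIntegrable_const fun p hp => ?_
        refine Real.rpow_le_rpow_of_nonpos (jb_pos _) (jb_le_jb (hp.1.trans (le_abs_self p)))
          (by linarith)
      rw [intervalIntegral.integral_const, smul_eq_mul] at h1
      have h2 : c * t + r - |c * t - r| ≤ 2 * r := by linarith [le_abs_self (c * t - r)]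
      rw [inv_mul_le_iff₀ hr]
      nlinarith [jb_rpow_nonneg (c * t - r) (-k)]
    have hjb : jb (t + r) ≤ D * jb (c * t - r) := by
      by_cases h2r : c * t ≤ 2 * r
      · have hr1 : r < 1 := not_le.1 fun h => hcase ⟨h, h2r⟩
        have h1 := jb_le_one_add (p := t + r) (by positivity)
        have h2 : t ≤ 2 / c := by rw [le_div_iff₀ hc]; linarith
        have h3 := one_le_jb (c * t - r)
        nlinarith
      · rw [not_le] at h2r
        refine jb_le_mul_jb (by rw [hD]; linarith [div_pos two_pos hc]) ?_
        rw [abs_of_pos (by positivity), abs_of_pos (by linarith)]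
        have h2 : t = (c * t) / c := by field_simp
        have h3 : D * (c * t - r) = 2 * (c * t - r) + 2 * (c * t - r) / c := by rw [hD]; ring
        have h4 : t ≤ 2 * (c * t - r) / c := by
          rw [le_div_iff₀ hc]; linarith
        linarith
    have h2 : jb (c * t - r) ^ (-k) ≤ D * (jb (t + r))⁻¹ * jb (c * t - r) ^ (1 - k) := by
      have e : jb (c * t - r) ^ (1 - k) = jb (c * t - r) * jb (c * t - r) ^ (-k) := by
        rw [show 1 - k = 1 + -k by ring, Real.rpow_add (jb_pos _), Real.rpow_one]
      rw [e, ← mul_assoc]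
      refine le_mul_of_one_le_left (jb_rpow_nonneg _ _) ?_
      rw [mul_assoc, mul_comm (jb (t + r))⁻¹, ← mul_assoc, ← div_eq_mul_inv, le_div_iff₀ hjp, one_mul]
      exact hjb
    calc r⁻¹ * I ≤ 2 * (D * (jb (t + r))⁻¹ * jb (c * t - r) ^ (1 - k)) := hIle.trans (by linarith)
      _ = 2 * D * (jb (t + r))⁻¹ * jb (c * t - r) ^ (1 - k) := by ring
      _ ≤ _ := by gcongr; linarith

theorem jb_abs (a : ℝ) : jb |a| = jb a := by simp [jb]

theorem radial_bound_of_one_lt {c : ℝ} (hc : 0 < c) {k : ℝ} (hk : 1 < k) :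
    ∃ C : ℝ, 0 < C ∧ ∀ t r : ℝ, 0 < t → 0 < r →
      r⁻¹ * ∫ p in |c * t - r|..(c * t + r), jb p ^ (-k)
        ≤ C * ((jb (t + r))⁻¹ * jb (c * t - r) ^ (1 - k)) := by
  obtain ⟨C, hC, h⟩ := inv_mul_integral_jb_le hc (k := k) (by linarith)
  have hq : 0 < 2 ^ k / (k - 1) := div_pos (by positivity) (by linarith)
  refine ⟨C * (1 + 2 ^ k / (k - 1)), by positivity, fun t r ht hr => (h t r ht hr).trans ?_⟩
  have hct : 0 < c * t := mul_pos hc ht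
  have h1 := integral_jb_rpow_tail hk (abs_nonneg (c * t - r))
    (abs_le.2 ⟨by linarith, by linarith⟩ : |c * t - r| ≤ c * t + r)
  rw [jb_abs] at h1
  have hjp := inv_pos.2 (jb_pos (t + r))
  calc C * (jb (t + r))⁻¹ * (jb (c * t - r) ^ (1 - k)
          + ∫ p in |c * t - r|..(c * t + r), jb p ^ (-k))
      ≤ C * (jb (t + r))⁻¹ * (jb (c * t - r) ^ (1 - k)
          + 2 ^ k / (k - 1) * jb (c * t - r) ^ (1 - k)) := by gcongr
    _ = _ := by ring

theorem log_two_add_le {m a b : ℝ} (hm : 1 ≤ m) (hb : 0 ≤ b) (ha : 0 ≤ a) (h : a ≤ m * b) :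
    Real.log (2 + a) ≤ (1 + Real.log m / Real.log 2) * Real.log (2 + b) := by
  have h2 : 0 < Real.log 2 := Real.log_pos one_lt_two
  have h3 : Real.log 2 ≤ Real.log (2 + b) := Real.log_le_log two_pos (by linarith)
  have h4 : Real.log (2 + a) ≤ Real.log (m * (2 + b)) :=
    Real.log_le_log (by linarith) (by nlinarith)
  rw [Real.log_mul (by linarith) (by linarith)] at h4
  have h5 : Real.log m ≤ Real.log m / Real.log 2 * Real.log (2 + b) := by
    rw [div_mul_eq_mul_div, le_div_iff₀ h2]
    exact mul_le_mul_of_nonneg_left h3 (Real.log_nonneg hm)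
  linarith

theorem log_two_le_log {a : ℝ} (ha : 0 ≤ a) : Real.log 2 ≤ Real.log (2 + a) :=
  Real.log_le_log two_pos (by linarith)

theorem radial_bound_log {c : ℝ} (hc : 0 < c) :
    ∃ C : ℝ, 0 < C ∧ ∀ t r : ℝ, 0 < t → 0 < r →
      r⁻¹ * ∫ p in |c * t - r|..(c * t + r), jb p ^ (-1 : ℝ)
        ≤ C * Real.log (2 + (t + r)) * (jb (t + r))⁻¹ := by
  obtain ⟨C, hC, h⟩ := inv_mul_integral_jb_le hc (k := 1) zero_le_one
  have h2 : 0 < Real.log 2 := Real.log_pos one_lt_two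
  set m : ℝ := 1 + Real.log (1 + c) / Real.log 2 with hm
  have hmp : 0 ≤ m := add_nonneg zero_le_one (div_nonneg (Real.log_nonneg (by linarith)) h2.le)
  refine ⟨C * ((Real.log 2)⁻¹ + 2 * m), by positivity, fun t r ht hr => (h t r ht hr).trans ?_⟩
  have hct : 0 < c * t := mul_pos hc ht
  have h1 := integral_jb_inv_le (abs_nonneg (c * t - r))
    (abs_le.2 ⟨by linarith, by linarith⟩ : |c * t - r| ≤ c * t + r)
  have h3 := log_two_add_le (m := 1 + c) (a := c * t + r) (b := t + r) (by linarith) (by linarith)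
    (by linarith) (by nlinarith)
  have h4 := log_two_le_log (a := t + r) (by linarith)
  have h5 : 1 ≤ (Real.log 2)⁻¹ * Real.log (2 + (t + r)) := by
    rw [inv_mul_eq_div, le_div_iff₀ h2]; linarith
  have hjp := inv_pos.2 (jb_pos (t + r))
  simp only [sub_self, Real.rpow_zero]
  calc C * (jb (t + r))⁻¹ * (1 + ∫ p in |c * t - r|..(c * t + r), jb p ^ (-1 : ℝ))
      ≤ C * (jb (t + r))⁻¹ * ((Real.log 2)⁻¹ * Real.log (2 + (t + r))
          + 2 * (m * Real.log (2 + (t + r)))) := by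
        refine mul_le_mul_of_nonneg_left (add_le_add h5 (h1.trans ?_)) (by positivity)
        exact mul_le_mul_of_nonneg_left h3 two_pos.le
    _ = _ := by ring

/-- A bound without logarithm for `κ = 1`, for use under the characteristic integral. It follows
from `⟨p⟩⁻¹ ≤ ⟨a⟩^{-1/2} ⟨p⟩^{-1/2}` on the interval with left end `a`, whose second factor has an
integral of order `⟨X⟩^{1/2}`. -/
theorem radial_bound_half {c : ℝ} (hc : 0 < c) :
    ∃ C : ℝ, 0 < C ∧ ∀ t r : ℝ, 0 < t → 0 < r →
      r⁻¹ * ∫ p in |c * t - r|..(c * t + r), jb p ^ (-1 : ℝ)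
        ≤ C * (jb (t + r) ^ (-(1 / 2) : ℝ) * jb (c * t - r) ^ (-(1 / 2) : ℝ)) := by
  obtain ⟨C, hC, h⟩ := inv_mul_integral_jb_le hc (k := 1) zero_le_one
  refine ⟨C * (1 + c + 4 * (1 + c)), by positivity, fun t r ht hr => (h t r ht hr).trans ?_⟩
  have hct : 0 < c * t := mul_pos hc ht
  set a := |c * t - r| with ha
  set X := c * t + r with hX
  have haX : a ≤ X := abs_le.2 ⟨by linarith, by linarith⟩
  have hXj : jb X ≤ (1 + c) * jb (t + r) := by
    refine jb_le_mul_jb (by linarith) ?_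
    rw [abs_of_pos (by linarith), abs_of_pos (by linarith)]
    nlinarith
  have haj : jb (c * t - r) = jb a := (jb_abs _).symm
  have haXj : jb a ≤ jb X := jb_le_jb (by
    rw [abs_of_nonneg (abs_nonneg (c * t - r))]; exact haX.trans (le_abs_self X))
  have hsq : ∀ y : ℝ, jb y ^ (1 / 2 : ℝ) * jb y ^ (1 / 2 : ℝ) = jb y := fun y => by
    rw [← Real.rpow_add (jb_pos y)]; norm_num
  have hXh : jb X ^ (1 / 2 : ℝ) ≤ (1 + c) * jb (t + r) ^ (1 / 2 : ℝ) := by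
    calc jb X ^ (1 / 2 : ℝ) ≤ ((1 + c) * jb (t + r)) ^ (1 / 2 : ℝ) :=
          Real.rpow_le_rpow (jb_pos X).le hXj (by norm_num)
      _ = (1 + c) ^ (1 / 2 : ℝ) * jb (t + r) ^ (1 / 2 : ℝ) :=
          Real.mul_rpow (by linarith) (jb_pos _).le
      _ ≤ (1 + c) * jb (t + r) ^ (1 / 2 : ℝ) := by
          refine mul_le_mul_of_nonneg_right ?_ (jb_rpow_nonneg _ _)
          exact Real.rpow_le_self_of_one_le (by linarith) (by norm_num)
  have hint : ∫ p in a..X, jb p ^ (-1 : ℝ) ≤ 4 * (jb a ^ (-(1 / 2) : ℝ) * jb X ^ (1 / 2 : ℝ)) := by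
    have h1 : ∫ p in a..X, jb p ^ (-1 : ℝ)
        ≤ ∫ p in a..X, jb a ^ (-(1 / 2) : ℝ) * jb p ^ (-(1 / 2) : ℝ) := by
      refine intervalIntegral.integral_mono_on haX (intervalIntegrable_jb_rpow _ _ _)
        ((intervalIntegrable_jb_rpow _ _ _).const_mul _) fun p hp => ?_
      have e : jb p ^ (-1 : ℝ) = jb p ^ (-(1 / 2) : ℝ) * jb p ^ (-(1 / 2) : ℝ) := by
        rw [← Real.rpow_add (jb_pos p)]; norm_num
      rw [e]
      refine mul_le_mul_of_nonneg_right ?_ (jb_rpow_nonneg _ _)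
      refine Real.rpow_le_rpow_of_nonpos (jb_pos a) (jb_le_jb ?_) (by norm_num)
      rw [abs_of_nonneg (abs_nonneg (c * t - r))]
      exact hp.1.trans (le_abs_self p)
    rw [intervalIntegral.integral_const_mul] at h1
    have h2 := integral_jb_rpow_growth (b := 1 / 2) (by norm_num) (by norm_num)
      (abs_nonneg (c * t - r)) haX
    calc _ ≤ _ := h1
      _ ≤ jb a ^ (-(1 / 2) : ℝ) * (2 / (1 - 1 / 2) * jb X ^ (1 - 1 / 2 : ℝ)) :=
          mul_le_mul_of_nonneg_left h2 (jb_rpow_nonneg _ _)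
      _ = _ := by norm_num; ring
  have hone : (1 : ℝ) ≤ jb a ^ (-(1 / 2) : ℝ) * jb X ^ (1 / 2 : ℝ) := by
    rw [Real.rpow_neg (jb_pos a).le, inv_mul_eq_div, le_div_iff₀ (Real.rpow_pos_of_pos (jb_pos a) _),
      one_mul]
    exact Real.rpow_le_rpow (jb_pos a).le haXj (by norm_num)
  have hinv : (jb (t + r))⁻¹ * jb (t + r) ^ (1 / 2 : ℝ) = jb (t + r) ^ (-(1 / 2) : ℝ) := by
    rw [← Real.rpow_neg_one, ← Real.rpow_add (jb_pos _)]; norm_num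
  have hP := jb_rpow_nonneg a (-(1 / 2))
  have hjp := inv_pos.2 (jb_pos (t + r))
  simp only [sub_self, Real.rpow_zero]
  calc C * (jb (t + r))⁻¹ * (1 + ∫ p in a..X, jb p ^ (-1 : ℝ))
      ≤ C * (jb (t + r))⁻¹ * (5 * (jb a ^ (-(1 / 2) : ℝ) * jb X ^ (1 / 2 : ℝ))) := by
        refine mul_le_mul_of_nonneg_left ?_ (by positivity)
        linarith
    _ ≤ C * (jb (t + r))⁻¹ * (5 * (jb a ^ (-(1 / 2) : ℝ) * ((1 + c) * jb (t + r) ^ (1 / 2 : ℝ)))) := by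
        gcongr
    _ = C * (1 + c + 4 * (1 + c)) * (((jb (t + r))⁻¹ * jb (t + r) ^ (1 / 2 : ℝ))
          * jb a ^ (-(1 / 2) : ℝ)) := by ring
    _ = _ := by rw [hinv, haj]

/-! ### Integrals along characteristics -/

/-- For `4s ≤ X` the bracket is comparable to `⟨X⟩` and `s⁻¹` integrates to a logarithm; for `4s >
X` it is `s⁻¹` that is at most `8⟨X⟩⁻¹`. Each of the two sources of a logarithm is kept as a
separate term. -/
theorem char_integral_le {β : ℝ} (hβ : 0 ≤ β) :
    ∃ C : ℝ, 0 < C ∧ ∀ r X : ℝ, 1 ≤ r → r ≤ X →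
      ∫ s in r..X, s⁻¹ * jb (X - 2 * s) ^ (-β)
        ≤ C * (jb X ^ (-β) * Real.log (X / r) + (jb X)⁻¹ * ∫ p in (0 : ℝ)..X, jb p ^ (-β)) := by
  refine ⟨2 ^ β + 8, by positivity, fun r X hr hrX => ?_⟩
  have hr0 : 0 < r := by linarith
  have hX0 : 0 < X := by linarith
  have c1 : ContinuousOn (fun s : ℝ => s⁻¹) (uIcc r X) := by
    rw [uIcc_of_le hrX]
    exact continuousOn_inv₀.mono fun s hs => (hr0.trans_le hs.1).ne'
  have c2 : Continuous fun s : ℝ => jb (X - 2 * s) ^ (-β) :=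
    (continuous_jb_rpow _).comp (by fun_prop)
  have hpt : ∀ s ∈ Icc r X, s⁻¹ * jb (X - 2 * s) ^ (-β)
      ≤ 2 ^ β * jb X ^ (-β) * s⁻¹ + 8 * (jb X)⁻¹ * jb (X - 2 * s) ^ (-β) := by
    intro s hs
    have hs0 : 0 < s := hr0.trans_le hs.1
    have p1 : 0 ≤ s⁻¹ := by positivity
    have p2 := jb_rpow_nonneg X (-β)
    have p3 := jb_rpow_nonneg (X - 2 * s) (-β)
    have p4 : 0 ≤ (jb X)⁻¹ := (inv_pos.2 (jb_pos X)).le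
    by_cases h : 4 * s ≤ X
    · have h1 : jb (X - 2 * s) ^ (-β) ≤ 2 ^ β * jb X ^ (-β) := by
        refine jb_neg_rpow_le two_pos hβ (jb_le_mul_jb one_le_two ?_)
        rw [abs_of_pos hX0, abs_of_pos (by linarith)]
        linarith
      have := mul_le_mul_of_nonneg_left h1 p1
      have h3 : 0 ≤ 8 * (jb X)⁻¹ * jb (X - 2 * s) ^ (-β) := by positivity
      nlinarith
    · rw [not_le] at h
      have h1 : s⁻¹ ≤ 8 * (jb X)⁻¹ := by
        rw [← div_eq_mul_inv, le_div_iff₀ (jb_pos X), inv_mul_le_iff₀ hs0]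
        have := jb_le_one_add hX0.le
        linarith [hs.1, hs.2]
      have := mul_le_mul_of_nonneg_right h1 p3
      have h3 : 0 ≤ 2 ^ β * jb X ^ (-β) * s⁻¹ := by positivity
      linarith
  have hI : ∫ s in r..X, jb (X - 2 * s) ^ (-β) ≤ ∫ p in (0 : ℝ)..X, jb p ^ (-β) := by
    rw [intervalIntegral.integral_comp_sub_mul (fun p => jb p ^ (-β)) two_ne_zero]
    have h1 : ∫ p in X - 2 * X..X - 2 * r, jb p ^ (-β) ≤ ∫ p in -X..X, jb p ^ (-β) := by
      refine intervalIntegral.integral_mono_interval (by linarith) (by linarith) (by linarith)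
        (Eventually.of_forall fun p => jb_rpow_nonneg _ _) (intervalIntegrable_jb_rpow _ _ _)
    have h2 : ∫ p in -X..X, jb p ^ (-β) = 2 * ∫ p in (0 : ℝ)..X, jb p ^ (-β) := by
      rw [← intervalIntegral.integral_add_adjacent_intervals (intervalIntegrable_jb_rpow _ (-X) 0)
        (intervalIntegrable_jb_rpow _ 0 X)]
      have := intervalIntegral.integral_comp_neg (fun p => jb p ^ (-β)) (a := 0) (b := X)
      have e : ∀ p, jb (-p) = jb p := fun p => by simp [jb]
      simp only [e, neg_zero] at this
      rw [← this]; ring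
    rw [smul_eq_mul]
    linarith
  calc ∫ s in r..X, s⁻¹ * jb (X - 2 * s) ^ (-β)
      ≤ ∫ s in r..X, (2 ^ β * jb X ^ (-β) * s⁻¹ + 8 * (jb X)⁻¹ * jb (X - 2 * s) ^ (-β)) :=
        intervalIntegral.integral_mono_on hrX (c1.mul c2.continuousOn).intervalIntegrable
          ((continuousOn_const.mul c1).intervalIntegrable.add
            (continuous_const.mul c2).continuousOn.intervalIntegrable) hpt
    _ = 2 ^ β * jb X ^ (-β) * Real.log (X / r)
          + 8 * (jb X)⁻¹ * ∫ s in r..X, jb (X - 2 * s) ^ (-β) := by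
        rw [intervalIntegral.integral_add (c1.intervalIntegrable.const_mul _)
            ((c2.intervalIntegrable r X).const_mul _),
          intervalIntegral.integral_const_mul, intervalIntegral.integral_const_mul,
          integral_inv_of_pos hr0 hX0]
    _ ≤ (2 ^ β + 8) * (jb X ^ (-β) * Real.log (X / r)
          + (jb X)⁻¹ * ∫ p in (0 : ℝ)..X, jb p ^ (-β)) := by
        have q1 : 0 ≤ jb X ^ (-β) * Real.log (X / r) :=
          mul_nonneg (jb_rpow_nonneg _ _) (Real.log_nonneg ((one_le_div hr0).2 hrX))
        have q2 : 0 ≤ (jb X)⁻¹ * ∫ p in (0 : ℝ)..X, jb p ^ (-β) :=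
          mul_nonneg (inv_pos.2 (jb_pos X)).le (intervalIntegral.integral_nonneg hX0.le
            fun p _ => jb_rpow_nonneg _ _)
        have q3 := mul_le_mul_of_nonneg_left hI (inv_pos.2 (jb_pos X)).le
        have q4 : (0 : ℝ) < 2 ^ β := by positivity
        nlinarith

theorem inv_mul_rpow_sub (X m : ℝ) : (jb X)⁻¹ * jb X ^ m = jb X ^ (m - 1) := by
  rw [← Real.rpow_neg_one, ← Real.rpow_add (jb_pos X)]; congr 1; ring

/-- A growing power is pulled out at the right end. It is applied so that the remaining exponent is
`-1` or `-(1 + μ)`, which covers `κ = 2` together with `κ < 2`. -/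
theorem integral_jb_rpow_le_mul {a b X : ℝ} (hab : a ≤ b) (hX : 0 ≤ X) :
    ∫ p in (0 : ℝ)..X, jb p ^ a ≤ jb X ^ (b - a) * ∫ p in (0 : ℝ)..X, jb p ^ (a - (b - a)) := by
  rw [← intervalIntegral.integral_const_mul]
  refine intervalIntegral.integral_mono_on hX (intervalIntegrable_jb_rpow _ _ _)
    ((intervalIntegrable_jb_rpow _ _ _).const_mul _) fun p hp => ?_
  have e : jb p ^ a = jb p ^ (b - a) * jb p ^ (a - (b - a)) := by
    rw [← Real.rpow_add (jb_pos p)]; congr 1; ring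
  rw [e]
  refine mul_le_mul_of_nonneg_right (Real.rpow_le_rpow (jb_pos p).le (jb_le_jb ?_) (by linarith))
    (jb_rpow_nonneg _ _)
  rw [abs_of_nonneg hp.1, abs_of_nonneg hX]
  exact hp.2

theorem log_div_le_log_two_add {r X : ℝ} (hr : 1 ≤ r) (hrX : r ≤ X) :
    Real.log (X / r) ≤ Real.log (2 + X) := by
  have hr0 : 0 < r := by linarith
  refine Real.log_le_log (div_pos (by linarith) hr0) ?_
  rw [div_le_iff₀ hr0]; nlinarith

theorem char_integral_log {κ : ℝ} (hκ1 : 1 < κ) (hκ2 : κ ≤ 2) :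
    ∃ C : ℝ, 0 < C ∧ ∀ r X : ℝ, 1 ≤ r → r ≤ X →
      ∫ s in r..X, s⁻¹ * jb (X - 2 * s) ^ (-(κ - 1)) ≤ C * Real.log (2 + X) * jb X ^ (1 - κ) := by
  obtain ⟨C, hC, h⟩ := char_integral_le (β := κ - 1) (by linarith)
  refine ⟨C * 3, by positivity, fun r X hr hrX => (h r X hr hrX).trans ?_⟩
  have hX0 : 0 ≤ X := by linarith
  have h1 := integral_jb_rpow_le_mul (a := -(κ - 1)) (b := -(κ - 1) + (2 - κ)) (by linarith) hX0
  rw [show -(κ - 1) + (2 - κ) - -(κ - 1) = 2 - κ by ring,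
    show -(κ - 1) - (2 - κ) = (-1 : ℝ) by ring] at h1
  have h2 := integral_jb_inv_le le_rfl hX0
  have h3 := log_div_le_log_two_add hr hrX
  have h4 : (jb X)⁻¹ * ∫ p in (0 : ℝ)..X, jb p ^ (-(κ - 1))
      ≤ jb X ^ (1 - κ) * (2 * Real.log (2 + X)) := by
    calc _ ≤ (jb X)⁻¹ * (jb X ^ (2 - κ) * (2 * Real.log (2 + X))) := by
          refine mul_le_mul_of_nonneg_left (h1.trans ?_) (inv_pos.2 (jb_pos X)).le
          exact mul_le_mul_of_nonneg_left h2 (jb_rpow_nonneg _ _)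
      _ = _ := by
          rw [← mul_assoc, inv_mul_rpow_sub]; congr 2; ring
  rw [show -(κ - 1) = 1 - κ by ring] at h4 ⊢
  have h5 := mul_le_mul_of_nonneg_left h3 (jb_rpow_nonneg X (1 - κ))
  nlinarith

theorem char_integral_half :
    ∃ C : ℝ, 0 < C ∧ ∀ r X : ℝ, 1 ≤ r → r ≤ X →
      ∫ s in r..X, s⁻¹ * jb (X - 2 * s) ^ (-(1 / 2) : ℝ)
        ≤ C * Real.log (2 + X) * jb X ^ (-(1 / 2) : ℝ) := by
  obtain ⟨C, hC, h⟩ := char_integral_le (β := 1 / 2) (by norm_num)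
  have hl2 : 0 < Real.log 2 := Real.log_pos one_lt_two
  refine ⟨C * (1 + 4 * (Real.log 2)⁻¹), by positivity, fun r X hr hrX => (h r X hr hrX).trans ?_⟩
  have hX0 : 0 ≤ X := by linarith
  have h1 := integral_jb_rpow_growth (b := 1 / 2) (by norm_num) (by norm_num) le_rfl hX0
  have h3 := log_div_le_log_two_add hr hrX
  have hP := jb_rpow_nonneg X (-(1 / 2))
  have h4 : (jb X)⁻¹ * ∫ p in (0 : ℝ)..X, jb p ^ (-(1 / 2) : ℝ) ≤ 4 * jb X ^ (-(1 / 2) : ℝ) := by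
    calc _ ≤ (jb X)⁻¹ * (2 / (1 - 1 / 2) * jb X ^ (1 - 1 / 2 : ℝ)) :=
          mul_le_mul_of_nonneg_left h1 (inv_pos.2 (jb_pos X)).le
      _ = 4 * ((jb X)⁻¹ * jb X ^ (1 - 1 / 2 : ℝ)) := by norm_num; ring
      _ = _ := by rw [inv_mul_rpow_sub]; norm_num
  have h5 := mul_le_mul_of_nonneg_left h3 hP
  have h6 : 1 ≤ (Real.log 2)⁻¹ * Real.log (2 + X) := by
    rw [inv_mul_eq_div, le_div_iff₀ hl2]; linarith [log_two_le_log hX0]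
  calc C * (jb X ^ (-(1 / 2) : ℝ) * Real.log (X / r)
        + (jb X)⁻¹ * ∫ p in (0 : ℝ)..X, jb p ^ (-(1 / 2) : ℝ))
      ≤ C * (jb X ^ (-(1 / 2) : ℝ) * Real.log (2 + X)
        + 4 * jb X ^ (-(1 / 2) : ℝ) * ((Real.log 2)⁻¹ * Real.log (2 + X))) := by
        refine mul_le_mul_of_nonneg_left (add_le_add h5 (h4.trans ?_)) hC.le
        exact le_mul_of_one_le_right (by positivity) h6
    _ = _ := by ring

/-- No logarithm remains: `X / r` is bounded, and the exponent `κ - 1` is below `1`, so the integral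
of the bracket grows like a pure power. -/
theorem char_integral_far {κ : ℝ} (hκ1 : 1 < κ) (hκ2 : κ < 2) {m : ℝ} (hm : 1 ≤ m) :
    ∃ C : ℝ, 0 < C ∧ ∀ r X : ℝ, 1 ≤ r → r ≤ X → X ≤ m * r →
      ∫ s in r..X, s⁻¹ * jb (X - 2 * s) ^ (-(κ - 1)) ≤ C * jb X ^ (1 - κ) := by
  obtain ⟨C, hC, h⟩ := char_integral_le (β := κ - 1) (by linarith)
  have hlm := Real.log_nonneg hm
  have h2k : 0 < 1 - (κ - 1) := by linarith
  refine ⟨C * (Real.log m + 2 / (1 - (κ - 1))), mul_pos hC (add_pos_of_nonneg_of_pos hlm (div_pos two_pos h2k)), fun r X hr hrX hXm => (h r X hr hrX).trans ?_⟩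
  have hX0 : 0 ≤ X := by linarith
  have hr0 : 0 < r := by linarith
  have h1 := integral_jb_rpow_growth (b := κ - 1) (by linarith) (by linarith) le_rfl hX0
  have h3 : Real.log (X / r) ≤ Real.log m :=
    Real.log_le_log (div_pos (by linarith) hr0) (by rwa [div_le_iff₀ hr0])
  have h4 : (jb X)⁻¹ * ∫ p in (0 : ℝ)..X, jb p ^ (-(κ - 1))
      ≤ 2 / (1 - (κ - 1)) * jb X ^ (1 - κ) := by
    calc _ ≤ (jb X)⁻¹ * (2 / (1 - (κ - 1)) * jb X ^ (1 - (κ - 1))) :=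
          mul_le_mul_of_nonneg_left h1 (inv_pos.2 (jb_pos X)).le
      _ = 2 / (1 - (κ - 1)) * ((jb X)⁻¹ * jb X ^ (1 - (κ - 1))) := by ring
      _ = _ := by rw [inv_mul_rpow_sub]; congr 2; ring
  have h5 := mul_le_mul_of_nonneg_left h3 (jb_rpow_nonneg X (1 - κ))
  rw [show -(κ - 1) = 1 - κ by ring] at h4 ⊢
  calc _ ≤ C * (jb X ^ (1 - κ) * Real.log m + 2 / (1 - (κ - 1)) * jb X ^ (1 - κ)) :=
        mul_le_mul_of_nonneg_left (add_le_add h5 h4) hC.le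
    _ = _ := by ring

/-- The spare `μ` in the exponent absorbs `log (X / r)`, which is at most `⟨X⟩^μ / μ`, and makes the
remaining bracket integral converge. -/
theorem char_integral_fast {κ μ : ℝ} (hκ1 : 1 ≤ κ) (hκ2 : κ ≤ 2) (hμ : 0 < μ) :
    ∃ C : ℝ, 0 < C ∧ ∀ r X : ℝ, 1 ≤ r → r ≤ X →
      ∫ s in r..X, s⁻¹ * jb (X - 2 * s) ^ (-(κ + μ - 1)) ≤ C * jb X ^ (1 - κ) := by
  obtain ⟨C, hC, h⟩ := char_integral_le (β := κ + μ - 1) (by linarith)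
  have hq : 0 < 2 ^ (1 + μ) / (1 + μ - 1) := div_pos (by positivity) (by linarith)
  refine ⟨C * (2 / μ + 2 ^ (1 + μ) / (1 + μ - 1)), by positivity, fun r X hr hrX =>
    (h r X hr hrX).trans ?_⟩
  have hX0 : 0 ≤ X := by linarith
  have hr0 : 0 < r := by linarith
  have h1 := integral_jb_rpow_le_mul (a := -(κ + μ - 1)) (b := -(κ + μ - 1) + (2 - κ))
    (by linarith) hX0
  rw [show -(κ + μ - 1) + (2 - κ) - -(κ + μ - 1) = 2 - κ by ring,
    show -(κ + μ - 1) - (2 - κ) = -(1 + μ) by ring] at h1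
  have h2 := integral_jb_rpow_tail (k := 1 + μ) (by linarith) le_rfl hX0
  have h2' : ∫ p in (0 : ℝ)..X, jb p ^ (-(1 + μ)) ≤ 2 ^ (1 + μ) / (1 + μ - 1) := by
    refine h2.trans (mul_le_of_le_one_right hq.le (jb_rpow_le_one _ (by linarith)))
  have h3 : Real.log (X / r) ≤ 2 / μ * jb X ^ μ := by
    have hXr : X / r ≤ jb X := by
      rw [div_le_iff₀ hr0]
      have := abs_le_jb X
      rw [abs_of_nonneg hX0] at this
      nlinarith [jb_pos X]
    calc Real.log (X / r) ≤ Real.log (jb X) := Real.log_le_log (div_pos (by linarith) hr0) hXr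
      _ ≤ jb X ^ μ / μ := Real.log_le_rpow_div (jb_pos X).le hμ
      _ ≤ 2 / μ * jb X ^ μ := by
        rw [div_mul_eq_mul_div]
        exact div_le_div_of_nonneg_right (by linarith [jb_rpow_nonneg X μ]) hμ.le
  have h4 : (jb X)⁻¹ * ∫ p in (0 : ℝ)..X, jb p ^ (-(κ + μ - 1))
      ≤ jb X ^ (1 - κ) * (2 ^ (1 + μ) / (1 + μ - 1)) := by
    calc _ ≤ (jb X)⁻¹ * (jb X ^ (2 - κ) * (2 ^ (1 + μ) / (1 + μ - 1))) := by
          refine mul_le_mul_of_nonneg_left (h1.trans ?_) (inv_pos.2 (jb_pos X)).le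
          exact mul_le_mul_of_nonneg_left h2' (jb_rpow_nonneg _ _)
      _ = _ := by
          rw [← mul_assoc, inv_mul_rpow_sub]; congr 2; ring
  have h5 : jb X ^ (-(κ + μ - 1)) * Real.log (X / r) ≤ 2 / μ * jb X ^ (1 - κ) := by
    calc _ ≤ jb X ^ (-(κ + μ - 1)) * (2 / μ * jb X ^ μ) :=
          mul_le_mul_of_nonneg_left h3 (jb_rpow_nonneg _ _)
      _ = 2 / μ * (jb X ^ (-(κ + μ - 1)) * jb X ^ μ) := by ring
      _ = _ := by rw [← Real.rpow_add (jb_pos X)]; congr 2; ring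
  calc _ ≤ C * (2 / μ * jb X ^ (1 - κ) + jb X ^ (1 - κ) * (2 ^ (1 + μ) / (1 + μ - 1))) :=
        mul_le_mul_of_nonneg_left (add_le_add h5 h4) hC.le
    _ = _ := by ring

/-! ### The weighted norm of the source -/

theorem continuous_weight {N : ℕ} (cs : Fin N → ℝ) :
    Continuous fun q : ℝ × ℝ => weight cs q.1 q.2 := by
  unfold weight
  refine Continuous.finset_inf'_apply _ fun j _ => continuous_jb.comp ?_
  fun_prop

/-- Without boundedness the supremum would have the default value `0` and would control nothing. The
cone lies in a compact product on which the function is continuous. -/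
theorem bddAbove_normA {N : ℕ} (cs : Fin N → ℝ) (ρ μ : ℝ) {s : ℕ} {G : ℝ × E3 → ℝ}
    (hG : ContDiffOn ℝ ∞ G halfSpace) {c t : ℝ} (hc : 0 < c) (x : E3) :
    BddAbove ((fun q : ℝ × E3 => ‖q.2‖ * jb (q.1 + ‖q.2‖) ^ ρ * weight cs q.1 ‖q.2‖ ^ (1 + μ)
      * zNorm s G q) '' cone c t x) := by
  have hsub : cone c t x ⊆ Icc 0 t ×ˢ Metric.closedBall x (c * t) := by
    rintro ⟨τ, y⟩ ⟨h1, h2, h3⟩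
    refine ⟨⟨h1, h2⟩, mem_closedBall_iff_norm.2 (h3.trans ?_)⟩
    exact mul_le_mul_of_nonneg_left (by simpa using h1) hc.le
  refine BddAbove.mono (image_mono hsub)
    ((isCompact_Icc.prod (isCompact_closedBall x (c * t))).bddAbove_image ?_)
  have h1 : Continuous fun q : ℝ × E3 => jb (q.1 + ‖q.2‖) ^ ρ :=
    (continuous_jb_rpow ρ).comp (by fun_prop)
  have h2 : Continuous fun q : ℝ × E3 => weight cs q.1 ‖q.2‖ ^ (1 + μ) :=
    ((continuous_weight cs).comp (by fun_prop : Continuous fun q : ℝ × E3 => (q.1, ‖q.2‖))).rpow_const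
      fun q => Or.inl (zero_lt_one.trans_le (one_le_weight _ _ _)).ne'
  exact (((continuous_snd.norm.mul h1).mul h2).continuousOn.mul
    ((continuousOn_zNorm hG s).mono fun q hq => mem_halfSpace.2 hq.1.1))

theorem mul_zNorm_le_normA {N : ℕ} (cs : Fin N → ℝ) (κ μ : ℝ) {s : ℕ} {G : ℝ × E3 → ℝ}
    (hG : ContDiffOn ℝ ∞ G halfSpace) {c t : ℝ} (hc : 0 < c) {x : E3} {p : ℝ × E3}
    (hp : p ∈ cone c t x) :
    ‖p.2‖ * zNorm s G p ≤ normA cs κ μ s G c t x *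
      (jb (p.1 + ‖p.2‖) ^ (-κ) * weight cs p.1 ‖p.2‖ ^ (-(1 + μ))) := by
  have h := le_csSup (bddAbove_normA cs κ μ (s := s) hG hc x) (mem_image_of_mem _ hp)
  have hw := zero_lt_one.trans_le (one_le_weight cs p.1 ‖p.2‖)
  have h1 := Real.rpow_pos_of_pos (jb_pos (p.1 + ‖p.2‖)) κ
  have h2 := Real.rpow_pos_of_pos hw (1 + μ)
  rw [Real.rpow_neg (jb_pos _).le, Real.rpow_neg hw.le, ← mul_inv, ← div_eq_mul_inv,
    le_div_iff₀ (mul_pos h1 h2)]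
  calc ‖p.2‖ * zNorm s G p * (jb (p.1 + ‖p.2‖) ^ κ * weight cs p.1 ‖p.2‖ ^ (1 + μ))
      = ‖p.2‖ * jb (p.1 + ‖p.2‖) ^ κ * weight cs p.1 ‖p.2‖ ^ (1 + μ) * zNorm s G p := by ring
    _ ≤ _ := h

theorem normA_nonneg {N : ℕ} (cs : Fin N → ℝ) (κ μ : ℝ) (s : ℕ) (G : ℝ × E3 → ℝ) (c t : ℝ)
    (x : E3) : 0 ≤ normA cs κ μ s G c t x := by
  refine Real.sSup_nonneg ?_
  rintro _ ⟨q, -, rfl⟩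
  have hw := zero_lt_one.trans_le (one_le_weight cs q.1 ‖q.2‖)
  exact mul_nonneg (mul_nonneg (mul_nonneg (norm_nonneg _) (jb_rpow_nonneg _ _))
    (Real.rpow_nonneg hw.le _)) (zNorm_nonneg _ _ _)

/-- With the third vector along `x` the polar angle is measured from `x`, as the hat-box theorem
requires. -/
theorem exists_frame {x : E3} (hx : x ≠ 0) :
    ∃ b : Fin 3 → E3, Orthonormal ℝ b ∧ b 2 = ‖x‖⁻¹ • x := by
  have hn : ‖‖x‖⁻¹ • x‖ = 1 := by
    rw [norm_smul, norm_inv, norm_norm, inv_mul_cancel₀ (norm_ne_zero_iff.2 hx)]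
  obtain ⟨b, hb⟩ := Orthonormal.exists_orthonormalBasis_extension_of_card_eq (𝕜 := ℝ) (E := E3)
    (ι := Fin 3) (by simp) (v := fun _ => ‖x‖⁻¹ • x) (s := {2}) (by
      refine ⟨fun _ => hn, ?_⟩
      rintro ⟨i, hi⟩ ⟨j, hj⟩ hij
      exact absurd (Subtype.ext (hi.trans hj.symm)) hij)
  exact ⟨b, b.orthonormal, hb 2 rfl⟩

/-! ### Estimates away from the origin -/

section Outer

variable {c : ℝ} {N : ℕ} {cs : Fin N → ℝ}

/-- Integration of `D_+(r u)` along the characteristic through the origin. -/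
theorem mul_abs_dPlus_le (hc : 0 < c) (hcs : ∀ j, 0 < cs j) {κ μ η β : ℝ} (hκ : 0 ≤ κ)
    (hμ : 0 < μ) (hη : η ≤ 1) :
    ∃ C : ℝ, 0 < C ∧ ∀ (G u : ℝ × E3 → ℝ), ContinuousOn G halfSpace → ContDiffOn ℝ 2 u halfSpace →
      (∀ (t : ℝ) (x : E3), 0 < t → box c u (t, x) = G (t, x)) →
      ∀ (t : ℝ) (x : E3) (M Q : ℝ), 0 < t → x ≠ 0 → 0 ≤ M → 0 ≤ Q →
      (∀ p ∈ cone c t x, ‖p.2‖ * |G p|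
        ≤ M * (jb (p.1 + ‖p.2‖) ^ (-κ) * weight cs p.1 ‖p.2‖ ^ (-(1 + μ)))) →
      (∀ j k : Fin 3, j < k → ∀ (τ : ℝ) (y : E3), 0 < τ → y ≠ 0 → (τ, y) ∈ cone c t x →
        |rot j k (rot j k u) (τ, y)|
          ≤ Q * (jb (τ + ‖y‖) ^ (-(1 - η)) * jb (c * τ - ‖y‖) ^ (-β))) →
      ‖x‖ * |dPlus c u (t, x)| ≤ c * |u (t, x)| + |charFun c t ‖x‖ 0 (‖x‖⁻¹ • x) u 1|
        + C * (M * jb (c * t + ‖x‖) ^ (-κ) + Q * (jb (c * t + ‖x‖) ^ (-(1 - η)) *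
          ∫ s in ‖x‖..(c * t + ‖x‖), s⁻¹ * jb (c * t + ‖x‖ - 2 * s) ^ (-β))) := by
  set I := ∫ y, jb y ^ (-(1 + μ)) with hI
  have hI0 : 0 ≤ I := integral_nonneg fun y => jb_rpow_nonneg _ _
  set cj : Fin (N + 1) → ℝ := Fin.cons 0 cs with hcj
  have hcj0 : ∀ j, 0 ≤ cj j := by
    intro j
    refine Fin.cases ?_ (fun i => ?_) j
    · simp [hcj]
    · simpa [hcj] using (hcs i).le
  set C1 := (1 + c) ^ κ with hC1
  have hC1p : 0 < C1 := Real.rpow_pos_of_pos (by linarith) _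
  set C2 : ℝ := (N + 1) * (1 + c⁻¹ * I) with hC2
  have hC2p : 0 < C2 := by positivity
  set C3 := (1 + c) ^ (1 - η) with hC3
  have hC3p : 0 < C3 := Real.rpow_pos_of_pos (by linarith) _
  refine ⟨C1 * C2 + 3 * c * C3, by positivity, ?_⟩
  intro G u hG hu heqn t x M Q ht hx hM hQ hGM hΩ
  set r := ‖x‖ with hr
  have hr0 : 0 < r := norm_pos_iff.2 hx
  set ν := r⁻¹ • x with hν
  have hνn : ‖ν‖ = 1 := by rw [hν, norm_smul, norm_inv, hr, norm_norm, inv_mul_cancel₀ hr0.ne']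
  have hxν : x = r • ν := by rw [hν, smul_smul, mul_inv_cancel₀ hr0.ne', one_smul]
  set X := c * t + r with hX
  have hct : 0 < c * t := mul_pos hc ht
  -- The centre is the origin and the starting distance is `‖x‖`, so the characteristic is radial
  -- and ends on `t = 0` at distance `ct + ‖x‖`.
  have hchar := charFun_sub ht hu hG heqn r 0 ν
  have h0 : charFun c t r 0 ν u 0 = r * dPlus c u (t, x) + c * u (t, x) := by
    rw [dPlus_eq_hD, ← hr, ← hν]
    simp only [charFun, backPt, mul_zero, add_zero, sub_zero, mul_one, zero_add, ← hxν]
  rw [h0] at hchar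
  set F : ℝ → ℝ := fun s => (r + c * t * s) * G (backPt c t r 0 ν s)
        + c ^ 2 * sphLap u (r + c * t * s) ν (backPt c t r 0 ν s) with hF
  have hmt : MapsTo (backPt c t r 0 ν) (Icc 0 1) halfSpace :=
    fun s hs => backPt_mem ht.le _ _ _ hs.2
  have hbc := (continuous_backPt c t r 0 ν).continuousOn (s := Icc (0 : ℝ) 1)
  have hrc : ContinuousOn (fun s : ℝ => r + c * t * s) (Icc (0 : ℝ) 1) := by fun_prop
  have hFc : ContinuousOn F (Icc 0 1) :=
    (hrc.mul (hG.comp hbc hmt)).add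
      (continuousOn_const.mul (continuousOn_sphLap_comp hu hbc hmt hrc continuousOn_const))
  set W : ℝ → ℝ := fun s => ∑ j, jb ((cj j + c) * (t * (1 - s)) - X) ^ (-(1 + μ)) with hW
  have hWc : Continuous W := continuous_finsetSum _ fun j _ =>
    (continuous_jb_rpow _).comp (by fun_prop)
  set V : ℝ → ℝ := fun s => s⁻¹ * jb (X - 2 * s) ^ (-β) with hV
  have hVc : ContinuousOn (fun s => V (r + c * t * s)) (Icc (0 : ℝ) 1) := by
    refine ContinuousOn.mul ?_ ?_
    · exact hrc.inv₀ fun s hs => (add_pos_of_pos_of_nonneg hr0 (mul_nonneg hct.le hs.1)).ne'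
    · exact ((continuous_jb_rpow _).comp
        (by fun_prop : Continuous fun s : ℝ => X - 2 * (r + c * t * s))).continuousOn
  have hpt : ∀ s ∈ Ioo (0 : ℝ) 1, |F s| ≤ M * C1 * jb X ^ (-κ) * W s
      + 3 * c ^ 2 * C3 * Q * jb X ^ (-(1 - η)) * V (r + c * t * s) := by
    intro s hs
    set ρ := r + c * t * s with hρ
    set τ := t * (1 - s) with hτ
    have hτ0 : 0 < τ := mul_pos ht (by linarith [hs.2])
    have hρ0 : 0 < ρ := add_pos_of_pos_of_nonneg hr0 (mul_nonneg hct.le hs.1.le)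
    have hpe : backPt c t r 0 ν s = (τ, ρ • ν) := by simp only [backPt, zero_add, ← hτ, ← hρ]
    have hyn : ‖ρ • ν‖ = ρ := by rw [norm_smul, hνn, mul_one, Real.norm_eq_abs, abs_of_pos hρ0]
    -- Since `cτ + ρ` is constant on this characteristic, the powers of `⟨τ + ρ⟩` come out of the
    -- integral as powers of `⟨X⟩`, and `cτ - ρ` becomes `X - 2ρ`.
    have hXe : c * τ + ρ = X := by rw [hτ, hρ, hX]; ring
    have hmem : (τ, ρ • ν) ∈ cone c t x := by
      refine ⟨hτ0.le, by simp only [hτ]; nlinarith [hs.1], ?_⟩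
      have : ρ • ν - x = (c * t * s) • ν := by
        rw [hxν, ← sub_smul, hρ]; congr 1; ring
      simp only [this, norm_smul, hνn, Real.norm_eq_abs]
      rw [abs_of_nonneg (mul_nonneg hct.le hs.1.le), hτ]
      exact le_of_eq (by ring)
    have hjX : jb X ≤ (1 + c) * jb (τ + ρ) := by
      refine jb_le_mul_jb (by linarith) ?_
      rw [abs_of_pos (by linarith), abs_of_pos (by linarith), ← hXe]
      nlinarith
    have hG1 : |ρ * G (τ, ρ • ν)| ≤ M * C1 * jb X ^ (-κ) * W s := by
      have h := hGM _ hmem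
      simp only [hyn] at h
      rw [abs_mul, abs_of_pos hρ0]
      refine h.trans ?_
      rw [mul_assoc M, mul_assoc M]
      refine mul_le_mul_of_nonneg_left (mul_le_mul (jb_neg_rpow_le (by linarith) hκ hjX) ?_
        (Real.rpow_nonneg (zero_le_one.trans (one_le_weight _ _ _)) _)
        (mul_nonneg hC1p.le (jb_rpow_nonneg _ _))) hM
      refine (weight_rpow_le_sum cs τ ρ _).trans (le_of_eq ?_)
      refine Finset.sum_congr rfl fun j _ => ?_
      congr 2
      simp only [hcj, ← hτ, ← hXe]; ring
    have hΩ1 : |sphLap u ρ ν (τ, ρ • ν)| ≤ 3 * C3 * Q * jb X ^ (-(1 - η)) * V ρ := by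
      have hy0 : ρ • ν ≠ 0 := norm_ne_zero_iff.1 (by rw [hyn]; exact hρ0.ne')
      have hb : ∀ j k : Fin 3, j < k → |rot j k (rot j k u) (τ, ρ • ν)|
          ≤ Q * (C3 * jb X ^ (-(1 - η)) * jb (X - 2 * ρ) ^ (-β)) := by
        intro j k hjk
        have h := hΩ j k hjk τ (ρ • ν) hτ0 hy0 hmem
        rw [hyn, show c * τ - ρ = X - 2 * ρ by rw [← hXe]; ring] at h
        refine h.trans (mul_le_mul_of_nonneg_left (mul_le_mul_of_nonneg_right ?_
          (jb_rpow_nonneg _ _)) hQ)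
        exact jb_neg_rpow_le (by linarith) (by linarith) hjX
      rw [sphLap_eq_sum_rot hu hτ0.le hρ0 hνn, abs_mul, abs_of_pos (inv_pos.2 hρ0)]
      have h3 := (abs_add_three (rot 0 1 (rot 0 1 u) (τ, ρ • ν)) (rot 0 2 (rot 0 2 u) (τ, ρ • ν))
        (rot 1 2 (rot 1 2 u) (τ, ρ • ν))).trans (add_le_add (add_le_add (hb 0 1 (by decide))
          (hb 0 2 (by decide))) (hb 1 2 (by decide)))
      refine (mul_le_mul_of_nonneg_left h3 (inv_pos.2 hρ0).le).trans (le_of_eq ?_)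
      simp only [hV]; ring
    simp only [hF, hpe]
    refine (abs_add_le _ _).trans (add_le_add hG1 ?_)
    rw [abs_mul, abs_of_nonneg (sq_nonneg c)]
    refine (mul_le_mul_of_nonneg_left hΩ1 (sq_nonneg c)).trans (le_of_eq (by ring))
  -- The incoming characteristic crosses every cone `c_j τ = ρ` with relative speed `c_j + c ≥ c`,
  -- so the weights have a bounded integral along it.
  have hWI : t * ∫ s in (0 : ℝ)..1, W s ≤ C2 := by
    simp only [hW]
    rw [intervalIntegral.integral_finsetSum, Finset.mul_sum]
    · have hj : ∀ j, t * ∫ s in (0 : ℝ)..1, jb ((cj j + c) * (t * (1 - s)) - X) ^ (-(1 + μ))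
          ≤ 1 + c⁻¹ * I := by
        intro j
        have hcjc : 0 < cj j + c := add_pos_of_nonneg_of_pos (hcj0 j) hc
        refine (mul_integral_jb_le hμ hcjc ht X).trans ?_
        have h1 : (cj j + c)⁻¹ ≤ c⁻¹ := inv_anti₀ hc (by linarith [hcj0 j])
        refine (mul_le_of_le_one_right (by positivity) (min_le_left _ _)).trans ?_
        rw [← hI]
        gcongr
      refine (Finset.sum_le_sum fun j _ => hj j).trans (le_of_eq ?_)
      simp only [Finset.sum_const, Finset.card_univ, Fintype.card_fin, nsmul_eq_mul, hC2]
      push_cast; ring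
    · intro j _
      exact ((continuous_jb_rpow _).comp (by fun_prop)).intervalIntegrable _ _
  have hVI : t * ∫ s in (0 : ℝ)..1, V (r + c * t * s) = c⁻¹ * ∫ s in r..X, V s := by
    rw [intervalIntegral.integral_comp_add_mul V hct.ne', smul_eq_mul, mul_zero, add_zero, mul_one,
      show r + c * t = X by rw [hX]; ring]
    field_simp
  have hInt : t * |∫ s in (0 : ℝ)..1, F s| ≤ M * C1 * jb X ^ (-κ) * C2
      + 3 * c * C3 * Q * jb X ^ (-(1 - η)) * ∫ s in r..X, V s := by
    have hi1 : IntervalIntegrable (fun s => M * C1 * jb X ^ (-κ) * W s) volume 0 1 :=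
      (hWc.intervalIntegrable 0 1).const_mul _
    have hi2 : IntervalIntegrable (fun s => 3 * c ^ 2 * C3 * Q * jb X ^ (-(1 - η))
        * V (r + c * t * s)) volume 0 1 :=
      (hVc.intervalIntegrable_of_Icc zero_le_one).const_mul _
    have h1 : |∫ s in (0 : ℝ)..1, F s| ≤ M * C1 * jb X ^ (-κ) * (∫ s in (0 : ℝ)..1, W s)
        + 3 * c ^ 2 * C3 * Q * jb X ^ (-(1 - η)) * ∫ s in (0 : ℝ)..1, V (r + c * t * s) := by
      rw [← intervalIntegral.integral_const_mul, ← intervalIntegral.integral_const_mul,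
        ← intervalIntegral.integral_add hi1 hi2]
      refine (intervalIntegral.abs_integral_le_integral_abs zero_le_one).trans ?_
      exact intervalIntegral.integral_mono_on_of_le_Ioo zero_le_one
        (hFc.abs.intervalIntegrable_of_Icc zero_le_one) (hi1.add hi2) hpt
    calc t * |∫ s in (0 : ℝ)..1, F s|
        ≤ t * (M * C1 * jb X ^ (-κ) * (∫ s in (0 : ℝ)..1, W s)
          + 3 * c ^ 2 * C3 * Q * jb X ^ (-(1 - η)) * ∫ s in (0 : ℝ)..1, V (r + c * t * s)) :=
          mul_le_mul_of_nonneg_left h1 ht.le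
      _ = M * C1 * jb X ^ (-κ) * (t * ∫ s in (0 : ℝ)..1, W s)
          + 3 * c ^ 2 * C3 * Q * jb X ^ (-(1 - η)) * (t * ∫ s in (0 : ℝ)..1, V (r + c * t * s)) := by
          ring
      _ ≤ M * C1 * jb X ^ (-κ) * C2
          + 3 * c ^ 2 * C3 * Q * jb X ^ (-(1 - η)) * (t * ∫ s in (0 : ℝ)..1, V (r + c * t * s)) := by
          refine add_le_add (mul_le_mul_of_nonneg_left hWI ?_) le_rfl
          exact mul_nonneg (by positivity) (jb_rpow_nonneg _ _)
      _ = _ := by rw [hVI]; field_simp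
  have hrX : r ≤ X := by linarith
  have hVnn : 0 ≤ ∫ s in r..X, V s := intervalIntegral.integral_nonneg hrX fun s hs =>
    mul_nonneg (inv_pos.2 (hr0.trans_le hs.1)).le (jb_rpow_nonneg _ _)
  have hfin : r * |dPlus c u (t, x)| = |r * dPlus c u (t, x)| := by rw [abs_mul, abs_of_pos hr0]
  have heq : r * dPlus c u (t, x) = -(c * u (t, x)) + charFun c t r 0 ν u 1
      + t * ∫ s in (0 : ℝ)..1, F s := by linarith
  rw [hfin, heq]
  refine (abs_add_three _ _ _).trans ?_
  rw [abs_neg, abs_mul, abs_of_pos hc, abs_mul, abs_of_pos ht]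
  have hp1 : 0 ≤ M * jb X ^ (-κ) := mul_nonneg hM (jb_rpow_nonneg _ _)
  have hp2 : 0 ≤ Q * (jb X ^ (-(1 - η)) * ∫ s in r..X, V s) :=
    mul_nonneg hQ (mul_nonneg (jb_rpow_nonneg _ _) hVnn)
  have hkey : t * |∫ s in (0 : ℝ)..1, F s| ≤ (C1 * C2 + 3 * c * C3) *
      (M * jb X ^ (-κ) + Q * (jb X ^ (-(1 - η)) * ∫ s in r..X, V s)) := by
    refine hInt.trans ?_
    have a1 : 0 < C1 * C2 := by positivity
    have a2 : 0 < 3 * c * C3 := by positivity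
    nlinarith [mul_nonneg a1.le hp2, mul_nonneg a2.le hp1]
  linarith

end Outer

/-! ### From bounds near and away from the origin to the weighted estimates -/

section Weights

variable {c κ t r D : ℝ}

/-- Passage to the weighted estimate near the origin. -/
theorem weighted_le_of_inner (hr : 0 ≤ r) (hr1 : r ≤ 1) {K : ℝ} (hK : 0 ≤ K)
    (h : D ≤ K * ((jb (t + r))⁻¹ * jb (c * t - r) ^ (1 - κ))) :
    jb r * jb (t + r) * jb (c * t - r) ^ (κ - 1) * D ≤ 2 * K := by
  have h1 : jb r ≤ 2 := (jb_le_one_add hr).trans (by linarith)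
  have h2 := jb_pos (t + r)
  have h3 := Real.rpow_pos_of_pos (jb_pos (c * t - r)) (κ - 1)
  have h4 : jb (c * t - r) ^ (κ - 1) * jb (c * t - r) ^ (1 - κ) = 1 := by
    rw [← Real.rpow_add (jb_pos _)]; simp
  have h5 := jb_pos r
  calc jb r * jb (t + r) * jb (c * t - r) ^ (κ - 1) * D
      ≤ jb r * jb (t + r) * jb (c * t - r) ^ (κ - 1) *
          (K * ((jb (t + r))⁻¹ * jb (c * t - r) ^ (1 - κ))) := by gcongr
    _ = jb r * K * (jb (t + r) * (jb (t + r))⁻¹)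
          * (jb (c * t - r) ^ (κ - 1) * jb (c * t - r) ^ (1 - κ)) := by ring
    _ = jb r * K := by rw [h4, mul_inv_cancel₀ h2.ne']; ring
    _ ≤ 2 * K := mul_le_mul_of_nonneg_right h1 hK

/-- Passage to the weighted estimate away from the origin. -/
theorem weighted_le_of_outer (hc : 0 < c) (ht : 0 < t) (hr : 1 ≤ r) (hκ : 1 ≤ κ) {K₁ K₂ : ℝ}
    (hK₂ : 0 ≤ K₂) (hD : 0 ≤ D)
    (h : r * D ≤ K₁ * ((jb (t + r))⁻¹ * jb (c * t - r) ^ (1 - κ)) + K₂ * jb (c * t + r) ^ (-κ)) :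
    jb r * jb (t + r) * jb (c * t - r) ^ (κ - 1) * D ≤ 2 * K₁ + 2 * (1 + 1 / c) * K₂ := by
  have h1 : jb r ≤ 2 * r := (jb_le_one_add (by linarith)).trans (by linarith)
  have h2 := jb_pos (t + r)
  have h3 := Real.rpow_pos_of_pos (jb_pos (c * t - r)) (κ - 1)
  have h4 : jb (c * t - r) ^ (κ - 1) * jb (c * t - r) ^ (1 - κ) = 1 := by
    rw [← Real.rpow_add (jb_pos _)]; simp
  have hct : 0 < c * t := mul_pos hc ht
  have h6 : jb (t + r) ≤ (1 + 1 / c) * jb (c * t + r) := by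
    refine jb_le_mul_jb (by linarith [div_pos one_pos hc]) ?_
    rw [abs_of_pos (by linarith), abs_of_pos (by linarith)]
    have e : (1 + 1 / c) * (c * t + r) = c * t + r + t + r / c := by field_simp; ring
    have := div_pos (show 0 < r by linarith) hc
    linarith
  have h7 : jb (c * t - r) ^ (κ - 1) ≤ jb (c * t + r) ^ (κ - 1) := by
    refine Real.rpow_le_rpow (jb_pos _).le (jb_le_jb ?_) (by linarith)
    rw [abs_of_pos (show 0 < c * t + r by linarith)]
    exact abs_le.2 ⟨by linarith, by linarith⟩
  have h8 : jb (c * t + r) * jb (c * t + r) ^ (κ - 1) * jb (c * t + r) ^ (-κ) = 1 := by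
    rw [mul_assoc, ← Real.rpow_add (jb_pos _), show κ - 1 + -κ = (-1 : ℝ) by ring,
      Real.rpow_neg_one, mul_inv_cancel₀ (jb_pos _).ne']
  -- Both `⟨t + r⟩` and `⟨ct - r⟩` are at most a multiple of `⟨ct + r⟩`, whose total power is `1 +
  -- (κ - 1) - κ = 0`.
  have h9 : jb (t + r) * jb (c * t - r) ^ (κ - 1) * jb (c * t + r) ^ (-κ) ≤ 1 + 1 / c := by
    calc _ ≤ ((1 + 1 / c) * jb (c * t + r)) * jb (c * t + r) ^ (κ - 1)
            * jb (c * t + r) ^ (-κ) := by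
          refine mul_le_mul_of_nonneg_right (mul_le_mul h6 h7 h3.le ?_) (jb_rpow_nonneg _ _)
          exact h2.le.trans h6
      _ = (1 + 1 / c) * (jb (c * t + r) * jb (c * t + r) ^ (κ - 1) * jb (c * t + r) ^ (-κ)) := by
          ring
      _ = _ := by rw [h8, mul_one]
  calc jb r * jb (t + r) * jb (c * t - r) ^ (κ - 1) * D
      ≤ 2 * r * jb (t + r) * jb (c * t - r) ^ (κ - 1) * D := by gcongr
    _ = 2 * (jb (t + r) * jb (c * t - r) ^ (κ - 1)) * (r * D) := by ring
    _ ≤ 2 * (jb (t + r) * jb (c * t - r) ^ (κ - 1)) *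
          (K₁ * ((jb (t + r))⁻¹ * jb (c * t - r) ^ (1 - κ)) + K₂ * jb (c * t + r) ^ (-κ)) := by
        gcongr
    _ = 2 * K₁ * (jb (t + r) * (jb (t + r))⁻¹)
          * (jb (c * t - r) ^ (κ - 1) * jb (c * t - r) ^ (1 - κ))
          + 2 * K₂ * (jb (t + r) * jb (c * t - r) ^ (κ - 1) * jb (c * t + r) ^ (-κ)) := by ring
    _ ≤ 2 * K₁ + 2 * K₂ * (1 + 1 / c) := by
        rw [h4, mul_inv_cancel₀ h2.ne', mul_one, mul_one]
        gcongr
    _ = _ := by ring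

end Weights

/-! ### The inhomogeneous equation -/

theorem abs_le_of_four_pi_mul_eq {v w : ℝ} (h : 4 * Real.pi * v = w) : |v| ≤ |w| := by
  have h1 : (1 : ℝ) ≤ 4 * Real.pi := by linarith [Real.pi_gt_three]
  rw [← h, abs_mul, abs_of_nonneg (zero_le_one.trans h1)]
  exact le_mul_of_one_le_left (abs_nonneg v) h1

theorem abs_rot_rot_le_zNorm {s : ℕ} (hs : 2 ≤ s) (f : ℝ × E3 → ℝ) (p : ℝ × E3) {j k : Fin 3}
    (hjk : j < k) : |rot j k (rot j k f) p| ≤ zNorm s f p := by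
  fin_cases j <;> fin_cases k <;> first | (exfalso; revert hjk; decide) | skip
  · exact abs_zField_iterate_le_zNorm f p 4 (n := 2) hs
  · exact abs_zField_iterate_le_zNorm f p 5 (n := 2) hs
  · exact abs_zField_iterate_le_zNorm f p 6 (n := 2) hs

theorem integral_char_nonneg {c t r m : ℝ} (hc : 0 < c) (ht : 0 < t) (hr : 0 < r) :
    0 ≤ r⁻¹ * ∫ p in |c * t - r|..(c * t + r), jb p ^ m := by
  have hct : 0 < c * t := mul_pos hc ht
  exact mul_nonneg (inv_pos.2 hr).le (intervalIntegral.integral_nonneg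
    (abs_le.2 ⟨by linarith, by linarith⟩) fun p _ => jb_rpow_nonneg _ _)

/-- The common core of both estimates with a source: `Λ` is the admitted loss, a logarithm or `1`,
and `P` the admitted region of points. The bound `hE` is not restricted by `P`, because it serves
for the rotational derivatives at all points of the backward cone. -/
theorem dPlus_inhomogeneous_le {c : ℝ} (hc : 0 < c) {N : ℕ} {cs : Fin N → ℝ} (hcs : ∀ j, 0 < cs j)
    {κ μ η β : ℝ} (hκ : 1 ≤ κ) (hμ : 0 < μ) (hη : η ≤ 1) {P : ℝ → ℝ → Prop} {Λ : ℝ → ℝ → ℝ}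
    (hE : ∃ C : ℝ, 0 < C ∧ ∀ t r : ℝ, 0 < t → 0 < r →
      r⁻¹ * ∫ p in |c * t - r|..(c * t + r), jb p ^ (-κ)
        ≤ C * (jb (t + r) ^ (-(1 - η)) * jb (c * t - r) ^ (-β)))
    (hΛ : ∃ C : ℝ, 0 < C ∧ ∀ t r : ℝ, 0 < t → 0 < r → P t r →
      r⁻¹ * ∫ p in |c * t - r|..(c * t + r), jb p ^ (-κ)
        ≤ C * Λ t r * ((jb (t + r))⁻¹ * jb (c * t - r) ^ (1 - κ)))
    (hJ : ∃ C : ℝ, 0 < C ∧ ∀ t r : ℝ, 0 < t → 1 ≤ r → P t r →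
      jb (c * t + r) ^ (-(1 - η)) * ∫ s in r..(c * t + r), s⁻¹ * jb (c * t + r - 2 * s) ^ (-β)
        ≤ C * Λ t r * jb (c * t + r) ^ (-κ))
    (hΛ1 : ∃ C : ℝ, 0 < C ∧ ∀ t r : ℝ, 0 < t → 0 < r → P t r → 1 ≤ C * Λ t r) :
    ∃ C : ℝ, 0 < C ∧ ∀ G u : ℝ × E3 → ℝ, ContDiffOn ℝ ∞ G halfSpace →
      IsSolution c G (fun _ => 0) (fun _ => 0) u →
      ∀ (t : ℝ) (x : E3), 0 < t → x ≠ 0 → P t ‖x‖ →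
        jb ‖x‖ * jb (t + ‖x‖) * jb (c * t - ‖x‖) ^ (κ - 1) * |dPlus c u (t, x)|
          ≤ C * Λ t ‖x‖ * normA cs κ μ 2 G c t x := by
  obtain ⟨CE, hCE, hE⟩ := hE
  obtain ⟨CL, hCL, hΛ⟩ := hΛ
  obtain ⟨CJ, hCJ, hJ⟩ := hJ
  obtain ⟨C1, hC1, hΛ1⟩ := hΛ1
  obtain ⟨C6, hC6, hpot⟩ := abs_retPot_le_of_weight hc hcs (κ := κ) (by linarith) hμ
  obtain ⟨C8, hC8, hout⟩ := mul_abs_dPlus_le hc hcs (κ := κ) (μ := μ) (η := η) (β := β)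
    (by linarith) hμ hη
  refine ⟨2 * ((3 + 6 * c) * C6 * CL) + (2 * (c * C6 * CL)
    + 2 * (1 + 1 / c) * (C8 * (C1 + C6 * CE * CJ))), by positivity, ?_⟩
  intro G u hG hu t x ht hx hP
  set r := ‖x‖ with hr
  set M := normA cs κ μ 2 G c t x with hM
  have hM0 : 0 ≤ M := normA_nonneg _ _ _ _ _ _ _ _
  have hr0 : 0 < r := norm_pos_iff.2 hx
  have hΛp : 0 < Λ t r := by
    by_contra h
    have := hΛ1 t r ht hr0 hP
    nlinarith
  have hz := continuousOn_zNorm hG 2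
  -- The norm `M` belongs to the apex `(t, x)`, but it bounds the source on the smaller cone of
  -- every `(τ, y)` inside.
  have hpot' : ∀ (τ : ℝ) (y : E3) (b : Fin 3 → E3) (g : ℝ × E3 → ℝ), 0 < τ → y ≠ 0 →
      (τ, y) ∈ cone c t x → Orthonormal ℝ b → b 2 = ‖y‖⁻¹ • y → ContinuousOn g halfSpace →
      (∀ p, |g p| ≤ zNorm 2 G p) → |retPot c τ y b g| ≤ C6 * M * min 1 τ * (‖y‖⁻¹ *
        ∫ p in |c * τ - ‖y‖|..(c * τ + ‖y‖), jb p ^ (-κ)) := by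
    intro τ y b g hτ hy hmem hb hb2 hg hgz
    refine hpot τ y b g M hτ hy hb hb2 hg hM0 fun p hp => ?_
    exact (mul_le_mul_of_nonneg_left (hgz p) (norm_nonneg _)).trans
      (mul_zNorm_le_normA cs κ μ hG hc (cone_subset hmem hp))
  have hxmem : (t, x) ∈ cone c t x := ⟨ht.le, le_rfl, by simp⟩
  obtain ⟨b, hb, hb2⟩ := exists_frame hx
  set E := r⁻¹ * ∫ p in |c * t - r|..(c * t + r), jb p ^ (-κ) with hEdef
  have hE0 : 0 ≤ E := integral_char_nonneg hc ht hr0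
  have hEL := hΛ t r ht hr0 hP
  rw [← hEdef] at hEL
  have hGz : ∀ p, |G p| ≤ zNorm 2 G p := fun p =>
    abs_zField_iterate_le_zNorm G p 0 (n := 0) (by norm_num)
  have hΛM : 0 ≤ Λ t r * M := mul_nonneg hΛp.le hM0
  rcases le_total r 1 with hr1 | hr1
  · have h1 := abs_dPlus_le_retPot hc ht hG hu hx hb
    have h2 := hpot' t x b (zNorm 2 G) ht hx hxmem hb hb2 hz
      fun p => (abs_of_nonneg (zNorm_nonneg _ _ _)).le
    have h3 : |dPlus c u (t, x)| ≤ (3 + 6 * c) * C6 * M * E := by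
      have h4 : |dPlus c u (t, x)| ≤ 4 * Real.pi * |dPlus c u (t, x)| :=
        le_mul_of_one_le_left (abs_nonneg _) (by linarith [Real.pi_gt_three])
      -- Here the singular factor `2 / t` meets the factor `min 1 t` of the potential estimate.
      have h5 : (2 / t + (1 + 6 * c)) * min 1 t ≤ 3 + 6 * c := by
        have h6 : 2 / t * min 1 t ≤ 2 := by
          rw [div_mul_eq_mul_div, div_le_iff₀ ht]
          exact mul_le_mul_of_nonneg_left (min_le_right _ _) two_pos.le
        have h7 := mul_le_of_le_one_right (by linarith : 0 ≤ 1 + 6 * c) (min_le_left 1 t)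
        rw [add_mul]; linarith
      calc |dPlus c u (t, x)| ≤ (2 / t + (1 + 6 * c)) * retPot c t x b (zNorm 2 G) := h4.trans h1
        _ ≤ (2 / t + (1 + 6 * c)) * (C6 * M * min 1 t * E) := by
            refine mul_le_mul_of_nonneg_left ((le_abs_self _).trans h2) (by positivity)
        _ = ((2 / t + (1 + 6 * c)) * min 1 t) * (C6 * M * E) := by ring
        _ ≤ (3 + 6 * c) * (C6 * M * E) := mul_le_mul_of_nonneg_right h5 (by positivity)
        _ = _ := by ring
    have h4 : |dPlus c u (t, x)| ≤ ((3 + 6 * c) * C6 * CL * (Λ t r * M)) *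
        ((jb (t + r))⁻¹ * jb (c * t - r) ^ (1 - κ)) := by
      refine h3.trans ((mul_le_mul_of_nonneg_left hEL (by positivity)).trans (le_of_eq ?_))
      ring
    refine (weighted_le_of_inner hr0.le hr1 (by positivity) h4).trans ?_
    have : 0 ≤ (2 * (c * C6 * CL) + 2 * (1 + 1 / c) * (C8 * (C1 + C6 * CE * CJ))) * (Λ t r * M) := by
      positivity
    nlinarith
  -- The data vanish, so the initial end of the characteristic contributes nothing.
  · have hc0 : charFun c t r 0 (r⁻¹ • x) u 1 = 0 := by
      simp only [charFun, backPt, sub_self, mul_zero, hD_zero_of_init hu contDiff_const, hu.init]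
      simp
    have hu1 : |u (t, x)| ≤ C6 * M * E := by
      refine (abs_le_of_four_pi_mul_eq (repr_retPot hc ht hG hu x hb)).trans
        ((hpot' t x b G ht hx hxmem hb hb2 hG.continuousOn hGz).trans ?_)
      rw [mul_assoc, mul_assoc, mul_assoc]
      refine mul_le_mul_of_nonneg_left (mul_le_mul_of_nonneg_left ?_ hM0) hC6.le
      exact mul_le_of_le_one_left hE0 (min_le_left _ _)
    have h := hout G u hG.continuousOn hu.contDiffOn hu.eqn t x M (C6 * M * CE) ht hx hM0
      (by positivity) (fun p hp => (mul_le_mul_of_nonneg_left (hGz p) (norm_nonneg _)).trans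
        (mul_zNorm_le_normA cs κ μ hG hc hp)) (by
        intro j k hjk τ y hτ hy hmem
        obtain ⟨b', hb', hb2'⟩ := exists_frame hy
        refine (abs_le_of_four_pi_mul_eq (repr_rot_rot hc hτ hG hu y hb' hjk.ne)).trans
          ((hpot' τ y b' _ hτ hy hmem hb' hb2'
            (contDiffOn_rot (contDiffOn_rot hG j k) j k).continuousOn
            fun p => abs_rot_rot_le_zNorm le_rfl G p hjk).trans ?_)
        rw [mul_assoc, mul_assoc (C6 * M)]
        refine mul_le_mul_of_nonneg_left ?_ (by positivity)
        refine (mul_le_of_le_one_left (integral_char_nonneg hc hτ (norm_pos_iff.2 hy))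
          (min_le_left _ _)).trans (hE τ ‖y‖ hτ (norm_pos_iff.2 hy)))
    rw [hc0, abs_zero, add_zero] at h
    have hJ1 := hJ t r ht hr1 hP
    have hL1 := hΛ1 t r ht hr0 hP
    have hX := jb_rpow_nonneg (c * t + r) (-κ)
    have h2 : r * |dPlus c u (t, x)| ≤ (c * C6 * CL * (Λ t r * M)) *
        ((jb (t + r))⁻¹ * jb (c * t - r) ^ (1 - κ))
        + (C8 * (C1 + C6 * CE * CJ) * (Λ t r * M)) * jb (c * t + r) ^ (-κ) := by
      refine h.trans (add_le_add ?_ ?_)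
      · calc c * |u (t, x)| ≤ c * (C6 * M * (CL * Λ t r *
              ((jb (t + r))⁻¹ * jb (c * t - r) ^ (1 - κ)))) := by
              refine mul_le_mul_of_nonneg_left (hu1.trans ?_) hc.le
              exact mul_le_mul_of_nonneg_left hEL (by positivity)
          _ = _ := by ring
      · calc _ ≤ C8 * (M * (C1 * Λ t r) * jb (c * t + r) ^ (-κ)
              + C6 * M * CE * (CJ * Λ t r * jb (c * t + r) ^ (-κ))) := by
              refine mul_le_mul_of_nonneg_left (add_le_add ?_ ?_) hC8.le
              · refine mul_le_mul_of_nonneg_right ?_ hX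
                exact le_mul_of_one_le_right hM0 hL1
              · exact mul_le_mul_of_nonneg_left hJ1 (by positivity)
          _ = _ := by ring
    refine (weighted_le_of_outer hc ht hr1 hκ (by positivity) (abs_nonneg _) h2).trans ?_
    have : 0 ≤ 2 * ((3 + 6 * c) * C6 * CL) * (Λ t r * M) := by positivity
    nlinarith

theorem dPlus_inhomogeneous_log {c : ℝ} (hc : 0 < c) {N : ℕ} {cs : Fin N → ℝ}
    (hcs : ∀ j, 0 < cs j) {κ μ : ℝ} (hκ1 : 1 ≤ κ) (hκ2 : κ ≤ 2) (hμ : 0 < μ) :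
    ∃ C : ℝ, 0 < C ∧ ∀ G u : ℝ × E3 → ℝ, ContDiffOn ℝ ∞ G halfSpace →
      IsSolution c G (fun _ => 0) (fun _ => 0) u →
      ∀ (t : ℝ) (x : E3), 0 < t → x ≠ 0 →
        jb ‖x‖ * jb (t + ‖x‖) * jb (c * t - ‖x‖) ^ (κ - 1) * |dPlus c u (t, x)|
          ≤ C * Real.log (2 + (t + ‖x‖)) * normA cs κ μ 2 G c t x := by
  have hl2 : 0 < Real.log 2 := Real.log_pos one_lt_two
  have hΛ1 : ∃ C : ℝ, 0 < C ∧ ∀ t r : ℝ, 0 < t → 0 < r → True →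
      1 ≤ C * (fun t r => Real.log (2 + (t + r))) t r := by
    refine ⟨(Real.log 2)⁻¹, by positivity, fun t r ht hr _ => ?_⟩
    rw [inv_mul_eq_div, le_div_iff₀ hl2, one_mul]
    exact log_two_le_log (by linarith)
  have hlog : ∀ t r : ℝ, 0 < t → 0 < r → Real.log (2 + (c * t + r))
      ≤ (1 + Real.log (1 + c) / Real.log 2) * Real.log (2 + (t + r)) := fun t r ht hr =>
    log_two_add_le (by linarith) (by linarith) (by nlinarith) (by nlinarith)
  have hm : 0 < 1 + Real.log (1 + c) / Real.log 2 :=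
    add_pos_of_pos_of_nonneg one_pos (div_nonneg (Real.log_nonneg (by linarith)) hl2.le)
  have main : ∃ C : ℝ, 0 < C ∧ ∀ G u : ℝ × E3 → ℝ, ContDiffOn ℝ ∞ G halfSpace →
      IsSolution c G (fun _ => 0) (fun _ => 0) u →
      ∀ (t : ℝ) (x : E3), 0 < t → x ≠ 0 → True →
        jb ‖x‖ * jb (t + ‖x‖) * jb (c * t - ‖x‖) ^ (κ - 1) * |dPlus c u (t, x)|
          ≤ C * (fun t r => Real.log (2 + (t + r))) t ‖x‖ * normA cs κ μ 2 G c t x := by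
    rcases hκ1.eq_or_lt with rfl | hκ
    -- For `κ = 1` the rotational derivatives are bounded with half powers. The only logarithm of
    -- the second term is then the one from integrating along the characteristic.
    · refine dPlus_inhomogeneous_le hc hcs (η := 1 / 2) (β := 1 / 2) (P := fun _ _ => True) le_rfl
        hμ (by norm_num) ?_ ?_ ?_ hΛ1
      · obtain ⟨C, hC, h⟩ := radial_bound_half hc
        refine ⟨C, hC, fun t r ht hr => (h t r ht hr).trans (le_of_eq ?_)⟩
        norm_num
      · obtain ⟨C, hC, h⟩ := radial_bound_log hc
        refine ⟨C, hC, fun t r ht hr _ => (h t r ht hr).trans (le_of_eq ?_)⟩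
        simp
      · obtain ⟨C, hC, h⟩ := char_integral_half
        refine ⟨C * (1 + Real.log (1 + c) / Real.log 2), by positivity, fun t r ht hr _ => ?_⟩
        have hct : 0 < c * t := mul_pos hc ht
        have h1 := h r (c * t + r) hr (by linarith)
        have h2 := hlog t r ht (by linarith)
        have hX := jb_rpow_nonneg (c * t + r) (-(1 / 2))
        have e : jb (c * t + r) ^ (-(1 / 2) : ℝ) * jb (c * t + r) ^ (-(1 / 2) : ℝ)
            = jb (c * t + r) ^ (-1 : ℝ) := by
          rw [← Real.rpow_add (jb_pos _)]; norm_num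
        rw [show (-(1 - 1 / 2) : ℝ) = -(1 / 2) by norm_num]
        calc _ ≤ jb (c * t + r) ^ (-(1 / 2) : ℝ) * (C * ((1 + Real.log (1 + c) / Real.log 2)
              * Real.log (2 + (t + r))) * jb (c * t + r) ^ (-(1 / 2) : ℝ)) := by
              refine mul_le_mul_of_nonneg_left (h1.trans ?_) hX
              refine mul_le_mul_of_nonneg_right ?_ hX
              exact mul_le_mul_of_nonneg_left h2 hC.le
          _ = C * (1 + Real.log (1 + c) / Real.log 2) * Real.log (2 + (t + r))
              * (jb (c * t + r) ^ (-(1 / 2) : ℝ) * jb (c * t + r) ^ (-(1 / 2) : ℝ)) := by ring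
          _ = _ := by rw [e]
    · refine dPlus_inhomogeneous_le hc hcs (η := 0) (β := κ - 1) (P := fun _ _ => True) hκ1
        hμ (by norm_num) ?_ ?_ ?_ hΛ1
      · obtain ⟨C, hC, h⟩ := radial_bound_of_one_lt hc hκ
        refine ⟨C, hC, fun t r ht hr => (h t r ht hr).trans (le_of_eq ?_)⟩
        rw [sub_zero, Real.rpow_neg_one, neg_sub]
      · obtain ⟨C, hC, h⟩ := radial_bound_of_one_lt hc hκ
        refine ⟨C * (Real.log 2)⁻¹, by positivity, fun t r ht hr _ => (h t r ht hr).trans ?_⟩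
        refine mul_le_mul_of_nonneg_right ?_ (mul_nonneg (inv_pos.2 (jb_pos _)).le
          (jb_rpow_nonneg _ _))
        rw [mul_assoc]
        refine le_mul_of_one_le_right hC.le ?_
        rw [inv_mul_eq_div, le_div_iff₀ hl2, one_mul]
        exact log_two_le_log (by linarith)
      · obtain ⟨C, hC, h⟩ := char_integral_log hκ hκ2
        refine ⟨C * (1 + Real.log (1 + c) / Real.log 2), by positivity, fun t r ht hr _ => ?_⟩
        have hct : 0 < c * t := mul_pos hc ht
        have h1 := h r (c * t + r) hr (by linarith)
        have h2 := hlog t r ht (by linarith)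
        rw [sub_zero, Real.rpow_neg_one]
        calc _ ≤ (jb (c * t + r))⁻¹ * (C * ((1 + Real.log (1 + c) / Real.log 2)
              * Real.log (2 + (t + r))) * jb (c * t + r) ^ (1 - κ)) := by
              refine mul_le_mul_of_nonneg_left (h1.trans ?_) (inv_pos.2 (jb_pos _)).le
              refine mul_le_mul_of_nonneg_right ?_ (jb_rpow_nonneg _ _)
              exact mul_le_mul_of_nonneg_left h2 hC.le
          _ = C * (1 + Real.log (1 + c) / Real.log 2) * Real.log (2 + (t + r))
              * ((jb (c * t + r))⁻¹ * jb (c * t + r) ^ (1 - κ)) := by ring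
          _ = _ := by
              rw [inv_mul_rpow_sub]; congr 2; ring
  obtain ⟨C, hC, h⟩ := main
  exact ⟨C, hC, fun G u hG hu t x ht hx => h G u hG hu t x ht hx trivial⟩

theorem dPlus_inhomogeneous_far {c : ℝ} (hc : 0 < c) {N : ℕ} {cs : Fin N → ℝ}
    (hcs : ∀ j, 0 < cs j) {κ μ : ℝ} (hκ1 : 1 < κ) (hκ2 : κ < 2) (hμ : 0 < μ) {δ : ℝ} (hδ : 0 < δ) :
    ∃ C : ℝ, 0 < C ∧ ∀ G u : ℝ × E3 → ℝ, ContDiffOn ℝ ∞ G halfSpace →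
      IsSolution c G (fun _ => 0) (fun _ => 0) u →
      ∀ (t : ℝ) (x : E3), 0 < t → δ * t < ‖x‖ →
        jb (t + ‖x‖) ^ 2 * jb (c * t - ‖x‖) ^ (κ - 1) * |dPlus c u (t, x)|
          ≤ C * normA cs κ μ 2 G c t x := by
  obtain ⟨C, hC, h⟩ := dPlus_inhomogeneous_le hc hcs (κ := κ) (μ := μ) (η := 0) (β := κ - 1)
    (P := fun t r => δ * t < r) (Λ := fun _ _ => 1) hκ1.le hμ (by norm_num)
    (by
      obtain ⟨C, hC, h⟩ := radial_bound_of_one_lt hc hκ1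
      refine ⟨C, hC, fun t r ht hr => (h t r ht hr).trans (le_of_eq ?_)⟩
      rw [sub_zero, Real.rpow_neg_one, neg_sub])
    (by
      obtain ⟨C, hC, h⟩ := radial_bound_of_one_lt hc hκ1
      refine ⟨C, hC, fun t r ht hr _ => (h t r ht hr).trans (le_of_eq ?_)⟩
      rw [mul_one])
    (by
      -- In the region `δt < r` one has `ct + r ≤ (c/δ + 1) r`.
      obtain ⟨C, hC, h⟩ := char_integral_far hκ1 hκ2 (m := c / δ + 1)
        (by linarith [div_pos hc hδ])
      refine ⟨C, hC, fun t r ht hr hP => ?_⟩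
      have hct : 0 < c * t := mul_pos hc ht
      have h1 := h r (c * t + r) hr (by linarith) (by
        have : c * t ≤ c / δ * r := by
          rw [div_mul_eq_mul_div, le_div_iff₀ hδ]
          nlinarith
        linarith)
      rw [sub_zero, Real.rpow_neg_one, mul_one]
      calc _ ≤ (jb (c * t + r))⁻¹ * (C * jb (c * t + r) ^ (1 - κ)) :=
            mul_le_mul_of_nonneg_left h1 (inv_pos.2 (jb_pos _)).le
        _ = C * ((jb (c * t + r))⁻¹ * jb (c * t + r) ^ (1 - κ)) := by ring
        _ = _ := by rw [inv_mul_rpow_sub]; congr 2; ring)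
    ⟨1, one_pos, fun _ _ _ _ _ => by norm_num⟩
  have hδ1 : 0 < 1 + 1 / δ := by positivity
  refine ⟨(1 + 1 / δ) * C, by positivity, fun G u hG hu t x ht hx => ?_⟩
  have hr0 : 0 < ‖x‖ := (mul_pos hδ ht).trans hx
  have h1 := h G u hG hu t x ht (norm_pos_iff.1 hr0) hx
  rw [mul_one] at h1
  -- Far from the axis `⟨x⟩` can be exchanged for a second factor `⟨t + |x|⟩`.
  have h2 : jb (t + ‖x‖) ≤ (1 + 1 / δ) * jb ‖x‖ := by
    refine jb_le_mul_jb (by linarith [div_pos one_pos hδ]) ?_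
    rw [abs_of_pos (by linarith), abs_of_pos hr0, add_mul, one_mul, div_mul_eq_mul_div, one_mul]
    have : t ≤ ‖x‖ / δ := by rw [le_div_iff₀ hδ]; linarith
    linarith
  have h3 := jb_pos (t + ‖x‖)
  have h4 := jb_rpow_nonneg (c * t - ‖x‖) (κ - 1)
  calc jb (t + ‖x‖) ^ 2 * jb (c * t - ‖x‖) ^ (κ - 1) * |dPlus c u (t, x)|
      = jb (t + ‖x‖) * (jb (t + ‖x‖) * jb (c * t - ‖x‖) ^ (κ - 1) * |dPlus c u (t, x)|) := by ring
    _ ≤ ((1 + 1 / δ) * jb ‖x‖) * (jb (t + ‖x‖) * jb (c * t - ‖x‖) ^ (κ - 1)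
          * |dPlus c u (t, x)|) := by gcongr
    _ = (1 + 1 / δ) * (jb ‖x‖ * jb (t + ‖x‖) * jb (c * t - ‖x‖) ^ (κ - 1)
          * |dPlus c u (t, x)|) := by ring
    _ ≤ (1 + 1 / δ) * (C * normA cs κ μ 2 G c t x) := by gcongr
    _ = _ := by ring

/-! ### The homogeneous equation -/

/-- The point of the sphere of radius `c t` about `x`, at time `0`. -/
noncomputable def basePt (c t : ℝ) (x : E3) (b : Fin 3 → E3) (q : ℝ × ℝ) : ℝ × E3 :=
  (0, x + (c * t) • sph b q)

/-- Kirchhoff's solution (up to the factor `4π`) of the homogeneous equation with data given by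
the time-independent functions `f` and `g`. -/
noncomputable def dataPot (c t : ℝ) (x : E3) (b : Fin 3 → E3) (f g : ℝ × E3 → ℝ) : ℝ :=
  ∫ q in angles, Real.sin q.1 * (t * g (basePt c t x b q)
    + c * t * hD f (basePt c t x b q) ((0 : ℝ), sph b q) + f (basePt c t x b q))

theorem basePt_mem (c t : ℝ) (x : E3) (b : Fin 3 → E3) (q : ℝ × ℝ) :
    basePt c t x b q ∈ halfSpace := mem_halfSpace.2 le_rfl

theorem contDiffOn_comp_snd {φ : E3 → ℝ} (hφ : ContDiff ℝ ∞ φ) :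
    ContDiffOn ℝ ∞ (fun p : ℝ × E3 => φ p.2) halfSpace :=
  (hφ.comp contDiff_snd).contDiffOn

theorem hD_comp_snd {φ : E3 → ℝ} (hφ : ContDiff ℝ ∞ φ) {p : ℝ × E3} (hp : p ∈ halfSpace) (a : ℝ)
    (v : E3) : hD (fun p : ℝ × E3 => φ p.2) p (a, v) = fderiv ℝ φ p.2 v := by
  have h1 : HasFDerivAt (fun p : ℝ × E3 => φ p.2)
      ((fderiv ℝ φ p.2).comp (ContinuousLinearMap.snd ℝ ℝ E3)) p :=
    ((hφ.differentiable (by simp)) p.2).hasFDerivAt.comp p hasFDerivAt_snd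
  rw [hD, h1.hasFDerivWithinAt.fderivWithin (uniqueDiffOn_halfSpace p hp)]
  rfl

theorem repr_dataPot {c t : ℝ} (hc : 0 < c) (ht : 0 < t) {φ ψ : E3 → ℝ} {u : ℝ × E3 → ℝ}
    (hφ : ContDiff ℝ ∞ φ) (hu : IsSolution c (fun _ => 0) φ ψ u) (x : E3) {b : Fin 3 → E3}
    (hb : Orthonormal ℝ b) :
    4 * Real.pi * u (t, x)
      = dataPot c t x b (fun p => φ p.2) (fun p => ψ p.2) := by
  rw [kirchhoff hc ht hu.contDiffOn continuousOn_const hu.eqn x hb]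
  simp only [mul_zero, integral_zero, add_zero]
  refine setIntegral_congr_fun isCompact_angles.measurableSet fun q _ => ?_
  simp only [hD_zero_of_init hu (hφ.of_le (by norm_cast)), hu.init, map_smul, smul_eq_mul, basePt]
  rw [hD_comp_snd hφ (mem_halfSpace.2 le_rfl)]
  ring

/-- The commutator of a constant field with `Ω_{jk}` is the derivative along the rotated direction.
This is the term that arises when the normal `sph b q` turns with the frame, so normal derivatives
of the data are covariant too. -/
theorem hD_rot {f : ℝ × E3 → ℝ} (hf : ContDiffOn ℝ 2 f halfSpace) {j k : Fin 3} {t : ℝ}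
    (ht : 0 ≤ t) (y w : E3) :
    hD (rot j k f) (t, y) ((0 : ℝ), w) = hD2 f (t, y) ((0 : ℝ), rotGen j k y) ((0 : ℝ), w)
      + hD f (t, y) ((0 : ℝ), rotGen j k w) := by
  have hl : HasDerivAt (fun s : ℝ => y + s • w) w 0 := by
    simpa using ((hasDerivAt_id (0 : ℝ)).smul_const w).const_add y
  have hl' := (hasDerivAt_const (0 : ℝ) t).prodMk hl
  have hm : ∀ᶠ s in 𝓝 (0 : ℝ), (t, y + s • w) ∈ halfSpace :=
    Eventually.of_forall fun _ => mem_halfSpace.2 ht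
  have hA : HasDerivAt (fun s : ℝ => rotGen j k (y + s • w)) (rotGen j k w) 0 :=
    ((rotGenLin j k).toContinuousLinearMap.hasFDerivAt.comp_hasDerivAt (0 : ℝ) hl)
  have h1 := hasDerivAt_hD_comp_curve hf hl' hm ((hasDerivAt_const (0 : ℝ) (0 : ℝ)).prodMk hA)
  have h2 := hasDerivAt_comp_curve (contDiffOn_rot_one hf j k) hl' hm
  simp only [rot_eq_hD j k f, zero_smul, add_zero] at h1 h2
  have h3 := h2.unique h1
  rw [hD2_symm hf (mem_halfSpace.2 ht) (0, w)] at h3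
  rw [← h3]

theorem basePt_rotMap {j k : Fin 3} (a c t : ℝ) (x : E3) (b : Fin 3 → E3) (q : ℝ × ℝ) :
    basePt c t (rotMap j k a x) (fun i => rotMap j k a (b i)) q
      = (0, rotMap j k a (x + (c * t) • sph b q)) := by
  simp only [basePt, sph_rotMap, rotMap_add, rotMap_smul]

theorem hasDerivAt_dataPot_rotMap {j k : Fin 3} (hjk : j ≠ k) {c t : ℝ} (x : E3)
    (b : Fin 3 → E3) {f g : ℝ × E3 → ℝ} (hf : ContDiffOn ℝ ∞ f halfSpace)
    (hg : ContDiffOn ℝ ∞ g halfSpace) (a : ℝ) :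
    HasDerivAt (fun a => dataPot c t (rotMap j k a x) (fun i => rotMap j k a (b i)) f g)
      (dataPot c t (rotMap j k a x) (fun i => rotMap j k a (b i)) (rot j k f) (rot j k g)) a := by
  have cs := continuous_sph b
  have hcont : ∀ {f g : ℝ × E3 → ℝ}, ContDiffOn ℝ ∞ f halfSpace → ContDiffOn ℝ ∞ g halfSpace →
      ContinuousOn (fun w : ℝ × (ℝ × ℝ) => Real.sin w.2.1 *
        (t * g (basePt c t (rotMap j k w.1 x) (fun i => rotMap j k w.1 (b i)) w.2)
        + c * t * hD f (basePt c t (rotMap j k w.1 x) (fun i => rotMap j k w.1 (b i)) w.2)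
            ((0 : ℝ), sph (fun i => rotMap j k w.1 (b i)) w.2)
        + f (basePt c t (rotMap j k w.1 x) (fun i => rotMap j k w.1 (b i)) w.2)))
        (Icc (a - 1) (a + 1) ×ˢ angles) := by
    intro f g hf hg
    simp only [basePt_rotMap, sph_rotMap]
    have h2 := continuous_rotMap j k
    have hp : Continuous fun w : ℝ × (ℝ × ℝ) =>
        (((0 : ℝ), rotMap j k w.1 (x + (c * t) • sph b w.2)) : ℝ × E3) :=
      continuous_const.prodMk (h2.comp (by fun_prop : Continuous fun w : ℝ × (ℝ × ℝ) =>
        (w.1, x + (c * t) • sph b w.2)))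
    have hw : Continuous fun w : ℝ × (ℝ × ℝ) => (((0 : ℝ), rotMap j k w.1 (sph b w.2)) : ℝ × E3) :=
      continuous_const.prodMk (h2.comp (by fun_prop : Continuous fun w : ℝ × (ℝ × ℝ) =>
        (w.1, sph b w.2)))
    have hm : MapsTo (fun w : ℝ × (ℝ × ℝ) =>
        (((0 : ℝ), rotMap j k w.1 (x + (c * t) • sph b w.2)) : ℝ × E3))
        (Icc (a - 1) (a + 1) ×ˢ angles) halfSpace := fun w _ => mem_halfSpace.2 le_rfl
    exact (by fun_prop : Continuous fun w : ℝ × (ℝ × ℝ) => Real.sin w.2.1).continuousOn.mul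
      (((continuousOn_const.mul (hg.continuousOn.comp hp.continuousOn hm)).add
        (continuousOn_const.mul (continuousOn_hD_comp (hf.of_le (by norm_cast)) hp.continuousOn hm
          hw.continuousOn))).add (hf.continuousOn.comp hp.continuousOn hm))
  have h2 : (2 : ℕ∞ω) ≤ ∞ := by norm_cast
  refine hasDerivAt_setIntegral_of_isCompact (F := fun a q => Real.sin q.1 *
        (t * g (basePt c t (rotMap j k a x) (fun i => rotMap j k a (b i)) q)
        + c * t * hD f (basePt c t (rotMap j k a x) (fun i => rotMap j k a (b i)) q)
            ((0 : ℝ), sph (fun i => rotMap j k a (b i)) q)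
        + f (basePt c t (rotMap j k a x) (fun i => rotMap j k a (b i)) q)))
    (F' := fun a q => Real.sin q.1 *
        (t * rot j k g (basePt c t (rotMap j k a x) (fun i => rotMap j k a (b i)) q)
        + c * t * hD (rot j k f) (basePt c t (rotMap j k a x) (fun i => rotMap j k a (b i)) q)
            ((0 : ℝ), sph (fun i => rotMap j k a (b i)) q)
        + rot j k f (basePt c t (rotMap j k a x) (fun i => rotMap j k a (b i)) q)))
    isCompact_angles one_pos (hcont hf hg) (hcont (contDiffOn_rot hf j k) (contDiffOn_rot hg j k))
    fun a' _ q _ _ => ?_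
  simp only [basePt_rotMap, sph_rotMap]
  have d1 := hasDerivAt_comp_rotMap (hg.of_le (by norm_cast)) hjk le_rfl a' (x + (c * t) • sph b q)
  have d2 := hasDerivAt_comp_rotMap (hf.of_le (by norm_cast)) hjk le_rfl a' (x + (c * t) • sph b q)
  have d3 := hasDerivAt_hD_comp_curve (hf.of_le h2) ((hasDerivAt_const a' (0 : ℝ)).prodMk
    (hasDerivAt_rotMap hjk a' (x + (c * t) • sph b q))) (Eventually.of_forall fun _ =>
      mem_halfSpace.2 le_rfl) ((hasDerivAt_const a' (0 : ℝ)).prodMk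
    (hasDerivAt_rotMap hjk a' (sph b q)))
  rw [← hD_rot (hf.of_le h2) le_rfl] at d3
  exact (((d1.const_mul t).fun_add (d3.const_mul (c * t))).fun_add d2).const_mul _

theorem repr_data_rot_rot {c t : ℝ} (hc : 0 < c) (ht : 0 < t) {φ ψ : E3 → ℝ} {u : ℝ × E3 → ℝ}
    (hφ : ContDiff ℝ ∞ φ) (hψ : ContDiff ℝ ∞ ψ) (hu : IsSolution c (fun _ => 0) φ ψ u) (x : E3)
    {b : Fin 3 → E3} (hb : Orthonormal ℝ b) {j k : Fin 3} (hjk : j ≠ k) :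
    4 * Real.pi * rot j k (rot j k u) (t, x)
      = dataPot c t x b (rot j k (rot j k fun p => φ p.2)) (rot j k (rot j k fun p => ψ p.2)) := by
  have hf := contDiffOn_comp_snd hφ
  have hg := contDiffOn_comp_snd hψ
  have h := hasDerivAt_dataPot_rotMap hjk x b (c := c) (t := t) (contDiffOn_rot hf j k)
    (contDiffOn_rot hg j k) 0
  simp only [rotMap_zero] at h
  exact rot_rot_eq_of_repr hu.contDiffOn hjk ht.le x
    (fun a => repr_dataPot hc ht hφ hu _ (orthonormal_rotMap hjk a hb))
    (hasDerivAt_dataPot_rotMap hjk x b hf hg) h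

/-- The density which controls the data. -/
noncomputable def dataDensity (φ ψ : E3 → ℝ) (y : E3) : ℝ := zNormData 3 φ y + zNormData 2 ψ y

theorem dataDensity_nonneg (φ ψ : E3 → ℝ) (y : E3) : 0 ≤ dataDensity φ ψ y :=
  add_nonneg (zNorm_nonneg _ _ _) (zNorm_nonneg _ _ _)

theorem continuous_dataDensity {φ ψ : E3 → ℝ} (hφ : ContDiff ℝ ∞ φ) (hψ : ContDiff ℝ ∞ ψ) :
    Continuous (dataDensity φ ψ) := by
  have h : ∀ {χ : E3 → ℝ} (s : ℕ), ContDiff ℝ ∞ χ → Continuous (zNormData s χ) := by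
    intro χ s hχ
    exact continuousOn_univ.1 ((continuousOn_zNorm (contDiffOn_comp_snd hχ) s).comp
      (by fun_prop : Continuous fun y : E3 => ((0 : ℝ), y)).continuousOn
      fun y _ => mem_halfSpace.2 le_rfl)
  exact (h 3 hφ).add (h 2 hψ)

theorem zNormData_le_dataDensity (φ ψ : E3 → ℝ) (y : E3) :
    zNorm 3 (fun p => φ p.2) (0, y) ≤ dataDensity φ ψ y ∧
      zNorm 2 (fun p => ψ p.2) (0, y) ≤ dataDensity φ ψ y :=
  ⟨le_add_of_nonneg_right (zNorm_nonneg _ _ _), le_add_of_nonneg_left (zNorm_nonneg _ _ _)⟩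

theorem abs_integral_angles_le {F : ℝ × ℝ → ℝ} {Z : E3 → ℝ} {c t K : ℝ} {x : E3} {b : Fin 3 → E3}
    (hF : ContinuousOn F angles) (hZ : Continuous Z)
    (h : ∀ q ∈ angles, |F q| ≤ K * |Z (x + (c * t) • sph b q)|) :
    |∫ q in angles, Real.sin q.1 * F q| ≤ K * ∫ q in angles, Real.sin q.1
      * |Z (x + (c * t) • sph b q)| := by
  have cs := continuous_sph b
  have hsin : Continuous fun q : ℝ × ℝ => Real.sin q.1 := by fun_prop
  rw [← integral_const_mul]
  refine abs_integral_le_integral_abs.trans (setIntegral_mono_on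
    ((hsin.continuousOn.mul hF).abs.integrableOn_compact isCompact_angles) ?_
    isCompact_angles.measurableSet fun q hq => ?_)
  · refine (Continuous.continuousOn ?_).integrableOn_compact isCompact_angles
    fun_prop
  · have hs := sin_nonneg_of_mem_angles hq
    rw [abs_mul, abs_of_nonneg hs, mul_left_comm]
    exact mul_le_mul_of_nonneg_left (h q hq) hs

theorem zField_succ_eq_dx (i : Fin 3) : zField ⟨i + 1, by omega⟩ = dx i := by
  fin_cases i <;> rfl

theorem abs_dx_dx_le_zNorm {s : ℕ} (hs : 2 ≤ s) {f : ℝ × E3 → ℝ} (hf : ContDiffOn ℝ 2 f halfSpace)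
    {p : ℝ × E3} (hp : p ∈ halfSpace) (i j : Fin 3) :
    |hD2 f p ((0 : ℝ), EuclideanSpace.single i 1) ((0 : ℝ), EuclideanSpace.single j 1)|
      ≤ zNorm s f p := by
  have key : ∀ i j : Fin 3, i ≤ j →
      |hD2 f p ((0 : ℝ), EuclideanSpace.single i 1) ((0 : ℝ), EuclideanSpace.single j 1)|
        ≤ zNorm s f p := by
    intro i j hij
    rw [← hD_hD_apply hf hp]
    change |dx i (dx j f) p| ≤ _
    rcases hij.eq_or_lt with rfl | hij
    · have := abs_zField_iterate_le_zNorm f p ⟨i + 1, by omega⟩ (n := 2) hs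
      rwa [zField_succ_eq_dx] at this
    · have := abs_zField_comp_le_zNorm f p (i := ⟨i + 1, by omega⟩) (j := ⟨j + 1, by omega⟩)
        (by simpa using hij) (m := 1) (n := 1) hs
      rwa [zField_succ_eq_dx, zField_succ_eq_dx] at this
  rcases le_total i j with h | h
  · exact key i j h
  · rw [hD2_symm hf hp]; exact key j i h

theorem abs_hD2_le_zNorm {s : ℕ} (hs : 2 ≤ s) {f : ℝ × E3 → ℝ} (hf : ContDiffOn ℝ 2 f halfSpace)
    {p : ℝ × E3} (hp : p ∈ halfSpace) (v w : E3) :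
    |hD2 f p ((0 : ℝ), v) ((0 : ℝ), w)| ≤ 9 * ‖v‖ * ‖w‖ * zNorm s f p := by
  have hdec : ∀ v : E3, ((0 : ℝ), v)
      = ∑ j, v j • ((0 : ℝ), (EuclideanSpace.single j (1 : ℝ) : E3)) := by
    intro v
    refine Prod.ext (by simp [Fin.sum_univ_three]) ?_
    ext i; fin_cases i <;> simp [Fin.sum_univ_three]
  have hsum : hD2 f p ((0 : ℝ), v) ((0 : ℝ), w) = ∑ i, ∑ j, v i * (w j *
      hD2 f p ((0 : ℝ), EuclideanSpace.single i 1) ((0 : ℝ), EuclideanSpace.single j 1)) := by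
    rw [hdec v, map_sum, sum_apply]
    refine Finset.sum_congr rfl fun i _ => ?_
    rw [map_smul, smul_apply, hdec w, map_sum, Finset.smul_sum]
    simp only [map_smul, smul_eq_mul]
  have hz := zNorm_nonneg s f p
  rw [hsum]
  refine (Finset.abs_sum_le_sum_abs _ _).trans ((Finset.sum_le_sum fun i _ =>
    (Finset.abs_sum_le_sum_abs _ _).trans (Finset.sum_le_sum fun j _ =>
      (?_ : _ ≤ ‖v‖ * (‖w‖ * zNorm s f p)))).trans (le_of_eq ?_))
  · rw [abs_mul, abs_mul]
    exact mul_le_mul (PiLp.norm_apply_le v i) (mul_le_mul (PiLp.norm_apply_le w j)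
      (abs_dx_dx_le_zNorm hs hf hp i j) (abs_nonneg _) (norm_nonneg _)) (by positivity)
      (norm_nonneg _)
  · simp; ring

/-- This is the place where the rotational estimate needs three derivatives of `φ`. The translations
precede the rotations in the list of fields, so `∂_i Ω_{jk}²` already has the order of `Z^α`. -/
theorem abs_hD_rot_rot_le_zNorm {s : ℕ} (hs : 3 ≤ s) (f : ℝ × E3 → ℝ) (p : ℝ × E3) {j k : Fin 3}
    (hjk : j < k) (v : E3) : |hD (rot j k (rot j k f)) p ((0 : ℝ), v)| ≤ 3 * ‖v‖ * zNorm s f p := by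
  have hj : ∀ i, |dx i (rot j k (rot j k f)) p| ≤ zNorm s f p := by
    intro i
    have h4 : ∀ l : Fin 7, 4 ≤ l → |dx i ((zField l)^[2] f) p| ≤ zNorm s f p := by
      intro l hl
      have := abs_zField_comp_le_zNorm f p (i := ⟨i + 1, by omega⟩) (j := l)
        (lt_of_lt_of_le (Fin.mk_lt_of_lt_val (by simp; omega)) hl) (m := 1) (n := 2) hs
      rwa [zField_succ_eq_dx] at this
    fin_cases j <;> fin_cases k <;> first | (exfalso; revert hjk; decide) | skip
    · exact h4 4 (by decide)
    · exact h4 5 (by decide)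
    · exact h4 6 (by decide)
  have hv : ∀ i, |v i * dx i (rot j k (rot j k f)) p| ≤ ‖v‖ * zNorm s f p := by
    intro i
    rw [abs_mul]
    exact mul_le_mul (PiLp.norm_apply_le v i) (hj i) (abs_nonneg _) (norm_nonneg _)
  rw [hD_eq_sum, zero_mul, zero_add]
  refine (Finset.abs_sum_le_sum_abs _ _).trans ((Finset.sum_le_sum fun i _ => hv i).trans
    (le_of_eq ?_))
  simp; ring

/-! ### Bounds by spherical means of the data -/

section Data

variable {c t : ℝ} {φ ψ : E3 → ℝ} {u : ℝ × E3 → ℝ}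

theorem continuousOn_dataPot_integrand (c t : ℝ) (x : E3) (b : Fin 3 → E3) {f g : ℝ × E3 → ℝ}
    (hf : ContDiffOn ℝ 2 f halfSpace) (hg : ContinuousOn g halfSpace) :
    ContinuousOn (fun q => t * g (basePt c t x b q)
      + c * t * hD f (basePt c t x b q) ((0 : ℝ), sph b q) + f (basePt c t x b q)) angles := by
  have cs := continuous_sph b
  have hp : Continuous (basePt c t x b) := by unfold basePt; fun_prop
  have hm : MapsTo (basePt c t x b) angles halfSpace := fun q _ => basePt_mem c t x b q
  exact ((continuousOn_const.mul (hg.comp hp.continuousOn hm)).add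
    (continuousOn_const.mul (continuousOn_hD_comp hf hp.continuousOn hm
      (by fun_prop : Continuous fun q => (((0 : ℝ), sph b q) : ℝ × E3)).continuousOn))).add
    (hf.continuousOn.comp hp.continuousOn hm)

theorem abs_dataPot_le (hc : 0 < c) (ht : 0 < t) (x : E3) {b : Fin 3 → E3} {f g : ℝ × E3 → ℝ}
    (hf : ContDiffOn ℝ 2 f halfSpace) (hg : ContinuousOn g halfSpace) {Z : E3 → ℝ}
    (hZ : Continuous Z) (hfZ : ∀ y, |f (0, y)| ≤ Z y)
    (hDZ : ∀ y q, |hD f (0, y) ((0 : ℝ), sph b q)| ≤ 3 * Z y) (hgZ : ∀ y, |g (0, y)| ≤ Z y) :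
    |dataPot c t x b f g| ≤ (1 + 3 * c) * ((1 + t) * ∫ q in angles, Real.sin q.1
      * |Z (x + (c * t) • sph b q)|) := by
  rw [← mul_assoc]
  refine abs_integral_angles_le (continuousOn_dataPot_integrand c t x b hf hg) hZ fun q _ => ?_
  set y := x + (c * t) • sph b q
  have hZ0 : 0 ≤ Z y := (abs_nonneg _).trans (hfZ y)
  have hct := mul_pos hc ht
  rw [abs_of_nonneg hZ0]
  refine (abs_add_three _ _ _).trans ?_
  rw [abs_mul, abs_mul, abs_of_pos ht, abs_of_pos hct]
  have h1 := mul_le_mul_of_nonneg_left (hgZ y) ht.le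
  have h2 := mul_le_mul_of_nonneg_left (hDZ y q) hct.le
  have h3 := hfZ y
  have h4 := mul_nonneg hc.le hZ0
  simp only [basePt]
  calc _ ≤ t * Z y + c * t * (3 * Z y) + Z y := add_le_add_three h1 h2 h3
    _ ≤ _ := by linarith

theorem abs_sol_le_data (hc : 0 < c) (ht : 0 < t) (hφ : ContDiff ℝ ∞ φ) (hψ : ContDiff ℝ ∞ ψ)
    (hu : IsSolution c (fun _ => 0) φ ψ u) (x : E3) {b : Fin 3 → E3} (hb : Orthonormal ℝ b) :
    |u (t, x)| ≤ (1 + 3 * c) * ((1 + t) * ∫ q in angles, Real.sin q.1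
      * |dataDensity φ ψ (x + (c * t) • sph b q)|) := by
  refine (abs_le_of_four_pi_mul_eq (repr_dataPot hc ht hφ hu x hb)).trans
    (abs_dataPot_le hc ht x ((contDiffOn_comp_snd hφ).of_le (by norm_cast))
      (contDiffOn_comp_snd hψ).continuousOn (continuous_dataDensity hφ hψ) (fun y => ?_)
      (fun y q => ?_) fun y => ?_)
  · exact (abs_zField_iterate_le_zNorm (fun p : ℝ × E3 => φ p.2) (0, y) 0 (n := 0)
      (by norm_num)).trans (zNormData_le_dataDensity φ ψ y).1
  · refine (abs_hD_le_zNorm _ _ _ _ (s := 3) (by norm_num)).trans ?_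
    rw [norm_sph hb, abs_zero, zero_add, mul_one]
    exact mul_le_mul_of_nonneg_left (zNormData_le_dataDensity φ ψ y).1 (by norm_num)
  · exact (abs_zField_iterate_le_zNorm (fun p : ℝ × E3 => ψ p.2) (0, y) 0 (n := 0)
      (by norm_num)).trans (zNormData_le_dataDensity φ ψ y).2

theorem abs_rot_rot_le_data (hc : 0 < c) (ht : 0 < t) (hφ : ContDiff ℝ ∞ φ) (hψ : ContDiff ℝ ∞ ψ)
    (hu : IsSolution c (fun _ => 0) φ ψ u) (x : E3) {b : Fin 3 → E3} (hb : Orthonormal ℝ b)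
    {j k : Fin 3} (hjk : j < k) :
    |rot j k (rot j k u) (t, x)| ≤ (1 + 3 * c) * ((1 + t) * ∫ q in angles, Real.sin q.1
      * |dataDensity φ ψ (x + (c * t) • sph b q)|) := by
  refine (abs_le_of_four_pi_mul_eq (repr_data_rot_rot hc ht hφ hψ hu x hb hjk.ne)).trans
    (abs_dataPot_le hc ht x ((contDiffOn_rot (contDiffOn_rot (contDiffOn_comp_snd hφ) j k) j
      k).of_le (by norm_cast)) (contDiffOn_rot (contDiffOn_rot (contDiffOn_comp_snd hψ) j k) j
      k).continuousOn (continuous_dataDensity hφ hψ) (fun y => ?_) (fun y q => ?_) fun y => ?_)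
  · exact (abs_rot_rot_le_zNorm (by norm_num) _ _ hjk).trans (zNormData_le_dataDensity φ ψ y).1
  · refine (abs_hD_rot_rot_le_zNorm (s := 3) le_rfl _ _ hjk _).trans ?_
    rw [norm_sph hb, mul_one]
    exact mul_le_mul_of_nonneg_left (zNormData_le_dataDensity φ ψ y).1 (by norm_num)
  · exact (abs_rot_rot_le_zNorm le_rfl _ _ hjk).trans (zNormData_le_dataDensity φ ψ y).2

/-- The derivative of a solution of the homogeneous equation in a null direction. -/
theorem abs_dPlus_le_data (hc : 0 < c) (ht : 0 < t) (hφ : ContDiff ℝ ∞ φ) (hψ : ContDiff ℝ ∞ ψ)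
    (hu : IsSolution c (fun _ => 0) φ ψ u) {x : E3} (hx : x ≠ 0) {b : Fin 3 → E3}
    (hb : Orthonormal ℝ b) :
    |dPlus c u (t, x)| ≤ (1 + 9 * c + 18 * c ^ 2) * ((1 + t) * ∫ q in angles, Real.sin q.1
      * |dataDensity φ ψ (x + (c * t) • sph b q)|) := by
  set e : E3 := ‖x‖⁻¹ • x with he
  have hen : ‖e‖ = 1 := by
    rw [he, norm_smul, norm_inv, norm_norm, inv_mul_cancel₀ (norm_ne_zero_iff.2 hx)]
  have cs := continuous_sph b
  set f : ℝ × E3 → ℝ := fun p => φ p.2 with hfdef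
  set g : ℝ × E3 → ℝ := fun p => ψ p.2 with hgdef
  have hf : ContDiffOn ℝ ∞ f halfSpace := contDiffOn_comp_snd hφ
  have hg : ContDiffOn ℝ ∞ g halfSpace := contDiffOn_comp_snd hψ
  have h12 : (1 : ℕ∞ω) ≤ ∞ := by norm_cast
  have h22 : (2 : ℕ∞ω) ≤ ∞ := by norm_cast
  -- The apex again moves along `(1, c e)`. The base point moves with velocity `c e + c ν`, of norm
  -- at most `2c`, and differentiating the normal derivative of `φ` brings in its Hessian.
  set P : ℝ → ℝ × ℝ → ℝ × E3 := fun h q => basePt c (t + h) (x + (c * h) • e) b q with hP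
  set V : ℝ × ℝ → ℝ × E3 := fun q => (0, c • e + c • sph b q) with hV
  set S : ℝ × ℝ → ℝ × E3 := fun q => (0, sph b q) with hS
  set F : ℝ → ℝ × ℝ → ℝ := fun h q => Real.sin q.1 * ((t + h) * g (P h q)
    + c * (t + h) * hD f (P h q) (S q) + f (P h q)) with hF
  set D : ℝ → ℝ × ℝ → ℝ := fun h q => (g (P h q) + (t + h) * hD g (P h q) (V q))
    + (c * hD f (P h q) (S q) + c * (t + h) * hD2 f (P h q) (V q) (S q)) + hD f (P h q) (V q) with hD'
  set F' : ℝ → ℝ × ℝ → ℝ := fun h q => Real.sin q.1 * D h q with hF'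
  have hPc : Continuous fun w : ℝ × (ℝ × ℝ) => P w.1 w.2 := by
    simp only [hP, basePt]; fun_prop
  have hVc : Continuous V := by rw [hV]; fun_prop
  have hSc : Continuous S := by rw [hS]; fun_prop
  have hmem : ∀ h q, P h q ∈ halfSpace := fun h q => basePt_mem _ _ _ _ _
  have hm : MapsTo (fun w : ℝ × (ℝ × ℝ) => P w.1 w.2) (Icc (0 - t / 2) (0 + t / 2) ×ˢ angles)
      halfSpace := fun w _ => hmem _ _
  have hfP := hf.continuousOn.comp hPc.continuousOn hm
  have hgP := hg.continuousOn.comp hPc.continuousOn hm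
  have hgV := continuousOn_hD_comp (hg.of_le h22) hPc.continuousOn hm
    (hVc.comp continuous_snd).continuousOn
  have hfV := continuousOn_hD_comp (hf.of_le h22) hPc.continuousOn hm
    (hVc.comp continuous_snd).continuousOn
  have hfS := continuousOn_hD_comp (hf.of_le h22) hPc.continuousOn hm
    (hSc.comp continuous_snd).continuousOn
  have hfVS := continuousOn_hD2_comp (hf.of_le h22) hPc.continuousOn hm
    (hVc.comp continuous_snd).continuousOn (hSc.comp continuous_snd).continuousOn
  have hth : ContinuousOn (fun w : ℝ × (ℝ × ℝ) => t + w.1)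
    (Icc (0 - t / 2) (0 + t / 2) ×ˢ angles) := by fun_prop
  have hsin : ContinuousOn (fun w : ℝ × (ℝ × ℝ) => Real.sin w.2.1)
    (Icc (0 - t / 2) (0 + t / 2) ×ˢ angles) := by fun_prop
  have hFc : ContinuousOn (fun w : ℝ × (ℝ × ℝ) => F w.1 w.2)
      (Icc (0 - t / 2) (0 + t / 2) ×ˢ angles) :=
    hsin.mul (((hth.mul hgP).add ((continuousOn_const.mul hth).mul hfS)).add hfP)
  have hDc : ContinuousOn (fun w : ℝ × (ℝ × ℝ) => D w.1 w.2)
      (Icc (0 - t / 2) (0 + t / 2) ×ˢ angles) :=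
    ((hgP.add (hth.mul hgV)).add ((continuousOn_const.mul hfS).add
      ((continuousOn_const.mul hth).mul hfVS))).add hfV
  have hder : HasDerivAt (fun h => ∫ q in angles, F h q) (∫ q in angles, F' 0 q) 0 := by
    refine hasDerivAt_setIntegral_of_isCompact isCompact_angles (half_pos ht) hFc (hsin.mul hDc) ?_
    intro h _ q _ _
    have h1 : HasDerivAt (fun h : ℝ => t + h) 1 h := (hasDerivAt_id h).const_add t
    have h1' : HasDerivAt (fun h : ℝ => c * (t + h)) c h := by simpa using h1.const_mul c
    have h2 : HasDerivAt (fun h => P h q) (V q) h := by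
      have a2 : HasDerivAt (fun h : ℝ => c * h) c h := by simpa using (hasDerivAt_id h).const_mul c
      exact (hasDerivAt_const h (0 : ℝ)).prodMk
        (((a2.smul_const e).const_add x).fun_add (h1'.smul_const (sph b q)))
    have hev : ∀ᶠ h in 𝓝 h, P h q ∈ halfSpace := Eventually.of_forall fun h => hmem h q
    have d1 := hasDerivAt_comp_curve (hg.of_le h12) h2 hev
    have d2 := hasDerivAt_comp_curve (hf.of_le h12) h2 hev
    have d3 := hasDerivAt_hD_comp_curve (hf.of_le h22) h2 hev (hasDerivAt_const h (S q))
    rw [map_zero, add_zero] at d3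
    have := (((h1.fun_mul d1).fun_add (h1'.fun_mul d3)).fun_add d2).const_mul (Real.sin q.1)
    rw [one_mul] at this
    exact this
  have hcurve : HasDerivAt (fun h : ℝ => (t + h, x + (c * h) • e)) (1, c • e) 0 := by
    have h1 : HasDerivAt (fun h : ℝ => t + h) 1 0 := (hasDerivAt_id (0 : ℝ)).const_add t
    have a2 : HasDerivAt (fun h : ℝ => c * h) c 0 := by
      simpa using (hasDerivAt_id (0 : ℝ)).const_mul c
    exact h1.prodMk ((a2.smul_const e).const_add x)
  have hev : ∀ᶠ h : ℝ in 𝓝 0, 0 < t + h := by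
    filter_upwards [Ioi_mem_nhds (neg_lt_zero.2 ht)] with h hh
    have : -t < h := hh
    linarith
  have h5 := (hasDerivAt_comp_curve (hu.contDiffOn.of_le one_le_two) hcurve
    (hev.mono fun h hh => mem_halfSpace.2 hh.le)).const_mul (4 * Real.pi)
  have h6 : (fun h : ℝ => 4 * Real.pi * u (t + h, x + (c * h) • e))
      =ᶠ[𝓝 0] fun h => ∫ q in angles, F h q :=
    hev.mono fun h hh => repr_dataPot hc hh hφ hu _ hb
  have h7 := h5.unique (hder.congr_of_eventuallyEq h6)
  simp only [add_zero, mul_zero, zero_smul] at h7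
  rw [← dPlus_eq_hD] at h7
  have h0 : (0 : ℝ) ∈ Icc (0 - t / 2) (0 + t / 2) := ⟨by linarith, by linarith⟩
  have hD0 : ContinuousOn (D 0) angles := by
    have hi : ContinuousOn (fun q : ℝ × ℝ => ((0 : ℝ), q)) angles := by fun_prop
    exact ContinuousOn.comp (g := fun w : ℝ × (ℝ × ℝ) => D w.1 w.2) (f := fun q => (0, q)) hDc hi
      fun q hq => ⟨h0, hq⟩
  clear_value F F' D
  simp only [hF'] at h7
  suffices hpt : ∀ q ∈ angles, |D 0 q| ≤ ((1 + 9 * c + 18 * c ^ 2) * (1 + t)) *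
      |dataDensity φ ψ (x + (c * t) • sph b q)| by
    rw [← mul_assoc]
    exact (abs_le_of_four_pi_mul_eq h7).trans
      (abs_integral_angles_le hD0 (continuous_dataDensity hφ hψ) hpt)
  intro q _
  have hP0 : P 0 q = (0, x + (c * t) • sph b q) := by simp [hP, basePt]
  generalize x + (c * t) • sph b q = y at hP0 ⊢
  obtain ⟨hZf, hZg⟩ := zNormData_le_dataDensity φ ψ y
  have hZ0 := dataDensity_nonneg φ ψ y
  generalize dataDensity φ ψ y = Z at *
  have hp : ((0 : ℝ), y) ∈ halfSpace := mem_halfSpace.2 le_rfl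
  have hVn : ‖c • e + c • sph b q‖ ≤ 2 * c := by
    refine (norm_add_le _ _).trans ?_
    rw [norm_smul c e, norm_smul c (sph b q), hen, norm_sph hb, Real.norm_eq_abs, abs_of_pos hc]
    linarith
  have b1 : |g (0, y)| ≤ Z :=
    (abs_zField_iterate_le_zNorm g (0, y) 0 (n := 0) (by norm_num)).trans hZg
  have bV : ∀ {s : ℕ} {f : ℝ × E3 → ℝ}, 1 ≤ s → zNorm s f (0, y) ≤ Z →
      |hD f (0, y) (V q)| ≤ 6 * c * Z := by
    intro s f hs hZ
    refine (abs_hD_le_zNorm f _ _ _ hs).trans ?_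
    rw [abs_zero, zero_add]
    exact mul_le_mul (by linarith) hZ (zNorm_nonneg _ _ _) (by positivity)
  have b3 : |hD f (0, y) (S q)| ≤ 3 * Z := by
    refine (abs_hD_le_zNorm f _ _ _ (s := 3) (by norm_num)).trans ?_
    rw [abs_zero, zero_add, norm_sph hb, mul_one]
    exact mul_le_mul_of_nonneg_left hZf (by norm_num)
  have b4 : |hD2 f (0, y) (V q) (S q)| ≤ 18 * c * Z := by
    refine (abs_hD2_le_zNorm (s := 3) (by norm_num) (hf.of_le h22) hp _ _).trans ?_
    rw [norm_sph hb, mul_one]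
    exact mul_le_mul (by linarith) hZf (zNorm_nonneg _ _ _) (by positivity)
  have b2 := bV (by norm_num) hZg
  have b5 := bV (by norm_num) hZf
  simp only [hD', hP0, add_zero]
  have hct := mul_pos hc ht
  have a2 : |t * hD g (0, y) (V q)| ≤ t * (6 * c * Z) := by
    rw [abs_mul, abs_of_pos ht]; gcongr
  have a3 : |c * hD f (0, y) (S q)| ≤ c * (3 * Z) := by
    rw [abs_mul, abs_of_pos hc]; gcongr
  have a4 : |c * t * hD2 f (0, y) (V q) (S q)| ≤ c * t * (18 * c * Z) := by
    rw [abs_mul, abs_of_pos hct]; gcongr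
  rw [abs_of_nonneg hZ0]
  have hcZ := mul_nonneg hc.le hZ0
  have htZ := mul_nonneg ht.le hZ0
  have hctZ := mul_nonneg hct.le hZ0
  have hccZ := mul_nonneg hc.le hcZ
  calc _ ≤ (|g (0, y)| + |t * hD g (0, y) (V q)|)
        + (|c * hD f (0, y) (S q)| + |c * t * hD2 f (0, y) (V q) (S q)|) + |hD f (0, y) (V q)| :=
        (abs_add_three _ _ _).trans (add_le_add (add_le_add (abs_add_le _ _) (abs_add_le _ _)) le_rfl)
    -- The constant `9c` collects `3c` from the normal derivative and `6c` from moving the base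
    -- point; `18c²` comes from the Hessian term.
    _ ≤ (Z + t * (6 * c * Z)) + (c * (3 * Z) + c * t * (18 * c * Z)) + 6 * c * Z := by
        linarith
    _ ≤ _ := by nlinarith

end Data

theorem jb_rpow_le_jb_rpow (a : ℝ) {m n : ℝ} (h : m ≤ n) : jb a ^ m ≤ jb a ^ n :=
  Real.rpow_le_rpow_of_exponent_le (one_le_jb a) h

theorem add_smul_sph_mem_coneBase {c t : ℝ} (hct : 0 ≤ c * t) (x : E3) {b : Fin 3 → E3}
    (hb : Orthonormal ℝ b) (q : ℝ × ℝ) : x + (c * t) • sph b q ∈ coneBase c t x := by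
  simp only [coneBase, mem_ofPred_eq, add_sub_cancel_left, norm_smul, norm_sph hb, Real.norm_eq_abs,
    abs_of_nonneg hct, mul_one, le_refl]

theorem coneBase_subset {c t τ : ℝ} {x y : E3} (h : (τ, y) ∈ cone c t x) :
    coneBase c τ y ⊆ coneBase c t x := by
  intro z hz
  obtain ⟨-, -, h3⟩ := h
  have : z - x = (z - y) + (y - x) := by abel
  calc ‖z - x‖ ≤ ‖z - y‖ + ‖y - x‖ := by rw [this]; exact norm_add_le _ _
    _ ≤ c * τ + c * (t - τ) := add_le_add hz h3
    _ = c * t := by ring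

/-- Spherical means of functions which decay at infinity. -/
theorem spherical_integral_le {c : ℝ} (hc : 0 < c) {k : ℝ} (hk : 1 < k) :
    ∃ C : ℝ, 0 < C ∧ ∀ (Z : E3 → ℝ) (t : ℝ) (x : E3) (b : Fin 3 → E3) (B : ℝ), Continuous Z →
      0 < t → x ≠ 0 → Orthonormal ℝ b → b 2 = ‖x‖⁻¹ • x → 0 ≤ B →
      (∀ y ∈ coneBase c t x, |Z y| ≤ B * jb ‖y‖ ^ (-(k + 1))) →
      (1 + t) * ∫ q in angles, Real.sin q.1 * |Z (x + (c * t) • sph b q)|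
        ≤ C * B * ((jb (t + ‖x‖))⁻¹ * jb (c * t - ‖x‖) ^ (1 - k)) := by
  obtain ⟨C₀, hC₀, hrad⟩ := radial_bound_of_one_lt hc hk
  have hpi := Real.pi_pos
  have hm : 0 < 2 + c := by linarith
  set C₁ := 4 * Real.pi / c * C₀ with hC₁
  set C₂ := 8 * Real.pi * ((2 + c) ^ (k + 1) * (3 * (2 + c) ^ (k - 1))) with hC₂
  have hC₁0 : 0 < C₁ := by positivity
  have hC₂0 : 0 < C₂ := by positivity
  refine ⟨C₁ + C₂, by positivity, ?_⟩
  intro Z t x b B hZ ht hx hb hb2 hB h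
  set r := ‖x‖ with hr
  have hr0 : 0 < r := norm_pos_iff.2 hx
  have hct : 0 < c * t := mul_pos hc ht
  have hmem := add_smul_sph_mem_coneBase hct.le x hb
  have cs := continuous_sph b
  have hE : 0 ≤ (jb (t + r))⁻¹ * jb (c * t - r) ^ (1 - k) :=
    mul_nonneg (inv_pos.2 (jb_pos _)).le (jb_rpow_nonneg _ _)
  set E := (jb (t + r))⁻¹ * jb (c * t - r) ^ (1 - k) with hEdef
  have hZc : Continuous fun q : ℝ × ℝ => Z (x + (c * t) • sph b q) := by fun_prop
  rw [mul_assoc (C₁ + C₂), add_mul C₁]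
  have hBE : 0 ≤ B * E := mul_nonneg hB hE
  -- For `t ≥ 1` the hat-box theorem applies; it spends one power of `⟨y⟩`, and its `t⁻¹` cancels `1
  -- + t`. For `t ≤ 1` that `t⁻¹` would be too large, but the sphere has radius at most `c`, so
  -- `⟨y⟩` is bounded below by a multiple of `⟨x⟩` and a pointwise bound suffices.
  rcases le_total 1 t with h1 | h1
  · have hx2 : x = r • b 2 := by rw [hb2, smul_smul, mul_inv_cancel₀ hr0.ne', one_smul]
    have hI := integral_sphere_le hb hr0 hct (f := Z) (Hh := fun l => B * jb l ^ (-k))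
      (continuous_const.mul (continuous_jb_rpow _)) (by rw [← hx2]; exact hZc.continuousOn) (by
        intro q _
        rw [← hx2]
        set y := x + (c * t) • sph b q
        have e : jb ‖y‖ ^ (-k) = jb ‖y‖ * jb ‖y‖ ^ (-(k + 1)) := by
          nth_rewrite 2 [← Real.rpow_one (jb ‖y‖)]
          rw [← Real.rpow_add (jb_pos _)]
          congr 1; ring
        rw [e, mul_left_comm]
        have h2 := abs_le_jb ‖y‖
        rw [abs_norm] at h2
        exact mul_le_mul h2 (h y (hmem q)) (abs_nonneg _) (jb_pos _).le)
    rw [← hx2, intervalIntegral.integral_const_mul, abs_sub_comm] at hI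
    have h2 := hrad t r ht hr0
    have h3 : (1 + t) / t ≤ 2 := by rw [div_le_iff₀ ht]; linarith
    have h4 : 0 ≤ B * (C₀ * E) := mul_nonneg hB (mul_nonneg hC₀.le hE)
    calc _ ≤ (1 + t) * (2 * Real.pi / (r * (c * t)) * (B * ∫ l in |c * t - r|..(r + c * t),
            jb l ^ (-k))) := mul_le_mul_of_nonneg_left hI (by linarith)
      _ = (1 + t) / t * (2 * Real.pi / c) * (B * (r⁻¹ * ∫ l in |c * t - r|..(c * t + r),
            jb l ^ (-k))) := by rw [add_comm r]; field_simp
      _ ≤ (1 + t) / t * (2 * Real.pi / c) * (B * (C₀ * E)) := by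
          refine mul_le_mul_of_nonneg_left (mul_le_mul_of_nonneg_left h2 hB) (by positivity)
      _ ≤ 2 * (2 * Real.pi / c) * (B * (C₀ * E)) := by gcongr
      _ = C₁ * (B * E) := by rw [hC₁]; ring
      _ ≤ _ := le_add_of_nonneg_right (mul_nonneg hC₂0.le hBE)
  · have hjr := one_add_le_two_mul_jb hr0.le
    have hj1 := one_le_jb r
    have hrj := abs_le_jb r
    rw [abs_of_pos hr0] at hrj
    have hctc : c * t ≤ c := mul_le_of_le_one_right hc.le h1
    have hpt : ∀ q, |Z (x + (c * t) • sph b q)| ≤ B * ((2 + c) ^ (k + 1) * jb r ^ (-(k + 1))) := by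
      intro q
      set y := x + (c * t) • sph b q with hy
      refine (h y (hmem q)).trans (mul_le_mul_of_nonneg_left ?_ hB)
      refine jb_neg_rpow_le hm (by linarith) ?_
      have h2 : r ≤ ‖y‖ + c * t := by
        have h3 : x = y - (c * t) • sph b q := by rw [hy]; abel
        have h4 := norm_sub_le y ((c * t) • sph b q)
        rwa [← h3, norm_smul, norm_sph hb, mul_one, Real.norm_eq_abs, abs_of_pos hct] at h4
      have h3 := jb_le_one_add hr0.le
      have h4 := one_le_jb ‖y‖
      have h5 := abs_le_jb ‖y‖
      rw [abs_norm] at h5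
      nlinarith
    have hint : ∫ q in angles, Real.sin q.1 * |Z (x + (c * t) • sph b q)|
        ≤ 4 * Real.pi * (B * ((2 + c) ^ (k + 1) * jb r ^ (-(k + 1)))) := by
      rw [← integral_sin_angles, ← integral_mul_const]
      refine setIntegral_mono_on ?_ ?_ isCompact_angles.measurableSet fun q hq =>
        mul_le_mul_of_nonneg_left (hpt q) (sin_nonneg_of_mem_angles hq)
      · exact (Continuous.continuousOn (by fun_prop)).integrableOn_compact isCompact_angles
      · exact (Continuous.continuousOn (by fun_prop)).integrableOn_compact isCompact_angles
    have hjE : jb r ^ (-(k + 1)) ≤ 3 * (2 + c) ^ (k - 1) * E := by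
      have a1 : (jb r)⁻¹ ≤ 3 * (jb (t + r))⁻¹ := by
        rw [← div_eq_mul_inv, le_div_iff₀ (jb_pos _), inv_mul_le_iff₀ (jb_pos _)]
        have := jb_le_one_add (by linarith : 0 ≤ t + r)
        linarith
      have a2 : jb r ^ (-(k - 1)) ≤ (2 + c) ^ (k - 1) * jb (c * t - r) ^ (-(k - 1)) := by
        refine jb_neg_rpow_le hm (by linarith) ?_
        have h2 := jb_le_one_add_abs (c * t - r)
        have h3 : |c * t - r| ≤ c + r := abs_le.2 ⟨by linarith, by linarith⟩
        nlinarith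
      calc jb r ^ (-(k + 1)) ≤ jb r ^ (-(k - 1) - 1) := jb_rpow_le_jb_rpow r (by linarith)
        _ = (jb r)⁻¹ * jb r ^ (-(k - 1)) := (inv_mul_rpow_sub _ _).symm
        _ ≤ (3 * (jb (t + r))⁻¹) * ((2 + c) ^ (k - 1) * jb (c * t - r) ^ (-(k - 1))) :=
            mul_le_mul a1 a2 (jb_rpow_nonneg _ _)
              (mul_nonneg (by norm_num) (inv_pos.2 (jb_pos _)).le)
        _ = _ := by rw [hEdef, neg_sub]; ring
    calc _ ≤ 2 * (4 * Real.pi * (B * ((2 + c) ^ (k + 1) * jb r ^ (-(k + 1))))) :=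
          mul_le_mul (by linarith : 1 + t ≤ 2) hint (setIntegral_nonneg isCompact_angles.measurableSet
            fun q hq => mul_nonneg (sin_nonneg_of_mem_angles hq) (abs_nonneg _)) (by norm_num)
      _ ≤ 2 * (4 * Real.pi * (B * ((2 + c) ^ (k + 1) * (3 * (2 + c) ^ (k - 1) * E)))) := by gcongr
      _ = C₂ * (B * E) := by rw [hC₂]; ring
      _ ≤ _ := le_add_of_nonneg_left (mul_nonneg hC₁0.le hBE)

section NormB

variable {φ ψ : E3 → ℝ}

theorem normB_nonneg (ρ : ℝ) (s : ℕ) (φ ψ : E3 → ℝ) (c t : ℝ) (x : E3) :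
    0 ≤ normB ρ s φ ψ c t x := by
  refine Real.sSup_nonneg ?_
  rintro _ ⟨y, -, rfl⟩
  exact mul_nonneg (jb_rpow_nonneg _ _) (add_nonneg (zNorm_nonneg _ _ _) (zNorm_nonneg _ _ _))

theorem dataDensity_le_normB (hφ : ContDiff ℝ ∞ φ) (hψ : ContDiff ℝ ∞ ψ) (ρ : ℝ) {c t : ℝ}
    {x y : E3} (hy : y ∈ coneBase c t x) :
    dataDensity φ ψ y ≤ normB ρ 2 φ ψ c t x * jb ‖y‖ ^ (-ρ) := by
  have hcomp : IsCompact (coneBase c t x) := by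
    have : coneBase c t x = Metric.closedBall x (c * t) := by
      ext y; simp [coneBase, dist_eq_norm]
    rw [this]; exact isCompact_closedBall _ _
  have hcont : Continuous fun y : E3 => jb ‖y‖ ^ ρ * dataDensity φ ψ y :=
    ((continuous_jb_rpow ρ).comp continuous_norm).mul (continuous_dataDensity hφ hψ)
  have h : jb ‖y‖ ^ ρ * dataDensity φ ψ y ≤ normB ρ 2 φ ψ c t x :=
    le_csSup (hcomp.bddAbove_image hcont.continuousOn) (mem_image_of_mem _ hy)
  rw [Real.rpow_neg (jb_pos _).le, ← div_eq_mul_inv,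
    le_div_iff₀ (Real.rpow_pos_of_pos (jb_pos _) _), mul_comm]
  exact h

end NormB

/-- The characteristic ends on the initial surface at distance `ct + r` from the origin. The factor
`ρ` in `charFun` costs one power of `⟨ct + r⟩`, which the exponent `κ + μ + 1` of the data norm can
afford. -/
theorem abs_charFun_le_data {c t : ℝ} (hc : 0 < c) (ht : 0 < t) {φ ψ : E3 → ℝ} {u : ℝ × E3 → ℝ}
    (hφ : ContDiff ℝ ∞ φ) (hu : IsSolution c (fun _ => 0) φ ψ u) {r : ℝ} (hr : 0 < r) {ν : E3}
    (hν : ‖ν‖ = 1) :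
    |charFun c t r 0 ν u 1| ≤ (1 + 4 * c) * jb (c * t + r) * dataDensity φ ψ ((c * t + r) • ν) := by
  have hX : 0 < c * t + r := add_pos (mul_pos hc ht) hr
  have e : charFun c t r 0 ν u 1 = (c * t + r) * (ψ ((c * t + r) • ν)
      + hD (fun p : ℝ × E3 => φ p.2) (0, (c * t + r) • ν) ((0 : ℝ), c • ν))
      + c * φ ((c * t + r) • ν) := by
    rw [hD_comp_snd hφ (mem_halfSpace.2 le_rfl)]
    simp only [charFun, backPt, sub_self, mul_zero, mul_one, zero_add,
      hD_zero_of_init hu (hφ.of_le (by norm_cast)), hu.init, one_mul, add_comm r]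
  set X := c * t + r
  set y := X • ν
  obtain ⟨hZf, hZg⟩ := zNormData_le_dataDensity φ ψ y
  have hZ0 := dataDensity_nonneg φ ψ y
  have b1 : |φ y| ≤ dataDensity φ ψ y :=
    (abs_zField_iterate_le_zNorm (fun p : ℝ × E3 => φ p.2) (0, y) 0 (n := 0) (by norm_num)).trans hZf
  have b2 : |ψ y| ≤ dataDensity φ ψ y :=
    (abs_zField_iterate_le_zNorm (fun p : ℝ × E3 => ψ p.2) (0, y) 0 (n := 0) (by norm_num)).trans hZg
  have b3 : |hD (fun p : ℝ × E3 => φ p.2) (0, y) ((0 : ℝ), c • ν)| ≤ 3 * c * dataDensity φ ψ y := by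
    refine (abs_hD_le_zNorm _ _ _ _ (s := 3) (by norm_num)).trans ?_
    rw [norm_smul, hν, abs_zero, zero_add, mul_one, Real.norm_eq_abs, abs_of_pos hc]
    exact mul_le_mul_of_nonneg_left hZf (by positivity)
  rw [e]
  generalize dataDensity φ ψ y = Z at *
  have hXj := (le_abs_self X).trans (abs_le_jb X)
  have hj := one_le_jb X
  have hs := (abs_add_le _ _).trans (add_le_add b2 b3)
  refine (abs_add_le _ _).trans ?_
  rw [abs_mul, abs_mul, abs_of_pos hX, abs_of_pos hc]
  calc _ ≤ jb X * (Z + 3 * c * Z) + c * Z :=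
        add_le_add (mul_le_mul hXj hs (abs_nonneg _) (jb_pos X).le)
          (mul_le_mul_of_nonneg_left b1 hc.le)
    _ ≤ jb X * (Z + 3 * c * Z) + jb X * (c * Z) :=
        add_le_add le_rfl (le_mul_of_one_le_left (mul_nonneg hc.le hZ0) hj)
    _ = _ := by ring

theorem dPlus_homogeneous {c : ℝ} (hc : 0 < c) {κ μ : ℝ} (hκ1 : 1 ≤ κ) (hκ2 : κ ≤ 2) (hμ : 0 < μ) :
    ∃ C : ℝ, 0 < C ∧ ∀ (φ ψ : E3 → ℝ) (u : ℝ × E3 → ℝ), ContDiff ℝ ∞ φ → ContDiff ℝ ∞ ψ →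
      IsSolution c (fun _ => 0) φ ψ u →
      ∀ (t : ℝ) (x : E3), 0 < t → x ≠ 0 →
        jb ‖x‖ * jb (t + ‖x‖) * jb (c * t - ‖x‖) ^ (κ - 1) * |dPlus c u (t, x)|
          ≤ C * normB (κ + μ + 1) 2 φ ψ c t x := by
  obtain ⟨C₀, hC₀, hsph⟩ := spherical_integral_le hc (k := κ + μ) (by linarith)
  obtain ⟨CF, hCF, hchar⟩ := char_integral_fast hκ1 hκ2 hμ
  -- There is no source, so the empty family of speeds serves and `M = 0` below. The rotational
  -- derivatives have the better exponent `β = κ + μ - 1`, which prevents a logarithm.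
  obtain ⟨C8, hC8, hout⟩ := mul_abs_dPlus_le hc (cs := Fin.elim0) (fun j => j.elim0) (κ := κ)
    (μ := μ) (η := 0) (β := κ + μ - 1) (by linarith) hμ zero_le_one
  set A₀ := (1 + 9 * c + 18 * c ^ 2) * C₀ with hA₀
  set A₁ := c * ((1 + 3 * c) * C₀) with hA₁
  set A₂ := (1 + 4 * c) + C8 * ((1 + 3 * c) * C₀ * CF) with hA₂
  have hA₀0 : 0 < A₀ := by positivity
  have hA₁0 : 0 < A₁ := by positivity
  have hA₂0 : 0 < A₂ := by positivity
  refine ⟨2 * A₀ + (2 * A₁ + 2 * (1 + 1 / c) * A₂), by positivity, ?_⟩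
  intro φ ψ u hφ hψ hu t x ht hx
  set B := normB (κ + μ + 1) 2 φ ψ c t x with hBdef
  have hB : 0 ≤ B := normB_nonneg _ _ _ _ _ _ _
  set r := ‖x‖ with hr
  have hr0 : 0 < r := norm_pos_iff.2 hx
  have hct : 0 < c * t := mul_pos hc ht
  have hxmem : (t, x) ∈ cone c t x := ⟨ht.le, le_rfl, by simp⟩
  have hI : ∀ (τ : ℝ) (y : E3) (b : Fin 3 → E3), 0 < τ → y ≠ 0 → (τ, y) ∈ cone c t x →
      Orthonormal ℝ b → b 2 = ‖y‖⁻¹ • y →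
      (1 + τ) * ∫ q in angles, Real.sin q.1 * |dataDensity φ ψ (y + (c * τ) • sph b q)|
        ≤ C₀ * B * ((jb (τ + ‖y‖))⁻¹ * jb (c * τ - ‖y‖) ^ (1 - (κ + μ))) := by
    intro τ y b hτ hy hmem hb hb2
    refine hsph _ τ y b B (continuous_dataDensity hφ hψ) hτ hy hb hb2 hB fun z hz => ?_
    rw [abs_of_nonneg (dataDensity_nonneg _ _ _)]
    exact dataDensity_le_normB hφ hψ _ (coneBase_subset hmem hz)
  obtain ⟨b, hb, hb2⟩ := exists_frame hx
  -- The surplus `μ` is needed only under the characteristic integral; for the bounds at the point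
  -- itself it is dropped.
  have hE : (jb (t + r))⁻¹ * jb (c * t - r) ^ (1 - (κ + μ))
      ≤ (jb (t + r))⁻¹ * jb (c * t - r) ^ (1 - κ) :=
    mul_le_mul_of_nonneg_left (jb_rpow_le_jb_rpow _ (by linarith)) (inv_pos.2 (jb_pos _)).le
  have hIx := (hI t x b ht hx hxmem hb hb2).trans
    (mul_le_mul_of_nonneg_left hE (by positivity : 0 ≤ C₀ * B))
  rcases le_total r 1 with hr1 | hr1
  · have h := (abs_dPlus_le_data hc ht hφ hψ hu hx hb).trans
      (mul_le_mul_of_nonneg_left hIx (by positivity))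
    rw [← mul_assoc _ (C₀ * B), ← mul_assoc _ C₀] at h
    refine (weighted_le_of_inner hr0.le hr1 (by positivity) h).trans ?_
    have : 0 ≤ (2 * A₁ + 2 * (1 + 1 / c) * A₂) * B := by positivity
    rw [← hA₀]
    linarith
  · have hu1 := (abs_sol_le_data hc ht hφ hψ hu x hb).trans
      (mul_le_mul_of_nonneg_left hIx (by positivity))
    have h := hout (fun _ => 0) u continuousOn_const hu.contDiffOn hu.eqn t x 0
      ((1 + 3 * c) * (C₀ * B)) ht hx le_rfl (by positivity) (fun p _ => by simp) (by
        intro j k hjk τ y hτ hy hmem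
        obtain ⟨b', hb', hb2'⟩ := exists_frame hy
        refine (abs_rot_rot_le_data hc hτ hφ hψ hu y hb' hjk).trans
          ((mul_le_mul_of_nonneg_left (hI τ y b' hτ hy hmem hb' hb2')
            (by positivity)).trans (le_of_eq ?_))
        rw [sub_zero, Real.rpow_neg_one, neg_sub, ← mul_assoc])
    rw [zero_mul, zero_add, sub_zero, Real.rpow_neg_one, ← hr] at h
    have hν : ‖r⁻¹ • x‖ = 1 := by
      rw [norm_smul, norm_inv, hr, norm_norm, inv_mul_cancel₀ hr0.ne']
    have hXm : (c * t + r) • (r⁻¹ • x) ∈ coneBase c t x := by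
      have : (c * t + r) • (r⁻¹ • x) - x = (c * t) • (r⁻¹ • x) := by
        rw [add_smul, smul_smul r, mul_inv_cancel₀ hr0.ne', one_smul, add_sub_cancel_right]
      simp only [coneBase, mem_ofPred_eq, this, norm_smul (c * t), hν, Real.norm_eq_abs,
        abs_of_pos hct, mul_one, le_refl]
    have hXn : ‖(c * t + r) • (r⁻¹ • x)‖ = c * t + r := by
      rw [norm_smul, hν, mul_one, Real.norm_eq_abs, abs_of_pos (by linarith)]
    have hZ := dataDensity_le_normB hφ hψ (κ + μ + 1) hXm
    rw [hXn, ← hBdef] at hZ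
    have hch : |charFun c t r 0 (r⁻¹ • x) u 1| ≤ (1 + 4 * c) * B * jb (c * t + r) ^ (-κ) := by
      have hj := jb_pos (c * t + r)
      have e : jb (c * t + r) * jb (c * t + r) ^ (-(κ + μ + 1)) = jb (c * t + r) ^ (-(κ + μ)) := by
        nth_rewrite 1 [← Real.rpow_one (jb (c * t + r))]
        rw [← Real.rpow_add hj]
        congr 1; ring
      calc _ ≤ (1 + 4 * c) * jb (c * t + r) * (B * jb (c * t + r) ^ (-(κ + μ + 1))) :=
            (abs_charFun_le_data hc ht hφ hu hr0 hν).trans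
              (mul_le_mul_of_nonneg_left hZ (by positivity))
        _ = (1 + 4 * c) * B * (jb (c * t + r) * jb (c * t + r) ^ (-(κ + μ + 1))) := by ring
        _ ≤ _ := by
            rw [e]
            exact mul_le_mul_of_nonneg_left (jb_rpow_le_jb_rpow _ (by linarith)) (by positivity)
    have hJ : (jb (c * t + r))⁻¹ * ∫ s in r..(c * t + r),
        s⁻¹ * jb (c * t + r - 2 * s) ^ (-(κ + μ - 1)) ≤ CF * jb (c * t + r) ^ (-κ) := by
      refine (mul_le_mul_of_nonneg_left (hchar r (c * t + r) hr1 (by linarith))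
        (inv_pos.2 (jb_pos _)).le).trans (le_of_eq ?_)
      rw [mul_left_comm, inv_mul_rpow_sub]
      congr 2; ring
    have hfin : r * |dPlus c u (t, x)| ≤ A₁ * B * ((jb (t + r))⁻¹ * jb (c * t - r) ^ (1 - κ))
        + A₂ * B * jb (c * t + r) ^ (-κ) := by
      have h1 := mul_le_mul_of_nonneg_left hu1 hc.le
      have h2 := mul_le_mul_of_nonneg_left (mul_le_mul_of_nonneg_left hJ
        (by positivity : 0 ≤ (1 + 3 * c) * (C₀ * B))) hC8.le
      refine (h.trans (add_le_add_three h1 hch h2)).trans (le_of_eq ?_)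
      rw [hA₁, hA₂]; ring
    refine (weighted_le_of_outer hc ht hr1 hκ1 (by positivity) (abs_nonneg _) hfin).trans ?_
    have : 0 ≤ 2 * A₀ * B := by positivity
    linarith

end WaveDecay

theorem theorem2p1 (c : ℝ) (hc : 0 < c) (N : ℕ) (cs : Fin N → ℝ) (hcs : ∀ j, 0 < cs j)
    (κ μ : ℝ) (hκ1 : 1 ≤ κ) (hκ2 : κ ≤ 2) (hμ : 0 < μ) :
    (∃ C : ℝ, 0 < C ∧ ∀ G u : ℝ × E3 → ℝ, ContDiffOn ℝ ∞ G halfSpace →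
      IsSolution c G (fun _ => 0) (fun _ => 0) u →
      ∀ (t : ℝ) (x : E3), 0 < t → x ≠ 0 →
        jb ‖x‖ * jb (t + ‖x‖) * jb (c * t - ‖x‖) ^ (κ - 1) * (Real.log (2 + t + ‖x‖))⁻¹
            * |dPlus c u (t, x)|
          ≤ C * normA cs κ μ 2 G c t x) ∧
    (1 < κ → κ < 2 → ∀ δ : ℝ, 0 < δ →
      ∃ C : ℝ, 0 < C ∧ ∀ G u : ℝ × E3 → ℝ, ContDiffOn ℝ ∞ G halfSpace →
        IsSolution c G (fun _ => 0) (fun _ => 0) u →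
        ∀ (t : ℝ) (x : E3), 0 < t → δ * t < ‖x‖ →
          jb (t + ‖x‖) ^ 2 * jb (c * t - ‖x‖) ^ (κ - 1) * |dPlus c u (t, x)|
            ≤ C * normA cs κ μ 2 G c t x) ∧
    (∃ C : ℝ, 0 < C ∧ ∀ (φ ψ : E3 → ℝ) (u : ℝ × E3 → ℝ), ContDiff ℝ ∞ φ → ContDiff ℝ ∞ ψ →
      IsSolution c (fun _ => 0) φ ψ u →
      ∀ (t : ℝ) (x : E3), 0 < t → x ≠ 0 →
        jb ‖x‖ * jb (t + ‖x‖) * jb (c * t - ‖x‖) ^ (κ - 1) * |dPlus c u (t, x)|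
          ≤ C * normB (κ + μ + 1) 2 φ ψ c t x) := by
  refine ⟨?_, fun h1 h2 δ hδ => dPlus_inhomogeneous_far hc hcs h1 h2 hμ hδ,
    dPlus_homogeneous hc hκ1 hκ2 hμ⟩
  obtain ⟨C, hC, h⟩ := dPlus_inhomogeneous_log hc hcs hκ1 hκ2 hμ
  refine ⟨C, hC, fun G u hG hu t x ht hx => ?_⟩
  have hL : 0 < Real.log (2 + (t + ‖x‖)) := Real.log_pos (by linarith [norm_nonneg x])
  have hx := h G u hG hu t x ht hx
  rw [add_assoc, mul_right_comm, ← div_eq_mul_inv, div_le_iff₀ hL]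
  exact hx.trans (le_of_eq (by ring))
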